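/- Let $\mathcal C$ be the category whose objects are triple vector bundles (smooth, of finite rank, real, satisfying the splitting condition, over arbitrary smooth manifolds $M$), and whose morphisms are the statomorphisms, i.e. the isomorphisms of triple vector bundles that induce the identity on each of the building bundles $E_1,E_2,E_3,E_{12},E_{23},E_{31},E_{123}$ (the side bundles, the cores of the lower faces, and the ultracore). All morphisms of $\mathcal C$ are invertible. For $I\subset\{0,1,2,3\}$ nonempty and proper put $E_I^*=E_{I^c}$; in particular $E_0=E_{123}^*$. Let $X,Y,Z:\mathcal C\to\mathcal C^{\mathrm{op}}$ be the functors that dualize a triple vector bundle $E$ as a vector bundle over its face $E_{2,3}$, $E_{1,3}$, $E_{1,2}$, respectively; since $\mathcal C$ is a groupoid they can be composed. Let $DG_3$ be the group of functors generated by $X,Y,Z$ under composition (with $E^{VW}=(E^V)^W$), where two functors are identified if there is a natural isomorphism between them through statomorphisms. Let $S_4$ be the group of permutations of $\{0,1,2,3\}$. **Theorem.** The functors $X,Y,Z$ are invertible up to natural isomorphism, so that $DG_3$ is a group, and there is a group homomorphism $\pi:DG_3\to S_4$ such that, for every $W\in DG_3$ with $\sigma=\pi(W)$ and every triple vector bundle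 $E$ with building bundles $E_I$, the triple vector bundle $E^W$ has the building bundles $E_{\sigma(1)},E_{\sigma(2)},E_{\sigma(3)},E_{\sigma(1)\sigma(2)},E_{\sigma(2)\sigma(3)},E_{\sigma(3)\sigma(1)},E_{\sigma(1)\sigma(2)\sigma(3)}$. Let $K_4=\ker\pi$. 1. $\pi$ is surjective, so $DG_3$ is an extension of $S_4$ by $K_4$: there is a short exact sequence $1\to K_4\to DG_3\xrightarrow{\pi} S_4\to 1$. 2. Conjugation in $DG_3$ induces an action of $S_4$ on $K_4$, and with it $K_4$ is isomorphic, as an $S_4$-module, to the normal subgroup $\{1,(12)(30),(23)(10),(13)(20)\}$ of $S_4$ with the action by conjugation. 3. The extension $1\to K_4\to DG_3\to S_4\to 1$ does not split. -/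

import Mathlib

noncomputable section

open scoped Manifold ContDiff
open Bundle CategoryTheory

namespace TripleVB

/-! ### Manifolds and vector bundles -/

/-- A smooth manifold (finite dimensional, without boundary, Hausdorff, second countable). -/
structure SmoothManifold where
  carrier : Type
  dim : ℕ
  [top : TopologicalSpace carrier]
  [t2 : T2Space carrier]
  [sc : SecondCountableTopology carrier]
  [charted : ChartedSpace (EuclideanSpace ℝ (Fin dim)) carrier]
  [mfd : IsManifold (𝓡 dim) ∞ carrier]

attribute [instance] SmoothManifold.top SmoothManifold.t2 SmoothManifold.sc
  SmoothManifold.charted SmoothManifold.mfd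

/-- A smooth real vector bundle of finite rank over `M`, with model fibre `F` and fibres `E m`. -/
structure SmoothVB (M : SmoothManifold) where
  F : Type
  [nacgF : NormedAddCommGroup F]
  [nsF : NormedSpace ℝ F]
  [fdF : FiniteDimensional ℝ F]
  E : M.carrier → Type
  [acg : ∀ m, AddCommGroup (E m)]
  [mod : ∀ m, Module ℝ (E m)]
  [topE : ∀ m, TopologicalSpace (E m)]
  [topT : TopologicalSpace (TotalSpace F E)]
  [fb : FiberBundle F E]
  [vb : VectorBundle ℝ F E]
  [smooth : ContMDiffVectorBundle ∞ F E (𝓡 M.dim)]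

attribute [instance] SmoothVB.nacgF SmoothVB.nsF SmoothVB.fdF SmoothVB.acg SmoothVB.mod
  SmoothVB.topE SmoothVB.topT SmoothVB.fb SmoothVB.vb SmoothVB.smooth

/-- The map `u ↦ s u ∈ E_{q u}` from `ℝᵈ` to the total space of the vector bundle is smooth
at `u₀`. -/
def SmoothVB.SmoothAt {M : SmoothManifold} (V : SmoothVB M) {d : ℕ}
    (q : EuclideanSpace ℝ (Fin d) → M.carrier) (s : ∀ u, V.E (q u))
    (u₀ : EuclideanSpace ℝ (Fin d)) : Prop :=
  ContMDiffAt (𝓡 d) ((𝓡 M.dim).prod 𝓘(ℝ, V.F)) ∞ (fun u => TotalSpace.mk' V.F (q u) (s u)) u₀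

/-- Labels of building bundles: the nonempty proper subsets of `{0,1,2,3}`. -/
abbrev Lab := {I : Finset (Fin 4) // I.Nonempty ∧ I ≠ Finset.univ}

/-- The complementary label. -/
def Lab.compl (I : Lab) : Lab :=
  ⟨I.1ᶜ, by
    obtain ⟨I, h1, h2⟩ := I
    revert I; decide⟩

/-- A system of building bundles: vector bundles `E_I` over a manifold `M` for all nonempty proper
`I ⊆ {0,1,2,3}`, with `E_I` and `E_{Iᶜ}` dual to each other through a smooth fibrewise perfect
pairing (so `E_I^* = E_{Iᶜ}`, compatibly with `E_I^{**} = E_I`). It amounts to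
the seven bundles `E_I`, `∅ ≠ I ⊆ {1,2,3}`, together with their duals. -/
structure BuildingSystem where
  M : SmoothManifold
  V : Lab → SmoothVB M
  pair : ∀ I J : Lab, IsCompl I.1 J.1 → ∀ m, (V I).E m →ₗ[ℝ] (V J).E m →ₗ[ℝ] ℝ
  pair_bijective : ∀ I J h m, Function.Bijective (pair I J h m)
  pair_symm : ∀ I J h m x y, pair I J h m x y = pair J I h.symm m y x
  pair_smooth : ∀ (I J : Lab) (h : IsCompl I.1 J.1) (d : ℕ)
    (q : EuclideanSpace ℝ (Fin d) → M.carrier) (s : ∀ u, (V I).E (q u)) (t : ∀ u, (V J).E (q u))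
    (u₀ : EuclideanSpace ℝ (Fin d)), (V I).SmoothAt q s u₀ → (V J).SmoothAt q t u₀ →
    ContDiffAt ℝ ∞ (fun u => pair I J h (q u) (s u) (t u)) u₀

/-- The fibre of the building bundle `E_I` over the point `m`. -/
abbrev BuildingSystem.E (B : BuildingSystem) (I : Lab) (m : B.M.carrier) : Type := (B.V I).E m

/-- The three directions of a triple vector bundle whose ultracore is dual to `E_o`. -/
abbrev Dir (o : Fin 4) := {i : Fin 4 // i ≠ o}

/-- The labels of the seven building bundles of a triple vector bundle whose ultracore is
dual to `E_o`. -/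
abbrev Coord (o : Fin 4) := {I : Lab // o ∉ I.1}

/-! ### Triple vector bundles, algebraic part -/

/-- The algebraic part of a triple vector bundle with building bundles `E_I`, `o ∉ I`. For
`o = 0` these are `E_1, E_2, E_3, E_12, E_23, E_31, E_123`.

`T m` is the fibre over `m ∈ M` of the total space `E_{1,2,3} → M`. Each direction `i` carries
a vector bundle structure whose base (the face `E_{j,k}` opposite to `i`) is identified with the
image of its zero section: the scalar multiplication is `smul i`, the projection (followed by the
zero section) is `smul i 0`, and `add i x y` is the sum of two elements with the same projection
(its values on other pairs are irrelevant). The structures in different directions are compatible: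
the structure maps of one are vector bundle morphisms for the other. The lower faces, with
their structures, are the images of the projections. `core I` identifies `E_I` with the
corresponding side bundle (`I` a singleton), core (`I` a pair) or ultracore. -/
structure PreTVB (B : BuildingSystem) (o : Fin 4) where
  T : B.M.carrier → Type
  smul : ∀ {m}, Dir o → ℝ → T m → T m
  add : ∀ {m}, Dir o → T m → T m → T m
  zero : ∀ m, T m
  core : ∀ {m} (I : Coord o), B.E I.1 m → T m
  -- vector bundle structure in direction `i`
  one_smul : ∀ {m} i (x : T m), smul i 1 x = x
  mul_smul : ∀ {m} i a b (x : T m), smul i (a * b) x = smul i a (smul i b x)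
  add_smul : ∀ {m} i a b (x : T m), smul i (a + b) x = add i (smul i a x) (smul i b x)
  smul_add : ∀ {m} i a (x y : T m), smul i 0 x = smul i 0 y →
    smul i a (add i x y) = add i (smul i a x) (smul i a y)
  proj_add : ∀ {m} i (x y : T m), smul i 0 x = smul i 0 y → smul i 0 (add i x y) = smul i 0 x
  add_comm : ∀ {m} i (x y : T m), smul i 0 x = smul i 0 y → add i x y = add i y x
  add_assoc : ∀ {m} i (x y z : T m), smul i 0 x = smul i 0 y → smul i 0 y = smul i 0 z →
    add i (add i x y) z = add i x (add i y z)
  add_proj : ∀ {m} i (x : T m), add i x (smul i 0 x) = x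
  -- compatibility of the structures in two directions
  smul_smul_comm : ∀ {m} i j a b (x : T m), i ≠ j →
    smul i a (smul j b x) = smul j b (smul i a x)
  smul_add_comm : ∀ {m} i j a (x y : T m), i ≠ j → smul j 0 x = smul j 0 y →
    smul i a (add j x y) = add j (smul i a x) (smul i a y)
  add_add_comm : ∀ {m} i j (x y z w : T m), i ≠ j →
    smul i 0 x = smul i 0 y → smul i 0 z = smul i 0 w →
    smul j 0 x = smul j 0 z → smul j 0 y = smul j 0 w →
    add j (add i x y) (add i z w) = add i (add j x z) (add j y w)
  -- the intersection of all the bases is `M`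
  proj_zero : ∀ i m, smul i 0 (zero m) = zero m
  eq_zero : ∀ {m} (x : T m), (∀ i, smul i 0 x = x) → x = zero m
  -- the building bundles
  core_injective : ∀ {m} I, Function.Injective (core (m := m) I)
  range_core : ∀ {m} (I : Coord o), Set.range (core (m := m) I) =
    {x | ∀ i : Dir o, (i.1 ∈ I.1.1 → smul i 0 x = zero m) ∧ (i.1 ∉ I.1.1 → smul i 0 x = x)}
  core_add : ∀ {m} (I : Coord o) (i : Dir o) (x y : B.E I.1 m), i.1 ∈ I.1.1 →
    core I (x + y) = add i (core I x) (core I y)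
  core_smul : ∀ {m} (I : Coord o) (i : Dir o) (a : ℝ) (x : B.E I.1 m), i.1 ∈ I.1.1 →
    core I (a • x) = smul i a (core I x)

variable {B : BuildingSystem} {o : Fin 4}

/-- The fibre over `m` of the decomposed triple vector bundle. -/
abbrev DecFibre (B : BuildingSystem) (o : Fin 4) (m : B.M.carrier) : Type :=
  ∀ I : Coord o, B.E I.1 m

/-- The decomposed triple vector bundle with building bundles `E_I`, `o ∉ I`. -/
abbrev dec (B : BuildingSystem) (o : Fin 4) : PreTVB B o where
  T := DecFibre B o
  smul i a e := fun I => if i.1 ∈ I.1.1 then a • e I else e I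
  add i e e' := fun I => if i.1 ∈ I.1.1 then e I + e' I else e I
  zero m := 0
  core I x := Pi.single I x
  one_smul i x := by funext I; simp
  mul_smul i a b x := by funext I; by_cases hi : i.1 ∈ I.1.1 <;> simp [hi, smul_smul]
  add_smul i a b x := by funext I; by_cases hi : i.1 ∈ I.1.1 <;> simp [hi, _root_.add_smul]
  smul_add i a x y h := by funext I; by_cases hi : i.1 ∈ I.1.1 <;> simp [hi]
  proj_add i x y h := by funext I; by_cases hi : i.1 ∈ I.1.1 <;> simp [hi]
  add_comm i x y h := by
    funext I
    have := congrFun h I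
    by_cases hi : i.1 ∈ I.1.1
    · simp [hi, _root_.add_comm]
    · simpa [hi] using this
  add_assoc i x y z h h' := by
    funext I; by_cases hi : i.1 ∈ I.1.1 <;> simp [hi, _root_.add_assoc]
  add_proj i x := by funext I; by_cases hi : i.1 ∈ I.1.1 <;> simp [hi]
  smul_smul_comm i j a b x hij := by
    funext I
    by_cases hi : i.1 ∈ I.1.1 <;> by_cases hj : j.1 ∈ I.1.1 <;>
      simp [hi, hj, smul_smul, mul_comm]
  smul_add_comm i j a x y hij h := by
    funext I
    by_cases hi : i.1 ∈ I.1.1 <;> by_cases hj : j.1 ∈ I.1.1 <;> simp [hi, hj]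
  add_add_comm i j x y z w hij h1 h2 h3 h4 := by
    funext I
    by_cases hi : i.1 ∈ I.1.1 <;> by_cases hj : j.1 ∈ I.1.1 <;>
      simp [hi, hj, add_add_add_comm]
  proj_zero i m := by funext I; simp
  eq_zero x h := by
    funext I
    have hne : ∃ i : Dir o, i.1 ∈ I.1.1 := by
      obtain ⟨i, hi⟩ := I.1.2.1
      exact ⟨⟨i, fun h => I.2 (h ▸ hi)⟩, hi⟩
    obtain ⟨i, hi⟩ := hne
    have := congrFun (h i) I
    simpa [hi] using this.symm
  core_injective {m} I := Pi.single_injective (M := fun I : Coord o => B.E I.1 m) I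
  range_core {m} I := by
    ext x
    constructor
    · rintro ⟨y, rfl⟩ i
      refine ⟨fun hi => ?_, fun hi => ?_⟩ <;> funext J <;> by_cases hJ : J = I
      · subst hJ; simp [hi]
      · simp [hJ]
      · subst hJ; simp [hi]
      · simp [hJ]
    · intro h
      refine ⟨x I, ?_⟩
      funext J
      by_cases hJ : J = I
      · subst hJ; simp
      · refine (Pi.single_eq_of_ne hJ _).trans ?_
        by_contra hx
        apply hJ
        apply Subtype.ext; apply Subtype.ext
        ext k
        by_cases hk : k = o
        · subst hk; exact ⟨fun h => (J.2 h).elim, fun h => (I.2 h).elim⟩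
        · have h1 := h ⟨k, hk⟩
          constructor
          · intro hkJ
            by_contra hkI
            have := congrFun (h1.2 hkI) J
            simp only [hkJ, if_true, zero_smul] at this
            exact hx this
          · intro hkI
            by_contra hkJ
            have := congrFun (h1.1 hkI) J
            simp only [hkJ, if_false] at this
            exact hx this.symm
  core_add I i x y hi := by
    funext J
    by_cases hJ : J = I
    · subst hJ; simp [hi]
    · simp [hJ]
  core_smul I i a x hi := by
    funext J
    by_cases hJ : J = I
    · subst hJ; simp [hi]
    · simp [hJ]

namespace PreTVB

/-- Transport of the structure along bijections. -/
abbrev transport (S : PreTVB B o) (T' : B.M.carrier → Type) (e : ∀ m, T' m ≃ S.T m) :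
    PreTVB B o where
  T := T'
  smul i a x := (e _).symm (S.smul i a (e _ x))
  add i x y := (e _).symm (S.add i (e _ x) (e _ y))
  zero m := (e _).symm (S.zero m)
  core I x := (e _).symm (S.core I x)
  one_smul i x := by simp [S.one_smul]
  mul_smul i a b x := by simp [S.mul_smul]
  add_smul i a b x := by simp [S.add_smul]
  smul_add i a x y h := by simpa using S.smul_add i a _ _ ((e _).symm.injective h)
  proj_add i x y h := by simpa using S.proj_add i _ _ ((e _).symm.injective h)
  add_comm i x y h := by simpa using S.add_comm i _ _ ((e _).symm.injective h)
  add_assoc i x y z h h' := by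
    simpa using S.add_assoc i _ _ _ ((e _).symm.injective h) ((e _).symm.injective h')
  add_proj i x := by simp [S.add_proj]
  smul_smul_comm i j a b x hij := by simp [S.smul_smul_comm i j a b _ hij]
  smul_add_comm i j a x y hij h := by
    simpa using S.smul_add_comm i j a _ _ hij ((e _).symm.injective h)
  add_add_comm i j x y z w hij h1 h2 h3 h4 := by
    simpa using S.add_add_comm i j _ _ _ _ hij ((e _).symm.injective h1)
      ((e _).symm.injective h2) ((e _).symm.injective h3) ((e _).symm.injective h4)
  proj_zero i m := by simp [S.proj_zero]
  eq_zero x h := by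
    apply (e _).injective
    rw [Equiv.apply_symm_apply]
    exact S.eq_zero _ fun i => by simpa using congrArg (e _) (h i)
  core_injective I := (e _).symm.injective.comp (S.core_injective I)
  range_core {m} I := by
    ext x
    have := Set.ext_iff.1 (S.range_core (m := m) I) (e _ x)
    simp only [Set.mem_range, Set.mem_ofPred_eq, Equiv.symm_apply_eq, Equiv.apply_symm_apply]
      at this ⊢
    exact this
  core_add I i x y hi := by simp [S.core_add I i x y hi]
  core_smul I i a x hi := by simp [S.core_smul I i a x hi]

end PreTVB

/-- An algebraic statomorphism: an isomorphism for all three vector bundle structures that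
induces the identity on `M` and on each of the building bundles. -/
@[ext] structure Stat (S T : PreTVB B o) where
  equiv : ∀ m, S.T m ≃ T.T m
  map_smul : ∀ {m} i a (x : S.T m), equiv m (S.smul i a x) = T.smul i a (equiv m x)
  map_add : ∀ {m} i (x y : S.T m), S.smul i 0 x = S.smul i 0 y →
    equiv m (S.add i x y) = T.add i (equiv m x) (equiv m y)
  map_core : ∀ {m} I (x : B.E I.1 m), equiv m (S.core I x) = T.core I x

namespace Stat

variable {S T U : PreTVB B o}

/-- The identity statomorphism. -/
def refl (S : PreTVB B o) : Stat S S := ⟨fun _ => Equiv.refl _, by simp, by simp, by simp⟩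

/-- The inverse statomorphism. -/
def symm (φ : Stat S T) : Stat T S where
  equiv m := (φ.equiv m).symm
  map_smul i a x := by simp [Equiv.symm_apply_eq, φ.map_smul]
  map_add i x y h := by
    rw [Equiv.symm_apply_eq, φ.map_add]
    · simp
    · apply (φ.equiv _).injective
      simpa [φ.map_smul] using h
  map_core I x := by simp [Equiv.symm_apply_eq, φ.map_core]

/-- Composition of statomorphisms, `φ` first. -/
def trans (φ : Stat S T) (ψ : Stat T U) : Stat S U where
  equiv m := (φ.equiv m).trans (ψ.equiv m)
  map_smul i a x := by simp [φ.map_smul, ψ.map_smul]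
  map_add i x y h := by
    simp only [Equiv.trans_apply]
    rw [φ.map_add _ _ _ h, ψ.map_add]
    rw [← φ.map_smul, ← φ.map_smul, h]
  map_core I x := by simp [φ.map_core, ψ.map_core]

@[simp] lemma refl_equiv (S : PreTVB B o) (m) : (refl S).equiv m = Equiv.refl _ := rfl
@[simp] lemma symm_equiv (φ : Stat S T) (m) : φ.symm.equiv m = (φ.equiv m).symm := rfl
@[simp] lemma trans_equiv (φ : Stat S T) (ψ : Stat T U) (m) :
    (φ.trans ψ).equiv m = (φ.equiv m).trans (ψ.equiv m) := rfl

lemma map_zero (φ : Stat S T) (m) : φ.equiv m (S.zero m) = T.zero m :=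
  T.eq_zero _ fun i => by rw [← φ.map_smul, S.proj_zero]

end Stat

/-! ### Smoothness -/

/-- Smoothness of a fibre preserving map of the decomposed triple vector bundle, that is, of the
fibre product over `M` of its building bundles: smooth maps from open sets of any `ℝᵈ` are sent
to smooth maps. -/
def SmoothMap (B : BuildingSystem) (o : Fin 4) (f : ∀ m, DecFibre B o m → DecFibre B o m) : Prop :=
  ∀ (d : ℕ) (q : EuclideanSpace ℝ (Fin d) → B.M.carrier) (s : ∀ u, DecFibre B o (q u))
    (u₀ : EuclideanSpace ℝ (Fin d)), (∀ I : Coord o, (B.V I.1).SmoothAt q (fun u => s u I) u₀) →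
    ∀ I : Coord o, (B.V I.1).SmoothAt q (fun u => f (q u) (s u) I) u₀

/-- A statomorphism of the decomposed triple vector bundle is a diffeomorphism. -/
def Stat.IsSmooth (χ : Stat (dec B o) (dec B o)) : Prop :=
  SmoothMap B o (fun m => χ.equiv m) ∧ SmoothMap B o (fun m => (χ.equiv m).symm)

lemma Stat.IsSmooth.refl : (Stat.refl (dec B o)).IsSmooth :=
  ⟨fun _ _ _ _ h => h, fun _ _ _ _ h => h⟩

lemma Stat.IsSmooth.symm {χ : Stat (dec B o) (dec B o)} (h : χ.IsSmooth) : χ.symm.IsSmooth :=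
  ⟨h.2, h.1⟩

lemma Stat.IsSmooth.trans {χ ψ : Stat (dec B o) (dec B o)} (h : χ.IsSmooth) (h' : ψ.IsSmooth) :
    (χ.trans ψ).IsSmooth :=
  ⟨fun d q s u hs => h'.1 d q _ u (h.1 d q s u hs), fun d q s u hs => h.2 d q _ u (h'.2 d q s u hs)⟩

/-- A triple vector bundle with building bundles `E_I`, `o ∉ I`, satisfying the splitting
condition. The smooth structure of the total space is recorded by the nonempty set `decs` of
its smooth decompositions (smooth statomorphisms to the decomposed triple vector bundle):
it is the structure for which these are diffeomorphisms. -/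
structure TVB (B : BuildingSystem) (o : Fin 4) extends PreTVB B o where
  decs : Set (Stat toPreTVB (dec B o))
  decs_nonempty : decs.Nonempty
  mem_decs_iff : ∀ P ∈ decs, ∀ Q, Q ∈ decs ↔ (P.symm.trans Q).IsSmooth

/-- Statomorphisms of triple vector bundles: algebraic statomorphisms that are diffeomorphisms,
equivalently pull smooth decompositions back to smooth decompositions. -/
def TVB.Hom (S T : TVB B o) : Type :=
  {φ : Stat S.toPreTVB T.toPreTVB // ∀ P ∈ T.decs, φ.trans P ∈ S.decs}

/-- The groupoid of triple vector bundles with given building bundles and statomorphisms. -/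
instance TVB.groupoid : Groupoid (TVB B o) where
  Hom := TVB.Hom
  id S := ⟨Stat.refl _, fun _ hP => hP⟩
  comp φ ψ := ⟨φ.1.trans ψ.1, fun P hP => φ.2 _ (ψ.2 P hP)⟩
  inv {S T} φ := ⟨φ.1.symm, fun P hP => by
    obtain ⟨Q, hQ⟩ := T.decs_nonempty
    rw [T.mem_decs_iff Q hQ]
    exact (S.mem_decs_iff _ (φ.2 Q hQ) P).1 hP⟩
  inv_comp φ := by
    apply Subtype.ext; apply Stat.ext; funext m; exact (φ.1.equiv m).symm_trans_self
  comp_inv φ := by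
    apply Subtype.ext; apply Stat.ext; funext m; exact (φ.1.equiv m).self_trans_symm


/-! ### Duals -/

/-- A point over `m` of the dual of the vector bundle structure in direction `i`: a point `base` of
the base (the image of the zero section) and a linear functional on the fibre over it, extended by
zero to a function `val` on `T m`. -/
@[ext] structure FibDual (T : PreTVB B o) (i : Dir o) (m : B.M.carrier) where
  base : T.T m
  proj_base : T.smul i 0 base = base
  val : T.T m → ℝ
  val_off : ∀ x, T.smul i 0 x ≠ base → val x = 0
  val_add : ∀ x y, T.smul i 0 x = base → T.smul i 0 y = base →
    val (T.add i x y) = val x + val y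
  val_smul : ∀ a x, T.smul i 0 x = base → val (T.smul i a x) = a * val x

/-- The dual of a statomorphism. -/
def Stat.dualEquiv {S T : PreTVB B o} (φ : Stat S T) (i : Dir o) (m : B.M.carrier) :
    FibDual T i m ≃ FibDual S i m where
  toFun Ψ :=
    { base := (φ.equiv m).symm Ψ.base
      proj_base := by rw [Equiv.eq_symm_apply, φ.map_smul]; simp [Ψ.proj_base]
      val := fun x => Ψ.val (φ.equiv m x)
      val_off := fun x h => Ψ.val_off _ fun h' => h (by
        rw [Equiv.eq_symm_apply, φ.map_smul]; exact h')
      val_add := fun x y h h' => by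
        rw [φ.map_add _ _ _ (h.trans h'.symm)]
        rw [Equiv.eq_symm_apply, φ.map_smul] at h h'
        exact Ψ.val_add _ _ h h'
      val_smul := fun a x h => by
        rw [φ.map_smul]
        rw [Equiv.eq_symm_apply, φ.map_smul] at h
        exact Ψ.val_smul _ _ h }
  invFun Ψ :=
    { base := φ.equiv m Ψ.base
      proj_base := by rw [← φ.map_smul, Ψ.proj_base]
      val := fun x => Ψ.val ((φ.equiv m).symm x)
      val_off := fun x h => Ψ.val_off _ fun h' => h (by
        rw [← h', φ.map_smul]; simp)
      val_add := fun x y h h' => by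
        have e := φ.symm.map_add i x y (h.trans h'.symm)
        have hx := φ.symm.map_smul i 0 x
        have hy := φ.symm.map_smul i 0 y
        simp only [Stat.symm_equiv] at e hx hy
        rw [e]
        exact Ψ.val_add _ _ (by rw [← hx, h]; simp) (by rw [← hy, h']; simp)
      val_smul := fun a x h => by
        have e := φ.symm.map_smul i a x
        have hx := φ.symm.map_smul i 0 x
        simp only [Stat.symm_equiv] at e hx
        rw [e]
        exact Ψ.val_smul _ _ (by rw [← hx, h]; simp) }
  left_inv Ψ := by ext <;> simp
  right_inv Ψ := by ext <;> simp

/-- The complementary label, as label of a building bundle of the dual in direction `i`. -/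
def Coord.dual {i : Dir o} (K : Coord o) (hK : i.1 ∈ K.1.1) : Coord i.1 :=
  ⟨K.1.compl, by simpa [Lab.compl] using hK⟩

/-- The complementary label, as label of a building bundle of the original. -/
def Coord.undual {i : Dir o} (J : Coord i.1) (hJ : o ∈ J.1.1) : Coord o :=
  ⟨J.1.compl, by simpa [Lab.compl] using hJ⟩

lemma Coord.isCompl_dual {i : Dir o} (K : Coord o) (hK : i.1 ∈ K.1.1) :
    IsCompl (K.dual hK).1.1 K.1.1 := (isCompl_compl (x := K.1.1)).symm

lemma Coord.isCompl_undual {i : Dir o} (J : Coord i.1) (hJ : o ∈ J.1.1) :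
    IsCompl J.1.1 (J.undual hJ).1.1 := isCompl_compl

lemma Coord.mem_undual {i : Dir o} (J : Coord i.1) (hJ : o ∈ J.1.1) :
    i.1 ∈ (J.undual hJ).1.1 := by
  simpa [Coord.undual, Lab.compl] using J.2

lemma Coord.mem_dual {i : Dir o} (K : Coord o) (hK : i.1 ∈ K.1.1) :
    o ∈ (K.dual hK).1.1 := by
  simpa [Coord.dual, Lab.compl] using K.2

lemma mem_iff_of_isCompl {I J : Finset (Fin 4)} (h : IsCompl I J) (k : Fin 4) :
    k ∈ I ↔ k ∉ J := by
  rw [← h.compl_eq]; simp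

/-- The perfect pairing as an isomorphism onto the dual space. -/
def BuildingSystem.pairEquiv (B : BuildingSystem) (I J : Lab) (h : IsCompl I.1 J.1)
    (m : B.M.carrier) : B.E I m ≃ₗ[ℝ] (B.E J m →ₗ[ℝ] ℝ) :=
  LinearEquiv.ofBijective (B.pair I J h m) (B.pair_bijective I J h m)

@[simp] lemma BuildingSystem.pairEquiv_apply (B : BuildingSystem) (I J : Lab) (h) (m) (x) :
    B.pairEquiv I J h m x = B.pair I J h m x := rfl

namespace DecDual

variable {i : Dir o} {m : B.M.carrier}

@[simp] lemma dec_smul (i : Dir o) (a : ℝ) (e : DecFibre B o m) (I : Coord o) :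
    (dec B o).smul i a e I = if i.1 ∈ I.1.1 then a • e I else e I := rfl

@[simp] lemma dec_add (i : Dir o) (e e' : DecFibre B o m) (I : Coord o) :
    (dec B o).add i e e' I = if i.1 ∈ I.1.1 then e I + e' I else e I := rfl

lemma dec_ext {e e' : (dec B o).T m} (h : ∀ I : Coord o, e I = e' I) : e = e' := funext h

lemma base_eq_zero (Ψ : FibDual (dec B o) i m) {I : Coord o} (h : i.1 ∈ I.1.1) :
    Ψ.base I = 0 := by
  have := congrFun Ψ.proj_base I
  rw [dec_smul, if_pos h, zero_smul] at this
  exact this.symm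

lemma proj_iff (Ψ : FibDual (dec B o) i m) (t : DecFibre B o m) :
    (dec B o).smul i 0 t = Ψ.base ↔ ∀ I : Coord o, i.1 ∉ I.1.1 → t I = Ψ.base I := by
  constructor
  · intro h I hI
    have := congrFun h I
    rw [dec_smul, if_neg hI] at this
    exact this
  · intro h
    apply dec_ext; intro I
    rw [dec_smul]
    split_ifs with hI
    · rw [base_eq_zero Ψ hI, zero_smul]
    · exact h I hI

/-- The linear functional on the sum of the building spaces defined by `Ψ`. -/
def lin (Ψ : FibDual (dec B o) i m) : DecFibre B o m →ₗ[ℝ] ℝ where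
  toFun e := Ψ.val fun I => if i.1 ∈ I.1.1 then e I else Ψ.base I
  map_add' e e' := by
    rw [← Ψ.val_add]
    · congr 1; apply dec_ext; intro I; rw [dec_add]; split_ifs <;> simp
    · rw [proj_iff]; intro I hI; simp [hI]
    · rw [proj_iff]; intro I hI; simp [hI]
  map_smul' a e := by
    rw [RingHom.id_apply, smul_eq_mul, ← Ψ.val_smul]
    · congr 1; apply dec_ext; intro I; rw [dec_smul]; split_ifs <;> simp
    · rw [proj_iff]; intro I hI; simp [hI]

lemma lin_eq (Ψ : FibDual (dec B o) i m) (t : DecFibre B o m)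
    (h : (dec B o).smul i 0 t = Ψ.base) : lin Ψ t = Ψ.val t := by
  rw [proj_iff] at h
  show Ψ.val _ = _
  congr 1; apply dec_ext; intro I
  split_ifs with hI
  · rfl
  · exact (h I hI).symm

lemma lin_single (Ψ : FibDual (dec B o) i m) (K : Coord o) (hK : i.1 ∈ K.1.1) (e : B.E K.1 m) :
    lin Ψ (Pi.single K e) = Ψ.val (Function.update Ψ.base K e) := by
  show Ψ.val _ = _
  congr 1; apply dec_ext; intro I
  by_cases hI : I = K
  · subst hI; simp [hK]
  · simp only [hI, ne_eq, not_false_eq_true, Pi.single_eq_of_ne, Function.update_of_ne]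
    split_ifs with h
    · exact (base_eq_zero Ψ h).symm
    · rfl

lemma lin_single_of_notMem (Ψ : FibDual (dec B o) i m) (K : Coord o) (hK : i.1 ∉ K.1.1)
    (e : B.E K.1 m) : lin Ψ (Pi.single K e) = 0 := by
  rw [← map_zero (lin Ψ)]
  show Ψ.val _ = Ψ.val _
  congr 1; apply dec_ext; intro I
  by_cases hI : I = K
  · subst hI; simp [hK]
  · simp [hI]

/-- The contribution of `E_K` to the pairing of `f` with `t`. -/
def term (f : DecFibre B i.1 m) (t : DecFibre B o m) (K : Coord o) : ℝ :=
  if hK : i.1 ∈ K.1.1 then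
    B.pair (K.dual hK).1 K.1 (K.isCompl_dual hK) m (f (K.dual hK)) (t K) else 0

lemma term_eq (f : DecFibre B i.1 m) (t : DecFibre B o m) (J : Coord i.1) (K : Coord o)
    (h : IsCompl J.1.1 K.1.1) : term f t K = B.pair J.1 K.1 h m (f J) (t K) := by
  have hK : i.1 ∈ K.1.1 := (mem_iff_of_isCompl h.symm i.1).2 J.2
  have hJ : J = K.dual hK := by
    apply Subtype.ext; apply Subtype.ext
    exact h.symm.compl_eq.symm
  subst hJ
  simp [term, hK]

/-- Coordinates of a point of the dual: a functional `Ψ` over `b` has the coordinates of `b`, and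
the restrictions of `Ψ` to the building bundles in the fibre. -/
def coords (Ψ : FibDual (dec B o) i m) : DecFibre B i.1 m := fun J =>
  if h : o ∈ J.1.1 then
    (B.pairEquiv J.1 (J.undual h).1 (J.isCompl_undual h) m).symm
      ((lin Ψ).comp (LinearMap.single ℝ (fun K : Coord o => B.E K.1 m) (J.undual h)))
  else Ψ.base ⟨J.1, h⟩

lemma coords_keep (Ψ : FibDual (dec B o) i m) (J : Coord i.1) (h : o ∉ J.1.1) :
    coords Ψ J = Ψ.base ⟨J.1, h⟩ := by simp [coords, h]

lemma coords_pair (Ψ : FibDual (dec B o) i m) (J : Coord i.1) (K : Coord o)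
    (h : IsCompl J.1.1 K.1.1) (e : B.E K.1 m) :
    B.pair J.1 K.1 h m (coords Ψ J) e = lin Ψ (Pi.single K e) := by
  have hJ : o ∈ J.1.1 := (mem_iff_of_isCompl h o).2 K.2
  have hK : K = J.undual hJ := by
    apply Subtype.ext; apply Subtype.ext
    exact h.compl_eq.symm
  subst hK
  rw [← BuildingSystem.pairEquiv_apply]
  simp only [coords, hJ, dif_pos, LinearEquiv.apply_symm_apply]
  rfl

lemma coords_pair' (Ψ : FibDual (dec B o) i m) (J : Coord i.1) (K : Coord o)
    (h : IsCompl J.1.1 K.1.1) (e : B.E K.1 m) :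
    B.pair J.1 K.1 h m (coords Ψ J) e = Ψ.val (Function.update Ψ.base K e) := by
  rw [coords_pair, lin_single]
  exact (mem_iff_of_isCompl h.symm i.1).2 J.2

lemma val_eq (Ψ : FibDual (dec B o) i m) (t : DecFibre B o m)
    (h : (dec B o).smul i 0 t = Ψ.base) : Ψ.val t = ∑ K, term (coords Ψ) t K := by
  rw [← lin_eq Ψ t h]
  conv_lhs => rw [← Finset.univ_sum_single t]
  rw [map_sum]
  refine Finset.sum_congr rfl fun K _ => ?_
  by_cases hK : i.1 ∈ K.1.1
  · rw [term_eq _ _ (K.dual hK) K (K.isCompl_dual hK), coords_pair]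
  · rw [lin_single_of_notMem Ψ K hK]; simp [term, hK]

lemma coords_ext {f g : DecFibre B i.1 m} (h1 : ∀ J, o ∉ J.1.1 → f J = g J)
    (h2 : ∀ (J : Coord i.1) (K : Coord o) (h : IsCompl J.1.1 K.1.1) (e : B.E K.1 m),
      B.pair J.1 K.1 h m (f J) e = B.pair J.1 K.1 h m (g J) e) : f = g := by
  funext J
  by_cases hJ : o ∈ J.1.1
  · apply (B.pair_bijective J.1 (J.undual hJ).1 (J.isCompl_undual hJ) m).1
    ext e
    exact h2 J _ _ e
  · exact h1 J hJ

/-- The point of the dual with given coordinates. -/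
def ofCoords (f : DecFibre B i.1 m) : FibDual (dec B o) i m where
  base := fun I => if h : i.1 ∈ I.1.1 then 0 else f ⟨I.1, h⟩
  proj_base := by
    apply dec_ext; intro I
    rw [dec_smul]
    by_cases h : i.1 ∈ I.1.1 <;> simp [h]
  val t := open Classical in
    if (dec B o).smul i 0 t = fun I => if h : i.1 ∈ I.1.1 then 0 else f ⟨I.1, h⟩ then
      ∑ K, term f t K else 0
  val_off t ht := by rw [if_neg ht]
  val_add x y hx hy := by
    rw [if_pos hx, if_pos hy, if_pos, ← Finset.sum_add_distrib]
    · refine Finset.sum_congr rfl fun K _ => ?_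
      by_cases hK : i.1 ∈ K.1.1 <;> simp [term, hK]
    · rw [(dec B o).proj_add _ _ _ (hx.trans hy.symm), hx]
  val_smul a x hx := by
    rw [if_pos hx, if_pos, Finset.mul_sum]
    · refine Finset.sum_congr rfl fun K _ => ?_
      by_cases hK : i.1 ∈ K.1.1 <;> simp [term, hK]
    · rw [← (dec B o).mul_smul, zero_mul, hx]

lemma ofCoords_val (f : DecFibre B i.1 m) (t : DecFibre B o m)
    (h : (dec B o).smul i 0 t = (ofCoords f).base) : (ofCoords f).val t = ∑ K, term f t K :=
  if_pos h

lemma proj_update (Ψ : FibDual (dec B o) i m) (K : Coord o) (hK : i.1 ∈ K.1.1) (e : B.E K.1 m) :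
    (dec B o).smul i 0 (Function.update Ψ.base K e) = Ψ.base := by
  rw [proj_iff]
  intro I hI
  rw [Function.update_of_ne]
  rintro rfl; exact hI hK

/-- The dual of the decomposed triple vector bundle is decomposed. -/
def equiv (i : Dir o) (m : B.M.carrier) : FibDual (dec B o) i m ≃ DecFibre B i.1 m where
  toFun := coords
  invFun := ofCoords
  left_inv Ψ := by
    have hb : (ofCoords (coords Ψ)).base = Ψ.base := by
      apply dec_ext; intro I
      show (if h : _ then _ else _) = _
      by_cases h : i.1 ∈ I.1.1
      · rw [dif_pos h, base_eq_zero Ψ h]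
      · rw [dif_neg h, coords_keep _ _ I.2]
    apply FibDual.ext
    · exact hb
    · funext t
      by_cases ht : (dec B o).smul i 0 t = Ψ.base
      · rw [ofCoords_val _ _ (ht.trans hb.symm), val_eq _ _ ht]
      · rw [Ψ.val_off _ ht, FibDual.val_off]
        rwa [hb]
  right_inv f := by
    apply coords_ext
    · intro J hJ
      rw [coords_keep _ _ hJ]
      exact dif_neg J.2
    · intro J K h e
      have hK : i.1 ∈ K.1.1 := (mem_iff_of_isCompl h.symm i.1).2 J.2
      rw [coords_pair', ofCoords_val _ _ (proj_update _ K hK e), Finset.sum_eq_single K]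
      · rw [term_eq _ _ J K h, Function.update_self]
      · intro K' _ hK'
        by_cases hi : i.1 ∈ K'.1.1
        · rw [term_eq _ _ (K'.dual hi) K' (K'.isCompl_dual hi), Function.update_of_ne hK',
            base_eq_zero _ hi, _root_.map_zero]
        · simp [term, hi]
      · simp

end DecDual


/-! The characterization of the structure of the dual by the pairing with the original.  -/

namespace FibDual

variable {T : PreTVB B o} {i : Dir o} {m : B.M.carrier}

/-- A direction of the dual other than `o`, as direction of the original. -/
def oldDir {i : Dir o} (j : Dir i.1) (h : j.1 ≠ o) : Dir o := ⟨j.1, h⟩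

/-- `Φ` is the product `a · Ψ` for the structure of the dual in direction `j`. For `j = o` this
is the product in the dual of the vector bundle structure in direction `i`. For the other `j`
it means `⟨Φ, a · d⟩ = a ⟨Ψ, d⟩`, and that `Φ` and `Ψ` have the same projection
to the dual of the core of the double vector bundle with directions `i` and `j`. -/
def IsSmul (j : Dir i.1) (a : ℝ) (Ψ Φ : FibDual T i m) : Prop :=
  if h : j.1 = o then Φ.base = Ψ.base ∧ ∀ d, Φ.val d = a * Ψ.val d
  else Φ.base = T.smul (oldDir j h) a Ψ.base ∧
    (∀ d, T.smul i 0 d = Ψ.base → Φ.val (T.smul (oldDir j h) a d) = a * Ψ.val d) ∧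
    (∀ c, T.smul i 0 c = T.smul (oldDir j h) 0 Ψ.base →
      T.smul (oldDir j h) 0 c = T.smul (oldDir j h) 0 Ψ.base →
      Φ.val (T.add (oldDir j h) Φ.base c) = Ψ.val (T.add (oldDir j h) Ψ.base c))

/-- `Φ` is the sum `Ψ + Ψ'` for the structure of the dual in direction `j`. For `j = o`
this is the sum of functionals; for the other `j` it means
`⟨Φ, d + d'⟩ = ⟨Ψ, d⟩ + ⟨Ψ', d'⟩`. -/
def IsAdd (j : Dir i.1) (Ψ Ψ' Φ : FibDual T i m) : Prop :=
  if h : j.1 = o then Φ.base = Ψ.base ∧ ∀ d, Φ.val d = Ψ.val d + Ψ'.val d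
  else Φ.base = T.add (oldDir j h) Ψ.base Ψ'.base ∧
    ∀ d d', T.smul i 0 d = Ψ.base → T.smul i 0 d' = Ψ'.base →
      T.smul (oldDir j h) 0 d = T.smul (oldDir j h) 0 d' →
      Φ.val (T.add (oldDir j h) d d') = Ψ.val d + Ψ'.val d'

/-- `Φ` is the element of the building bundle `E_J` of the dual given by `x`. If `o ∉ J` it is the
zero functional over the element of `E_J` in the base. If `o ∈ J` it is the functional over
zero given by pairing with `x` on `E_{Jᶜ}` and vanishing on the other building bundles. -/
def IsCore (J : Coord i.1) (x : B.E J.1 m) (Φ : FibDual T i m) : Prop :=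
  if h : o ∈ J.1.1 then Φ.base = T.zero m ∧
    ∀ (K : Coord o) (y : B.E K.1 m), i.1 ∈ K.1.1 →
      (∀ h : IsCompl J.1.1 K.1.1, Φ.val (T.core K y) = B.pair J.1 K.1 h m x y) ∧
      (¬ IsCompl J.1.1 K.1.1 → Φ.val (T.core K y) = 0)
  else Φ.base = T.core ⟨J.1, h⟩ x ∧ ∀ d, Φ.val d = 0

variable {S : PreTVB B o} (φ : Stat S T)

lemma dualEquiv_base (Ψ : FibDual T i m) :
    (φ.dualEquiv i m Ψ).base = (φ.equiv m).symm Ψ.base := rfl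

lemma dualEquiv_val (Ψ : FibDual T i m) (x : S.T m) :
    (φ.dualEquiv i m Ψ).val x = Ψ.val (φ.equiv m x) := rfl

lemma IsSmul.dualEquiv {j : Dir i.1} {a : ℝ} {Ψ Φ : FibDual T i m} (h : IsSmul j a Ψ Φ) :
    IsSmul j a (φ.dualEquiv i m Ψ) (φ.dualEquiv i m Φ) := by
  unfold IsSmul at h ⊢
  split_ifs at h ⊢ with hj
  · exact ⟨congrArg (φ.equiv m).symm h.1, fun d => h.2 _⟩
  · obtain ⟨h1, h2, h3⟩ := h
    refine ⟨?_, fun d hd => ?_, fun c hc hc' => ?_⟩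
    · rw [dualEquiv_base, dualEquiv_base, h1]
      exact φ.symm.map_smul _ _ _
    · rw [dualEquiv_base, Equiv.eq_symm_apply, φ.map_smul] at hd
      rw [dualEquiv_val, dualEquiv_val, φ.map_smul, h2 _ hd]
    · rw [dualEquiv_base] at hc hc'
      have e1 : T.smul i 0 (φ.equiv m c) = T.smul (oldDir j hj) 0 Ψ.base := by
        rw [← φ.map_smul, hc, φ.map_smul, Equiv.apply_symm_apply]
      have e2 : T.smul (oldDir j hj) 0 (φ.equiv m c) = T.smul (oldDir j hj) 0 Ψ.base := by
        rw [← φ.map_smul, hc', φ.map_smul, Equiv.apply_symm_apply]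
      have e3 : S.smul (oldDir j hj) 0 ((φ.equiv m).symm Φ.base) =
          S.smul (oldDir j hj) 0 c := by
        apply (φ.equiv m).injective
        rw [φ.map_smul, φ.map_smul, Equiv.apply_symm_apply, e2, h1, ← T.mul_smul, zero_mul]
      rw [dualEquiv_val, dualEquiv_val, dualEquiv_base, dualEquiv_base, φ.map_add _ _ _ e3,
        φ.map_add _ _ _ hc'.symm, Equiv.apply_symm_apply, Equiv.apply_symm_apply]
      exact h3 _ e1 e2

lemma IsAdd.dualEquiv {j : Dir i.1} {Ψ Ψ' Φ : FibDual T i m} (h : IsAdd j Ψ Ψ' Φ)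
    (hΨ : ∀ hj : j.1 ≠ o, T.smul (oldDir j hj) 0 Ψ.base = T.smul (oldDir j hj) 0 Ψ'.base) :
    IsAdd j (φ.dualEquiv i m Ψ) (φ.dualEquiv i m Ψ') (φ.dualEquiv i m Φ) := by
  unfold IsAdd at h ⊢
  split_ifs at h ⊢ with hj
  · exact ⟨congrArg (φ.equiv m).symm h.1, fun d => h.2 _⟩
  · obtain ⟨h1, h2⟩ := h
    refine ⟨?_, fun d d' hd hd' hdd => ?_⟩
    · rw [dualEquiv_base, dualEquiv_base, dualEquiv_base, h1]
      exact φ.symm.map_add _ _ _ (hΨ hj)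
    · rw [dualEquiv_base, Equiv.eq_symm_apply, φ.map_smul] at hd hd'
      rw [dualEquiv_val, dualEquiv_val, dualEquiv_val, φ.map_add _ _ _ hdd]
      refine h2 _ _ hd hd' ?_
      rw [← φ.map_smul, hdd, φ.map_smul]

lemma IsCore.dualEquiv {J : Coord i.1} {x : B.E J.1 m} {Φ : FibDual T i m} (h : IsCore J x Φ) :
    IsCore J x (φ.dualEquiv i m Φ) := by
  unfold IsCore at h ⊢
  split_ifs at h ⊢ with hj
  · refine ⟨?_, fun K y hK => ⟨fun hJK => ?_, fun hJK => ?_⟩⟩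
    · rw [dualEquiv_base, h.1]; exact φ.symm.map_zero m
    · rw [dualEquiv_val, φ.map_core]; exact (h.2 K y hK).1 hJK
    · rw [dualEquiv_val, φ.map_core]; exact (h.2 K y hK).2 hJK
  · refine ⟨?_, fun d => h.2 _⟩
    rw [dualEquiv_base, h.1]; exact φ.symm.map_core _ _

end FibDual

namespace DecDual

open FibDual

variable {i : Dir o} {m : B.M.carrier}

lemma base_keep (Ψ : FibDual (dec B o) i m) (I : Coord o) (h : i.1 ∉ I.1.1) :
    Ψ.base I = coords Ψ ⟨I.1, h⟩ := (coords_keep Ψ ⟨I.1, h⟩ I.2).symm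

lemma base_ext {b : DecFibre B o m} (Ψ : FibDual (dec B o) i m)
    (h1 : ∀ I : Coord o, i.1 ∈ I.1.1 → b I = 0)
    (h2 : ∀ (I : Coord o) (h : i.1 ∉ I.1.1), coords Ψ ⟨I.1, h⟩ = b I) : Ψ.base = b := by
  apply dec_ext; intro I
  by_cases hI : i.1 ∈ I.1.1
  · rw [base_eq_zero Ψ hI, h1 I hI]
  · rw [base_keep Ψ I hI, h2]

lemma mem_compl_iff {J : Coord i.1} {K : Coord o} (h : IsCompl J.1.1 K.1.1) (k : Fin 4) :
    k ∈ J.1.1 ↔ k ∉ K.1.1 := mem_iff_of_isCompl h k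

/-- Comparison of the values of functionals term by term. -/
lemma sum_term_congr {f : DecFibre B i.1 m} {t : DecFibre B o m} {c : Coord o → ℝ}
    (h0 : ∀ K, i.1 ∉ K.1.1 → c K = 0)
    (h : ∀ (J : Coord i.1) (K : Coord o) (hJK : IsCompl J.1.1 K.1.1), i.1 ∈ K.1.1 → o ∈ J.1.1 →
      B.pair J.1 K.1 hJK m (f J) (t K) = c K) :
    ∑ K, term f t K = ∑ K, c K := by
  refine Finset.sum_congr rfl fun K _ => ?_
  by_cases hK : i.1 ∈ K.1.1
  · rw [term_eq f t _ K (K.isCompl_dual hK)]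
    exact h _ _ _ hK (K.mem_dual hK)
  · rw [h0 K hK]; simp [term, hK]

lemma term_zero (f : DecFibre B i.1 m) (t : DecFibre B o m) (K : Coord o) (hK : i.1 ∉ K.1.1) :
    term f t K = 0 := by simp [term, hK]

lemma isSmul_iff (j : Dir i.1) (a : ℝ) (Ψ Φ : FibDual (dec B o) i m) :
    IsSmul j a Ψ Φ ↔ coords Φ = (dec B i.1).smul j a (coords Ψ) := by
  unfold IsSmul
  split_ifs with hj
  · constructor
    · rintro ⟨h1, h2⟩
      apply coords_ext
      · intro J hJ
        rw [dec_smul, if_neg (by rwa [hj]), coords_keep _ _ hJ, coords_keep _ _ hJ, h1]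
      · intro J K hJK e
        have hJ : o ∈ J.1.1 := (mem_compl_iff hJK o).2 K.2
        rw [dec_smul, if_pos (by rwa [hj]), map_smul, LinearMap.smul_apply, coords_pair',
          coords_pair', h2, h1, smul_eq_mul]
    · intro h
      have hb : Φ.base = Ψ.base := by
        apply base_ext
        · exact fun I hI => base_eq_zero Ψ hI
        · intro I hI
          rw [h, dec_smul, if_neg (by rw [hj]; exact I.2), coords_keep _ _ I.2]
      refine ⟨hb, fun d => ?_⟩
      by_cases hd : (dec B o).smul i 0 d = Ψ.base
      · rw [val_eq Ψ d hd, val_eq Φ d (hd.trans hb.symm), Finset.mul_sum]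
        apply sum_term_congr
        · intro K hK; rw [term_zero _ _ _ hK, mul_zero]
        · intro J K hJK hK hJ
          rw [term_eq _ _ J K hJK, h, dec_smul, if_pos (by rwa [hj]), map_smul,
            LinearMap.smul_apply, smul_eq_mul]
      · rw [Ψ.val_off d hd, Φ.val_off d (by rwa [hb]), mul_zero]
  · have hij : i ≠ oldDir j hj := fun h => j.2 (congrArg Subtype.val h).symm
    constructor
    · rintro ⟨h1, h2, h3⟩
      apply coords_ext
      · intro J hJ
        rw [dec_smul, coords_keep _ _ hJ, coords_keep _ _ hJ, h1]
        rfl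
      · intro J K hJK e
        have hJ : o ∈ J.1.1 := (mem_compl_iff hJK o).2 K.2
        have hK : i.1 ∈ K.1.1 := by
          by_contra h; exact J.2 ((mem_compl_iff hJK i.1).2 h)
        rw [dec_smul, coords_pair']
        by_cases hjJ : j.1 ∈ J.1.1
        · have hjK : j.1 ∉ K.1.1 := (mem_compl_iff hJK j.1).1 hjJ
          rw [if_pos hjJ, map_smul, LinearMap.smul_apply, coords_pair', smul_eq_mul,
            ← h2 _ (proj_update Ψ K hK e), h1]
          congr 1
          apply dec_ext; intro I
          rw [dec_smul]
          by_cases hI : I = K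
          · subst hI; simp [oldDir, hjK]
          · rw [Function.update_of_ne hI, Function.update_of_ne hI, dec_smul]
        · have hjK : j.1 ∈ K.1.1 := by
            by_contra h; exact hjJ ((mem_compl_iff hJK j.1).2 h)
          rw [if_neg hjJ, coords_pair']
          have h3' := h3 (Function.update ((dec B o).smul (oldDir j hj) 0 Ψ.base) K e) ?_ ?_
          · convert h3' using 2
            · apply dec_ext; intro I
              rw [dec_add]
              by_cases hI : I = K
              · subst hI; simp [oldDir, hjK, base_eq_zero Φ hK]
              · rw [Function.update_of_ne hI, Function.update_of_ne hI, dec_smul]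
                split_ifs <;> simp
            · apply dec_ext; intro I
              rw [dec_add]
              by_cases hI : I = K
              · subst hI; simp [oldDir, hjK, base_eq_zero Ψ hK]
              · rw [Function.update_of_ne hI, Function.update_of_ne hI, dec_smul]
                split_ifs <;> simp
          · apply dec_ext; intro I
            rw [dec_smul]
            by_cases hI : I = K
            · subst hI; rw [if_pos hK, dec_smul, if_pos (by exact hjK)]; simp
            · rw [Function.update_of_ne hI]
              split_ifs with h
              · rw [dec_smul, base_eq_zero Ψ h]; simp
              · rfl
          · apply dec_ext; intro I
            rw [dec_smul]
            by_cases hI : I = K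
            · subst hI; rw [if_pos (by exact hjK), dec_smul, if_pos (by exact hjK)]; simp
            · rw [Function.update_of_ne hI, dec_smul]
              split_ifs <;> simp
    · intro h
      have hb : Φ.base = (dec B o).smul (oldDir j hj) a Ψ.base := by
        apply base_ext
        · intro I hI; rw [dec_smul, base_eq_zero Ψ hI]; simp
        · intro I hI
          rw [h, dec_smul, dec_smul, coords_keep _ _ I.2]; rfl
      refine ⟨hb, fun d hd => ?_, fun c hc hc' => ?_⟩
      · rw [val_eq Ψ d hd, val_eq Φ _ ?_, Finset.mul_sum]
        · apply sum_term_congr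
          · intro K hK; rw [term_zero _ _ _ hK, mul_zero]
          · intro J K hJK hK hJ
            rw [term_eq _ _ J K hJK, h, dec_smul, dec_smul]
            by_cases hjJ : j.1 ∈ J.1.1
            · have hjK : (oldDir j hj).1 ∉ K.1.1 := (mem_compl_iff hJK j.1).1 hjJ
              rw [if_pos hjJ, if_neg hjK]; simp
            · have hjK : j.1 ∈ K.1.1 := by
                by_contra h; exact hjJ ((mem_compl_iff hJK j.1).2 h)
              rw [if_neg hjJ, if_pos (by exact hjK)]; simp
        · rw [(dec B o).smul_smul_comm _ _ _ _ _ hij, hd, hb]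
      · have key : ∀ (b : DecFibre B o m) (I : Coord o), (i.1 ∉ I.1.1) →
            (dec B o).add (oldDir j hj) b c I = b I := by
          intro b I hI
          have e1 := congrFun hc I
          rw [dec_smul, dec_smul, if_neg hI] at e1
          rw [dec_add, e1]
          split_ifs <;> simp
        rw [val_eq Ψ _ ((proj_iff Ψ _).2 (key _)), val_eq Φ _ ((proj_iff Φ _).2 (key _))]
        apply sum_term_congr
        · intro K hK; rw [term_zero _ _ _ hK]
        · intro J K hJK hK hJ
          rw [term_eq _ _ J K hJK, h, dec_smul, dec_add, dec_add, base_eq_zero Ψ hK,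
            base_eq_zero Φ hK]
          by_cases hjJ : j.1 ∈ J.1.1
          · have hjK : (oldDir j hj).1 ∉ K.1.1 := (mem_compl_iff hJK j.1).1 hjJ
            rw [if_pos hjJ, if_neg hjK]; simp
          · rw [if_neg hjJ]

lemma isAdd_iff (j : Dir i.1) (Ψ Ψ' Φ : FibDual (dec B o) i m)
    (hΨ : (dec B i.1).smul j 0 (coords Ψ) = (dec B i.1).smul j 0 (coords Ψ')) :
    IsAdd j Ψ Ψ' Φ ↔ coords Φ = (dec B i.1).add j (coords Ψ) (coords Ψ') := by
  have hc : ∀ J : Coord i.1, j.1 ∉ J.1.1 → coords Ψ J = coords Ψ' J := by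
    intro J hJ
    have := congrFun hΨ J
    rwa [dec_smul, dec_smul, if_neg hJ, if_neg hJ] at this
  have hbc : ∀ I : Coord o, j.1 ∉ I.1.1 → Ψ.base I = Ψ'.base I := by
    intro I hI
    by_cases h : i.1 ∈ I.1.1
    · rw [base_eq_zero Ψ h, base_eq_zero Ψ' h]
    · rw [base_keep Ψ I h, base_keep Ψ' I h]; exact hc _ hI
  unfold IsAdd
  split_ifs with hj
  · have hbb : Ψ'.base = Ψ.base := by
      apply dec_ext; intro I
      exact (hbc I (by rw [hj]; exact I.2)).symm
    constructor
    · rintro ⟨h1, h2⟩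
      apply coords_ext
      · intro J hJ
        rw [dec_add, if_neg (by rwa [hj]), coords_keep _ _ hJ, coords_keep _ _ hJ, h1]
      · intro J K hJK e
        have hJ : o ∈ J.1.1 := (mem_compl_iff hJK o).2 K.2
        rw [dec_add, if_pos (by rwa [hj]), map_add, LinearMap.add_apply, coords_pair',
          coords_pair', coords_pair', h2, h1, hbb]
    · intro h
      have hb : Φ.base = Ψ.base := by
        apply base_ext
        · exact fun I hI => base_eq_zero Ψ hI
        · intro I hI
          rw [h, dec_add, if_neg (by rw [hj]; exact I.2), coords_keep _ _ I.2]
      refine ⟨hb, fun d => ?_⟩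
      by_cases hd : (dec B o).smul i 0 d = Ψ.base
      · rw [val_eq Ψ d hd, val_eq Φ d (hd.trans hb.symm), val_eq Ψ' d (hd.trans hbb.symm),
          ← Finset.sum_add_distrib]
        apply sum_term_congr
        · intro K hK; rw [term_zero _ _ _ hK, term_zero _ _ _ hK, add_zero]
        · intro J K hJK hK hJ
          rw [term_eq _ _ J K hJK, term_eq _ _ J K hJK, h, dec_add, if_pos (by rwa [hj]), map_add,
            LinearMap.add_apply]
      · rw [Ψ.val_off d hd, Φ.val_off d (by rwa [hb]), Ψ'.val_off d (by rwa [hbb]), add_zero]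
  · have hij : i ≠ oldDir j hj := fun h => j.2 (congrArg Subtype.val h).symm
    constructor
    · rintro ⟨h1, h2⟩
      apply coords_ext
      · intro J hJ
        rw [dec_add, coords_keep _ _ hJ, coords_keep _ _ hJ, coords_keep _ _ hJ, h1]
        rfl
      · intro J K hJK e
        have hJ : o ∈ J.1.1 := (mem_compl_iff hJK o).2 K.2
        have hK : i.1 ∈ K.1.1 := by
          by_contra h; exact J.2 ((mem_compl_iff hJK i.1).2 h)
        rw [dec_add, coords_pair']
        by_cases hjJ : j.1 ∈ J.1.1
        · have hjK : j.1 ∉ K.1.1 := (mem_compl_iff hJK j.1).1 hjJ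
          rw [if_pos hjJ, map_add, LinearMap.add_apply, coords_pair', coords_pair',
            ← h2 _ _ (proj_update Ψ K hK e) (proj_update Ψ' K hK e), h1]
          · congr 1
            apply dec_ext; intro I
            rw [dec_add]
            by_cases hI : I = K
            · subst hI; simp [oldDir, hjK]
            · rw [Function.update_of_ne hI, Function.update_of_ne hI, Function.update_of_ne hI,
                dec_add]
          · apply dec_ext; intro I
            rw [dec_smul, dec_smul]
            by_cases hI : I = K
            · subst hI; simp
            · rw [Function.update_of_ne hI, Function.update_of_ne hI]
              split_ifs with hjI
              · simp
              · exact hbc I hjI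
        · have hjK : j.1 ∈ K.1.1 := by
            by_contra h; exact hjJ ((mem_compl_iff hJK j.1).2 h)
          have hz : Ψ'.val Ψ'.base = 0 := by
            have := Ψ'.val_smul 0 Ψ'.base Ψ'.proj_base
            rwa [zero_mul, Ψ'.proj_base] at this
          rw [if_neg hjJ, coords_pair', ← add_zero (Ψ.val _), ← hz,
            ← h2 _ _ (proj_update Ψ K hK e) Ψ'.proj_base, h1]
          · congr 1
            apply dec_ext; intro I
            rw [dec_add]
            by_cases hI : I = K
            · subst hI; simp [base_eq_zero Ψ' hK]
            · rw [Function.update_of_ne hI, Function.update_of_ne hI, dec_add]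
          · apply dec_ext; intro I
            rw [dec_smul, dec_smul]
            by_cases hI : I = K
            · subst hI; rw [if_pos (by exact hjK), if_pos (by exact hjK)]; simp
            · rw [Function.update_of_ne hI]
              split_ifs with hjI
              · simp
              · exact hbc I hjI
    · intro h
      have hb : Φ.base = (dec B o).add (oldDir j hj) Ψ.base Ψ'.base := by
        apply base_ext
        · intro I hI; rw [dec_add, base_eq_zero Ψ hI, base_eq_zero Ψ' hI]; simp
        · intro I hI
          rw [h, dec_add, dec_add, coords_keep _ _ I.2, coords_keep _ _ I.2]; rfl
      refine ⟨hb, fun d d' hd hd' hdd => ?_⟩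
      rw [val_eq Ψ d hd, val_eq Ψ' d' hd', val_eq Φ _ ?_, ← Finset.sum_add_distrib]
      · apply sum_term_congr
        · intro K hK; rw [term_zero _ _ _ hK, term_zero _ _ _ hK, add_zero]
        · intro J K hJK hK hJ
          rw [term_eq _ _ J K hJK, term_eq _ _ J K hJK, h, dec_add, dec_add]
          by_cases hjJ : j.1 ∈ J.1.1
          · have hjK : (oldDir j hj).1 ∉ K.1.1 := (mem_compl_iff hJK j.1).1 hjJ
            have := congrFun hdd K
            rw [dec_smul, dec_smul, if_neg hjK, if_neg hjK] at this
            rw [if_pos hjJ, if_neg hjK, map_add, LinearMap.add_apply, this]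
          · have hjK : j.1 ∈ K.1.1 := by
              by_contra h; exact hjJ ((mem_compl_iff hJK j.1).2 h)
            rw [if_neg hjJ, if_pos (by exact hjK), map_add, hc J hjJ]
      · rw [(dec B o).smul_add_comm _ _ _ _ _ hij hdd, hd, hd', hb]

lemma core_same {o : Fin 4} (J : Coord o) (x : B.E J.1 m) : (dec B o).core J x J = x :=
  Pi.single_eq_same (M := fun J : Coord o => B.E J.1 m) J x

lemma core_ne {o : Fin 4} {J J' : Coord o} (h : J' ≠ J) (x : B.E J.1 m) :
    (dec B o).core J x J' = 0 :=
  Pi.single_eq_of_ne (M := fun J : Coord o => B.E J.1 m) h x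

lemma isCore_iff (J : Coord i.1) (x : B.E J.1 m) (Φ : FibDual (dec B o) i m) :
    IsCore J x Φ ↔ coords Φ = (dec B i.1).core J x := by
  unfold IsCore
  split_ifs with hJ
  · constructor
    · rintro ⟨h1, h2⟩
      apply coords_ext
      · intro J' hJ'
        have hne : J' ≠ J := by rintro rfl; exact hJ' hJ
        rw [coords_keep _ _ hJ', h1]
        exact (core_ne hne x).symm
      · intro J' K hJK e
        have hK : i.1 ∈ K.1.1 := by
          by_contra h; exact J'.2 ((mem_compl_iff hJK i.1).2 h)
        have hv : Φ.val ((dec B o).core K e) = Φ.val (Function.update Φ.base K e) := by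
          congr 1; rw [h1]; rfl
        rw [coords_pair', ← hv]
        by_cases hne : J' = J
        · subst hne
          rw [(h2 K e hK).1 hJK, core_same]
        · rw [(h2 K e hK).2]
          · rw [core_ne hne]; simp
          · intro h
            exact hne (Subtype.ext (Subtype.ext (hJK.symm.right_unique h.symm)))
    · intro h
      have hb : Φ.base = (dec B o).zero m := by
        apply base_ext
        · intro I hI; rfl
        · intro I hI
          have hne : (⟨I.1, hI⟩ : Coord i.1) ≠ J := by
            rintro rfl; exact I.2 hJ
          rw [h]
          exact core_ne hne x
      have hv : ∀ (K : Coord o) (y : B.E K.1 m), Φ.val ((dec B o).core K y) =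
          Φ.val (Function.update Φ.base K y) := by
        intro K y; congr 1; rw [hb]; rfl
      refine ⟨hb, fun K y hK => ⟨fun hJK => ?_, fun hJK => ?_⟩⟩
      · rw [hv, ← coords_pair' Φ J K hJK, h]
        rw [core_same]
      · rw [hv, ← coords_pair' Φ (K.dual hK) K (K.isCompl_dual hK), h]
        have hne : K.dual hK ≠ J := by
          rintro rfl; exact hJK (K.isCompl_dual hK)
        rw [core_ne hne]; simp
  · constructor
    · rintro ⟨h1, h2⟩
      apply coords_ext
      · intro J' hJ'
        rw [coords_keep _ _ hJ', h1]
        by_cases hne : J' = J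
        · subst hne; rw [core_same]; exact (core_same J' x).symm
        · rw [core_ne hne, core_ne]
          intro h; exact hne (Subtype.ext (congrArg (fun K : Coord o => K.1) h))
      · intro J' K hJK e
        have hJ' : o ∈ J'.1.1 := (mem_compl_iff hJK o).2 K.2
        have hne : J' ≠ J := by rintro rfl; exact hJ hJ'
        rw [coords_pair', h2]
        rw [core_ne hne]; simp
    · intro h
      have hb : Φ.base = (dec B o).core ⟨J.1, hJ⟩ x := by
        apply base_ext
        · intro I hI
          apply core_ne
          rintro rfl; exact J.2 hI
        · intro I hI
          rw [h]
          by_cases hne : I = ⟨J.1, hJ⟩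
          · subst hne; rw [core_same]; exact (core_same (⟨J.1, hJ⟩ : Coord o) x).symm
          · refine (core_ne ?_ x).trans (core_ne hne x).symm
            intro h; exact hne (Subtype.ext (congrArg (fun K : Coord i.1 => K.1) h))
      refine ⟨hb, fun d => ?_⟩
      by_cases hd : (dec B o).smul i 0 d = Φ.base
      · rw [val_eq Φ d hd]
        apply Finset.sum_eq_zero
        intro K _
        by_cases hK : i.1 ∈ K.1.1
        · have hne : K.dual hK ≠ J := by rintro rfl; exact hJ (K.mem_dual hK)
          rw [term_eq _ _ _ K (K.isCompl_dual hK), h]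
          rw [core_ne hne]; simp
        · exact term_zero _ _ _ hK
      · exact Φ.val_off d hd

end DecDual

/-- The dual of a statomorphism of decomposed triple vector bundles, in coordinates. -/
def Stat.decDual (χ : Stat (dec B o) (dec B o)) (i : Dir o) : Stat (dec B i.1) (dec B i.1) where
  equiv m := (DecDual.equiv i m).symm.trans ((χ.dualEquiv i m).trans (DecDual.equiv i m))
  map_smul {m} j a f := by
    have h := (DecDual.isSmul_iff j a ((DecDual.equiv i m).symm f)
      ((DecDual.equiv i m).symm ((dec B i.1).smul j a f))).2 (by
        show DecDual.equiv i m _ = (dec B i.1).smul j a (DecDual.equiv i m _)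
        rw [Equiv.apply_symm_apply, Equiv.apply_symm_apply])
    exact (DecDual.isSmul_iff j a _ _).1 (h.dualEquiv χ)
  map_add {m} j f g hfg := by
    have hs : ∀ f : DecFibre B i.1 m, DecDual.coords ((DecDual.equiv i m).symm f) = f :=
      fun f => (DecDual.equiv i m).apply_symm_apply f
    have h := (DecDual.isAdd_iff j ((DecDual.equiv i m).symm f) ((DecDual.equiv i m).symm g)
      ((DecDual.equiv i m).symm ((dec B i.1).add j f g)) (by rw [hs, hs]; exact hfg)).2 (by
        rw [hs, hs, hs])
    have hsm : ∀ f : DecFibre B i.1 m, FibDual.IsSmul j 0 ((DecDual.equiv i m).symm f)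
        ((DecDual.equiv i m).symm ((dec B i.1).smul j 0 f)) := fun f =>
      (DecDual.isSmul_iff j 0 _ _).2 (by rw [hs, hs])
    refine (DecDual.isAdd_iff j _ _ _ ?_).1 (h.dualEquiv χ ?_)
    · rw [← (DecDual.isSmul_iff j 0 _ _).1 ((hsm f).dualEquiv χ),
        ← (DecDual.isSmul_iff j 0 _ _).1 ((hsm g).dualEquiv χ)]
      rw [show (dec B i.1).smul j 0 f = (dec B i.1).smul j 0 g from hfg]
    · intro hj
      have h1 := hsm f
      have h2 := hsm g
      rw [show (dec B i.1).smul j 0 f = (dec B i.1).smul j 0 g from hfg] at h1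
      unfold FibDual.IsSmul at h1 h2
      rw [dif_neg hj] at h1 h2
      rw [← h1.1, ← h2.1]
  map_core {m} J x := by
    have h := (DecDual.isCore_iff J x ((DecDual.equiv i m).symm ((dec B i.1).core J x))).2
      ((DecDual.equiv i m).apply_symm_apply _)
    exact (DecDual.isCore_iff J x _).1 (h.dualEquiv χ)

lemma contDiffAt_clm_apply' {D E F : Type} [NormedAddCommGroup D] [NormedSpace ℝ D]
    [NormedAddCommGroup E] [NormedSpace ℝ E] [FiniteDimensional ℝ E]
    [NormedAddCommGroup F] [NormedSpace ℝ F] {f : D → E →L[ℝ] F} {x : D}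
    (h : ∀ y, ContDiffAt ℝ ∞ (fun x => f x y) x) : ContDiffAt ℝ ∞ f x := by
  let d := Module.finrank ℝ E
  have hd : d = Module.finrank ℝ (Fin d → ℝ) := (Module.finrank_fin_fun ℝ).symm
  let e₁ := ContinuousLinearEquiv.ofFinrankEq hd
  let e₂ := (e₁.arrowCongr (1 : F ≃L[ℝ] F)).trans (ContinuousLinearEquiv.piRing (Fin d))
  rw [← Function.id_comp f, ← e₂.symm_comp_self]
  exact e₂.symm.contDiff.contDiffAt.comp x (contDiffAt_pi.2 fun i => h _)

/-- A map into the total space of `E_J` is smooth if its pairing with smooth maps into the total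
space of `E_{Jᶜ}` is smooth. -/
lemma smoothAt_of_pair (B : BuildingSystem) (J K : Lab) (h : IsCompl J.1 K.1) {d : ℕ}
    {q : EuclideanSpace ℝ (Fin d) → B.M.carrier} {u₀ : EuclideanSpace ℝ (Fin d)}
    (hq : ContMDiffAt (𝓡 d) (𝓡 B.M.dim) ∞ q u₀) (s : ∀ u, B.E J (q u))
    (hs : ∀ t : ∀ u, B.E K (q u), (B.V K).SmoothAt q t u₀ →
      ContDiffAt ℝ ∞ (fun u => B.pair J K h (q u) (s u) (t u)) u₀) :
    (B.V J).SmoothAt q s u₀ := by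
  set eJ := trivializationAt (B.V J).F (B.V J).E (q u₀) with heJ
  set eK := trivializationAt (B.V K).F (B.V K).E (q u₀) with heK
  have hJ : ∀ᶠ u in nhds u₀, q u ∈ eJ.baseSet := hq.continuousAt.eventually
    (eJ.open_baseSet.mem_nhds (mem_baseSet_trivializationAt _ _ _))
  have hK : ∀ᶠ u in nhds u₀, q u ∈ eK.baseSet := hq.continuousAt.eventually
    (eK.open_baseSet.mem_nhds (mem_baseSet_trivializationAt _ _ _))
  have frameJ : ∀ v, (B.V J).SmoothAt q (fun u => eJ.symmₗ ℝ (q u) v) u₀ := by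
    intro v
    refine contMDiffAt_totalSpace.2 ⟨hq, ?_⟩
    refine (contMDiffAt_const (c := v)).congr_of_eventuallyEq ?_
    filter_upwards [hJ] with u hu
    rw [eJ.coe_symmₗ hu]
    exact congrArg Prod.snd (eJ.apply_mk_symm hu v)
  have frameK : ∀ v, (B.V K).SmoothAt q (fun u => eK.symmₗ ℝ (q u) v) u₀ := by
    intro v
    refine contMDiffAt_totalSpace.2 ⟨hq, ?_⟩
    refine (contMDiffAt_const (c := v)).congr_of_eventuallyEq ?_
    filter_upwards [hK] with u hu
    rw [eK.coe_symmₗ hu]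
    exact congrArg Prod.snd (eK.apply_mk_symm hu v)
  let C : ((B.V K).F →ₗ[ℝ] ℝ) ≃ₗ[ℝ] ((B.V K).F →L[ℝ] ℝ) := LinearMap.toContinuousLinearMap
  let L : ∀ u, (B.V J).F →ₗ[ℝ] ((B.V K).F →L[ℝ] ℝ) := fun u =>
    C.toLinearMap ∘ₗ ((B.pair J K h (q u)).compl₁₂ (eJ.symmₗ ℝ (q u)) (eK.symmₗ ℝ (q u)))
  let A : EuclideanSpace ℝ (Fin d) → (B.V J).F →L[ℝ] ((B.V K).F →L[ℝ] ℝ) := fun u =>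
    LinearMap.toContinuousLinearMap (L u)
  let g : EuclideanSpace ℝ (Fin d) → ((B.V K).F →L[ℝ] ℝ) := fun u =>
    C ((B.pair J K h (q u) (s u)).comp (eK.symmₗ ℝ (q u)))
  have hA : ContDiffAt ℝ ∞ A u₀ := by
    refine contDiffAt_clm_apply' fun v => contDiffAt_clm_apply' fun w => ?_
    exact B.pair_smooth J K h d q _ _ u₀ (frameJ v) (frameK w)
  have hg : ContDiffAt ℝ ∞ g u₀ := by
    refine contDiffAt_clm_apply' fun w => ?_
    exact hs _ (frameK w)
  have hbij : ∀ u, q u ∈ eJ.baseSet → q u ∈ eK.baseSet → Function.Bijective (L u) := by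
    intro u hu hu'
    have b1 : Function.Bijective (eJ.symmₗ ℝ (q u)) := by
      rw [eJ.coe_symmₗ hu]
      exact (eJ.continuousLinearEquivAt ℝ (q u) hu).symm.bijective
    have b2 : Function.Bijective (eK.symmₗ ℝ (q u)) := by
      rw [eK.coe_symmₗ hu']
      exact (eK.continuousLinearEquivAt ℝ (q u) hu').symm.bijective
    let e2 : (B.V K).F ≃ₗ[ℝ] (B.V K).E (q u) := LinearEquiv.ofBijective _ b2
    have : (L u : (B.V J).F → _) = C ∘ e2.dualMap ∘ (B.pair J K h (q u)) ∘ (eJ.symmₗ ℝ (q u)) := by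
      rfl
    rw [this]
    exact C.bijective.comp (e2.dualMap.bijective.comp ((B.pair_bijective J K h (q u)).comp b1))
  let eq : ∀ u, q u ∈ eJ.baseSet → q u ∈ eK.baseSet →
      ((B.V J).F ≃L[ℝ] ((B.V K).F →L[ℝ] ℝ)) := fun u hu hu' =>
    (LinearEquiv.ofBijective (L u) (hbij u hu hu')).toContinuousLinearEquiv
  have heq : ∀ u hu hu', (eq u hu hu' : (B.V J).F →L[ℝ] ((B.V K).F →L[ℝ] ℝ)) = A u := by
    intro u hu hu'; ext; rfl
  refine contMDiffAt_totalSpace.2 ⟨hq, ?_⟩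
  have hc : ContDiffAt ℝ ∞ (fun u => (A u).inverse (g u)) u₀ := by
    have h1 : ContDiffAt ℝ ∞ (fun u => (A u).inverse) u₀ := by
      refine ContDiffAt.comp (g := ContinuousLinearMap.inverse) u₀ ?_ hA
      rw [← heq u₀ hJ.self_of_nhds hK.self_of_nhds]
      exact contDiffAt_map_inverse _
    exact h1.clm_apply hg
  refine hc.contMDiffAt.congr_of_eventuallyEq ?_
  filter_upwards [hJ, hK] with u hu hu'
  rw [← heq u hu hu', ContinuousLinearMap.inverse_equiv]
  symm
  show (eq u hu hu').symm (g u) = _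
  rw [ContinuousLinearEquiv.symm_apply_eq]
  have hsym : eJ.symmₗ ℝ (q u) (eJ ⟨q u, s u⟩).2 = s u := by
    rw [eJ.coe_symmₗ hu]; exact eJ.symm_apply_apply_mk hu (s u)
  ext w
  show _ = B.pair J K h (q u) (eJ.symmₗ ℝ (q u) (eJ ⟨q u, s u⟩).2) (eK.symmₗ ℝ (q u) w)
  rw [hsym]
  rfl

lemma Stat.decDual_symm (χ : Stat (dec B o) (dec B o)) (i : Dir o) :
    (χ.decDual i).symm = χ.symm.decDual i := rfl

/-- The zero section is smooth. -/
lemma smoothAt_zero {M : SmoothManifold} (V : SmoothVB M) {d : ℕ}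
    {q : EuclideanSpace ℝ (Fin d) → M.carrier} {u₀ : EuclideanSpace ℝ (Fin d)}
    (hq : ContMDiffAt (𝓡 d) (𝓡 M.dim) ∞ q u₀) : V.SmoothAt q (fun _ => 0) u₀ :=
  ContMDiffAt.comp u₀ (contMDiffAt_zeroSection ℝ V.E) hq

lemma singleton_label (o : Fin 4) : ({o} : Finset (Fin 4)).Nonempty ∧ {o} ≠ Finset.univ := by
  revert o; decide

lemma Stat.decDual_smoothMap {χ : Stat (dec B o) (dec B o)} (h : χ.IsSmooth) (i : Dir o) :
    SmoothMap B i.1 (fun m => (χ.decDual i).equiv m) := by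
  intro d q s u₀ hs
  have hq : ContMDiffAt (𝓡 d) (𝓡 B.M.dim) ∞ q u₀ :=
    (contMDiffAt_totalSpace.1 (hs ⟨⟨{o}, singleton_label o⟩, by simpa using i.2⟩)).1
  let b : ∀ u, DecFibre B o (q u) := fun u => (DecDual.ofCoords (s u)).base
  have hb : ∀ I : Coord o, (B.V I.1).SmoothAt q (fun u => b u I) u₀ := by
    intro I
    by_cases hI : i.1 ∈ I.1.1
    · have : (fun u => b u I) = fun u => 0 := by
        funext u; exact dif_pos hI
      rw [this]
      exact smoothAt_zero _ hq
    · have : (fun u => b u I) = fun u => s u ⟨I.1, hI⟩ := by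
        funext u; exact dif_neg hI
      rw [this]
      exact hs ⟨I.1, hI⟩
  have hb' := h.2 d q b u₀ hb
  intro J
  by_cases hJ : o ∈ J.1.1
  · have hJK := J.isCompl_undual hJ
    have hK := J.mem_undual hJ
    set K := J.undual hJ
    refine smoothAt_of_pair B J.1 K.1 hJK hq _ fun t ht => ?_
    let t' : ∀ u, DecFibre B o (q u) := fun u =>
      Function.update ((χ.equiv (q u)).symm (b u)) K (t u)
    have ht' : ∀ I : Coord o, (B.V I.1).SmoothAt q (fun u => t' u I) u₀ := by
      intro I
      by_cases hI : I = K
      · subst hI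
        have : (fun u => t' u K) = t := by funext u; simp [t']
        rw [this]; exact ht
      · have : (fun u => t' u I) = fun u => (χ.equiv (q u)).symm (b u) I := by
          funext u; exact Function.update_of_ne hI _ _
        rw [this]; exact hb' I
    have ht'' := h.1 d q t' u₀ ht'
    have hval : ∀ u, B.pair J.1 K.1 hJK (q u) ((χ.decDual i).equiv (q u) (s u) J) (t u) =
        ∑ K', DecDual.term (s u) (χ.equiv (q u) (t' u)) K' := by
      intro u
      have e1 := DecDual.coords_pair' (χ.dualEquiv i (q u) (DecDual.ofCoords (s u))) J K hJK (t u)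
      refine e1.trans ?_
      refine DecDual.ofCoords_val (s u) _ ?_
      have e2 := DecDual.proj_update (χ.dualEquiv i (q u) (DecDual.ofCoords (s u))) K hK (t u)
      have e3 := congrArg (χ.equiv (q u)) e2
      rw [χ.map_smul] at e3
      exact e3.trans ((χ.equiv (q u)).apply_symm_apply _)
    simp only [hval]
    refine ContDiffAt.sum fun K' _ => ?_
    by_cases hK' : i.1 ∈ K'.1.1
    · simp only [DecDual.term, hK', dif_pos]
      exact B.pair_smooth _ _ _ d q _ _ u₀ (hs _) (ht'' K')
    · simp only [DecDual.term, hK', dif_neg, not_false_eq_true]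
      exact contDiffAt_const
  · have : (fun u => (χ.decDual i).equiv (q u) (s u) J) =
        fun u => (χ.equiv (q u)).symm (b u) ⟨J.1, hJ⟩ := by
      funext u
      exact DecDual.coords_keep _ _ hJ
    rw [this]
    exact hb' ⟨J.1, hJ⟩

lemma Stat.IsSmooth.decDual {χ : Stat (dec B o) (dec B o)} (h : χ.IsSmooth) (i : Dir o) :
    (χ.decDual i).IsSmooth :=
  ⟨Stat.decDual_smoothMap h i, Stat.decDual_smoothMap h.symm i⟩

namespace TVB

/-- A smooth decomposition of `T`. -/
def someDec (T : TVB B o) : Stat T.toPreTVB (dec B o) := T.decs_nonempty.some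

lemma someDec_mem (T : TVB B o) : T.someDec ∈ T.decs := T.decs_nonempty.some_mem

/-- The decomposition of the dual induced by a decomposition of `T`. -/
abbrev dualCoords (T : TVB B o) (i : Dir o) (m : B.M.carrier) :
    FibDual T.toPreTVB i m ≃ DecFibre B i.1 m :=
  (T.someDec.symm.dualEquiv i m).trans (DecDual.equiv i m)

/-- The algebraic part of the dual of `T` in direction `i`. Its points are the points of the
dual vector bundle. The structure is transported from the decomposed
bundle through a decomposition; the lemmas `dualPre_smul`, `dualPre_add`, `dualPre_core`
describe it intrinsically. -/
abbrev dualPre (T : TVB B o) (i : Dir o) : PreTVB B i.1 :=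
  (dec B i.1).transport (FibDual T.toPreTVB i) (T.dualCoords i)

/-- The decomposition of the dual induced by a decomposition of `T`. -/
def dualDec (T : TVB B o) (i : Dir o) : Stat (T.dualPre i) (dec B i.1) where
  equiv := T.dualCoords i
  map_smul _ _ _ := (T.dualCoords i _).apply_symm_apply _
  map_add _ _ _ _ := (T.dualCoords i _).apply_symm_apply _
  map_core _ _ := (T.dualCoords i _).apply_symm_apply _

section intrinsic

variable (T : TVB B o) (i : Dir o) {m : B.M.carrier}

lemma dualEquiv_symm_symm (Φ : FibDual T.toPreTVB i m) :
    T.someDec.dualEquiv i m (T.someDec.symm.dualEquiv i m Φ) = Φ :=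
  (T.someDec.dualEquiv i m).apply_symm_apply Φ

lemma dualPre_smul (j : Dir i.1) (a : ℝ) (Ψ : FibDual T.toPreTVB i m) :
    FibDual.IsSmul j a Ψ ((T.dualPre i).smul j a Ψ) := by
  have h := ((DecDual.isSmul_iff j a (T.someDec.symm.dualEquiv i m Ψ)
    (T.someDec.symm.dualEquiv i m ((T.dualPre i).smul j a Ψ))).2
      ((T.dualDec i).map_smul j a Ψ)).dualEquiv T.someDec
  rwa [dualEquiv_symm_symm, dualEquiv_symm_symm] at h

lemma dualPre_add (j : Dir i.1) (Ψ Ψ' : FibDual T.toPreTVB i m)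
    (h : (T.dualPre i).smul j 0 Ψ = (T.dualPre i).smul j 0 Ψ') :
    FibDual.IsAdd j Ψ Ψ' ((T.dualPre i).add j Ψ Ψ') := by
  have hc := congrArg ((T.dualDec i).equiv m) h
  rw [(T.dualDec i).map_smul, (T.dualDec i).map_smul] at hc
  have h' := ((DecDual.isAdd_iff j (T.someDec.symm.dualEquiv i m Ψ)
    (T.someDec.symm.dualEquiv i m Ψ') (T.someDec.symm.dualEquiv i m ((T.dualPre i).add j Ψ Ψ'))
      hc).2 ((T.dualDec i).map_add j Ψ Ψ' h)).dualEquiv T.someDec (fun hj => by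
        have h1 := T.dualPre_smul i j 0 Ψ
        have h2 := T.dualPre_smul i j 0 Ψ'
        rw [← h] at h2
        unfold FibDual.IsSmul at h1 h2
        rw [dif_neg hj] at h1 h2
        have h3 := congrArg (T.someDec.equiv m) (h1.1.symm.trans h2.1)
        rw [T.someDec.map_smul, T.someDec.map_smul] at h3
        exact h3)
  rwa [dualEquiv_symm_symm, dualEquiv_symm_symm, dualEquiv_symm_symm] at h'

lemma dualPre_core (J : Coord i.1) (x : B.E J.1 m) :
    FibDual.IsCore J x ((T.dualPre i).core J x) := by
  have h := ((DecDual.isCore_iff J x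
    (T.someDec.symm.dualEquiv i m ((T.dualPre i).core J x))).2
      ((T.dualDec i).map_core J x)).dualEquiv T.someDec
  rwa [dualEquiv_symm_symm] at h

end intrinsic

/-- The dual of the triple vector bundle `T` in direction `i`. -/
abbrev dual (T : TVB B o) (i : Dir o) : TVB B i.1 where
  toPreTVB := T.dualPre i
  decs := {Q | ((T.dualDec i).symm.trans Q).IsSmooth}
  decs_nonempty := ⟨T.dualDec i, by
    have : (T.dualDec i).symm.trans (T.dualDec i) = Stat.refl _ := by
      apply Stat.ext; funext m; exact ((T.dualDec i).equiv m).symm_trans_self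
    show Stat.IsSmooth _
    rw [this]; exact Stat.IsSmooth.refl⟩
  mem_decs_iff P hP Q := by
    constructor
    · intro hQ
      have : P.symm.trans Q = ((T.dualDec i).symm.trans P).symm.trans
          ((T.dualDec i).symm.trans Q) := by
        apply Stat.ext; funext m; ext x; simp
      rw [this]
      exact (Stat.IsSmooth.symm hP).trans hQ
    · intro hQ
      have : (T.dualDec i).symm.trans Q = ((T.dualDec i).symm.trans P).trans
          (P.symm.trans Q) := by
        apply Stat.ext; funext m; ext x; simp
      show Stat.IsSmooth _
      rw [this]
      exact Stat.IsSmooth.trans hP hQ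

/-- A statomorphism in the chosen decompositions. -/
def coordHom {S T : TVB B o} (φ : S ⟶ T) : Stat (dec B o) (dec B o) :=
  S.someDec.symm.trans (φ.1.trans T.someDec)

lemma coordHom_isSmooth {S T : TVB B o} (φ : S ⟶ T) : (coordHom φ).IsSmooth :=
  (S.mem_decs_iff _ S.someDec_mem _).1 (φ.2 _ T.someDec_mem)

lemma dualEquiv_eq {S T : TVB B o} (φ : S ⟶ T) (i : Dir o) (m : B.M.carrier) :
    φ.1.dualEquiv i m =
      ((T.dualDec i).trans (((coordHom φ).decDual i).trans (S.dualDec i).symm)).equiv m := by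
  apply Equiv.ext; intro Ψ
  apply (S.dualCoords i m).injective
  show _ = (S.dualCoords i m) ((S.dualCoords i m).symm _)
  rw [Equiv.apply_symm_apply]
  show DecDual.equiv i m _ = DecDual.equiv i m ((coordHom φ).dualEquiv i m
    ((DecDual.equiv i m).symm (DecDual.equiv i m _)))
  rw [Equiv.symm_apply_apply]
  congr 1
  apply FibDual.ext
  · show S.someDec.equiv m ((φ.1.equiv m).symm Ψ.base) = S.someDec.equiv m ((φ.1.equiv m).symm
      ((T.someDec.equiv m).symm (T.someDec.equiv m Ψ.base)))
    rw [Equiv.symm_apply_apply]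
  · funext x
    show Ψ.val (φ.1.equiv m ((S.someDec.equiv m).symm x)) = Ψ.val ((T.someDec.equiv m).symm
      (T.someDec.equiv m (φ.1.equiv m ((S.someDec.equiv m).symm x))))
    rw [Equiv.symm_apply_apply]

/-- The dual of a statomorphism. -/
def dualMap {S T : TVB B o} (φ : S ⟶ T) (i : Dir o) : T.dual i ⟶ S.dual i :=
  ⟨{  equiv := φ.1.dualEquiv i
      map_smul := fun j a x => by
        rw [dualEquiv_eq]; exact Stat.map_smul _ j a x
      map_add := fun j x y h => by
        rw [dualEquiv_eq]; exact Stat.map_add _ j x y h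
      map_core := fun J x => by
        rw [dualEquiv_eq]; exact Stat.map_core _ J x }, fun P hP => by
    refine Eq.subst (motive := fun χ => Stat.IsSmooth χ) ?_
      (((coordHom_isSmooth φ).decDual i).trans hP)
    apply Stat.ext; funext m; ext x
    simp only [Stat.trans_equiv, Stat.symm_equiv, Equiv.trans_apply]
    rw [dualEquiv_eq]
    simp⟩

/-- Dualization in direction `i`, as a contravariant functor. -/
def dualFunctor (B : BuildingSystem) (o : Fin 4) (i : Dir o) : TVB B o ⥤ (TVB B i.1)ᵒᵖ where
  obj T := Opposite.op (T.dual i)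
  map φ := (dualMap φ i).op
  map_id _ := rfl
  map_comp _ _ := rfl

end TVB

/-! ### The duality functors `X`, `Y`, `Z` and the group they generate -/

/-- The triple vector bundles with building bundles `E_{σ(1)}, E_{σ(2)}, E_{σ(3)}`,
`E_{σ(1)σ(2)}, …, E_{σ(1)σ(2)σ(3)}`. -/
abbrev Placed (p : BuildingSystem × Equiv.Perm (Fin 4)) := TVB p.1 (p.2 0)

/-- The category of all triple vector bundles (with their building bundles labelled), with
statomorphisms as morphisms. -/
abbrev C := Σ p : BuildingSystem × Equiv.Perm (Fin 4), Placed p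

instance : Groupoid C where
  inv f := match f with
    | Sigma.SigmaHom.mk φ => Sigma.SigmaHom.mk (Groupoid.inv φ)
  inv_comp := by
    rintro _ _ ⟨φ⟩
    exact congrArg Sigma.SigmaHom.mk (Groupoid.inv_comp φ)
  comp_inv := by
    rintro _ _ ⟨φ⟩
    exact congrArg Sigma.SigmaHom.mk (Groupoid.comp_inv φ)

/-- The contravariant functors `X`, `Y`, `Z`, for `k = 1, 2, 3`: dualization in the `k`-th
direction. The building bundle `E_{σ(k)}` and the dual `E_{σ(0)}` of the ultracore are
exchanged. -/
def dualization (k : Fin 4) (hk : k ≠ 0) : C ⥤ Cᵒᵖ :=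
  Sigma.desc fun p =>
    TVB.dualFunctor p.1 (p.2 0) ⟨p.2 k, fun h => hk (p.2.injective h)⟩ ⋙
      (Sigma.incl (C := Placed) (p.1, p.2 * Equiv.swap 0 k)).op

/-- The same, as covariant functor: all morphisms are invertible, so `C` and `Cᵒᵖ` are identified
by inversion of morphisms. -/
def dualizationCov (k : Fin 4) (hk : k ≠ 0) : C ⥤ C :=
  dualization k hk ⋙ (Groupoid.invEquivalence (C := C)).inverse

/-- Functors `C ⥤ C` up to natural isomorphism. -/
def FunctorClass := Quotient (isIsomorphicSetoid (C ⥤ C))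

/-- The class of a functor. -/
def FunctorClass.mk (F : C ⥤ C) : FunctorClass := Quotient.mk (isIsomorphicSetoid (C ⥤ C)) F

/-- Composition; the product `FG` is `F` followed by `G`, so that `E^{FG} = (E^F)^G`. -/
instance : Monoid FunctorClass where
  mul := Quotient.map₂ (fun F G => F ⋙ G) fun _ _ ⟨α⟩ _ _ ⟨β⟩ => ⟨NatIso.hcomp α β⟩
  one := FunctorClass.mk (𝟭 C)
  mul_assoc := by
    rintro ⟨F⟩ ⟨G⟩ ⟨H⟩
    exact Quotient.sound ⟨Functor.associator F G H⟩
  one_mul := by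
    rintro ⟨F⟩
    exact Quotient.sound ⟨Functor.leftUnitor F⟩
  mul_one := by
    rintro ⟨F⟩
    exact Quotient.sound ⟨Functor.rightUnitor F⟩

/-- The group of duality functors: the group, under composition, of functors generated by
`X`, `Y` and `Z`, modulo natural isomorphism. -/
def DG3 : Subgroup FunctorClassˣ :=
  Subgroup.closure {u | ∃ (k : Fin 4) (hk : k ≠ 0), (u : FunctorClass) =
    FunctorClass.mk (dualizationCov k hk)}

/-- The subgroup `{1, (12)(30), (23)(10), (13)(20)}` of `S_4`. -/
def klein : Subgroup (Equiv.Perm (Fin 4)) where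
  carrier := {1, Equiv.swap 1 2 * Equiv.swap 3 0, Equiv.swap 2 3 * Equiv.swap 1 0,
    Equiv.swap 1 3 * Equiv.swap 2 0}
  one_mem' := by simp
  mul_mem' {a b} ha hb := by
    simp only [Set.mem_insert_iff, Set.mem_singleton_iff] at ha hb ⊢
    revert a b; decide
  inv_mem' {a} ha := by
    simp only [Set.mem_insert_iff, Set.mem_singleton_iff] at ha ⊢
    revert a; decide


end TripleVB

end

/-!
The proof embeds `DG3` into a group of signed permutations and computes there.

In a decomposition of its source and target, a statomorphism is an automorphism `χ` of the
decomposed triple vector bundle, and such a `χ` is a polynomial map whose coefficients are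
multilinear. Since `E_I` and `E_{Iᶜ}` are dual, the coefficients can be read as scalar forms: for
each partition of `{0,1,2,3}` into a pair `P` and two singletons a trilinear form `χ.theta P`, and
for the partition into singletons a quadrilinear form `χ.gamma`. The value of `χ` is paired with
the argument belonging to the block that contains `o`, but as forms on the blocks of a partition of
`{0,1,2,3}` they do not single out `o`. So the forms of `χ` and of its dual `χ.codual i` can be
compared, although they belong to triple vector bundles with different ultracores:

* the `theta P` are additive in `χ` (`Stat.theta_trans`), and dualization in direction `i`
  multiplies `theta P` by `-1`, except for `P = {o, i}`, where it is unchanged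
  (`Stat.theta_codual`);
* dualization changes `gamma` by a sign and by contractions of the trilinear forms. Subtracting a
  quarter of the sum of all contractions gives a form `Stat.gammaCorr` on which dualization acts
  by `-1` exactly (`Stat.gammaCorr_codual`);
* the trilinear forms and `gammaCorr` determine `χ` (`Stat.eq_of_forms`).

Consequently each functor in `DG3` acts on morphisms, in suitable decompositions, by signs on the
forms and by a permutation of the labels (`HasType`). Two functors with the same signs and the
same permutation are naturally isomorphic (`HasType.mk_eq`), because an isomorphism between two
objects that is the identity in decompositions is natural as soon as the forms agree. Conversely
signs and permutation are determined by the class of the functor (`HasType.unique`): the trilinear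
forms of an automorphism do not depend on the decomposition, and for each `P` there is a triple
vector bundle, over a point and with lines as building bundles, with an automorphism for which
`theta P` does not vanish (`exists_theta_ne_zero`). The sign on the quadrilinear form is that of
the permutation and carries no information. So `DG3` is isomorphic to the subgroup of the
semidirect product `SignedPerm` generated by three explicit elements `SignedPerm.gen k`
(`DG3.typeHom_injective`), and `π` is the projection to the permutations.

The elements of this subgroup satisfy the relations `SignedPerm.Admissible`: the product of the
signs of the labels containing `v`, and the product of all signs, are prescribed by the permutation.
For the identity permutation the solutions are the four families `kleinSign κ`, with `κ` in the
Klein group, where a label has sign `1` if it is fixed by `κ` and `-1` otherwise; squares of words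
in the generators realize them. This identifies the kernel with the Klein group, and
`kleinSign_conj` gives equivariance. Finally, the relations exclude an element of order two over
`(12)(30)`, which has order two, so that there is no splitting.
-/

noncomputable section

open scoped Manifold ContDiff
open Bundle CategoryTheory

namespace TripleVB

section

variable {B : BuildingSystem} {o : Fin 4} {m : B.M.carrier}

/-! ### Statomorphisms of decomposed triple vector bundles in coordinates -/

/-- The part of `e` with labels in the family `S`. -/
def rst (S : Finset (Fin 4) → Prop) (e : DecFibre B o m) : DecFibre B o m :=
  open Classical in fun I => if S I.1.1 then e I else 0

lemma rst_pos {S : Finset (Fin 4) → Prop} {e : DecFibre B o m} {I : Coord o} (h : S I.1.1) :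
    rst S e I = e I := if_pos h

lemma rst_neg {S : Finset (Fin 4) → Prop} {e : DecFibre B o m} {I : Coord o} (h : ¬ S I.1.1) :
    rst S e I = 0 := if_neg h

/-- The action of a statomorphism of the decomposed triple vector bundle on a fibre. -/
def Stat.app (χ : Stat (dec B o) (dec B o)) (e : DecFibre B o m) : DecFibre B o m := χ.equiv m e

namespace Stat

variable (χ : Stat (dec B o) (dec B o))

lemma app_symm_app (e : DecFibre B o m) : χ.symm.app (χ.app e) = e :=
  (χ.equiv m).symm_apply_apply e

/-- Additivity in direction `i`, in coordinates. -/
lemma app_add {i : Fin 4} {J : Coord o} (hi : i ∈ J.1.1) {e e₁ e₂ : DecFibre B o m}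
    (h : ∀ I : Coord o, i ∉ I.1.1 → e₁ I = e I ∧ e₂ I = e I)
    (h' : ∀ I : Coord o, i ∈ I.1.1 → e I = e₁ I + e₂ I) :
    χ.app e J = χ.app e₁ J + χ.app e₂ J := by
  let i' : Dir o := ⟨i, fun h => J.2 (h ▸ hi)⟩
  have h1 : (dec B o).add i' e₁ e₂ = e := by
    funext I
    show (if i ∈ I.1.1 then e₁ I + e₂ I else e₁ I) = e I
    split_ifs with hI
    · exact (h' I hI).symm
    · exact (h I hI).1
  have h2 := χ.map_add i' e₁ e₂ (by
    funext I
    show (if i ∈ I.1.1 then (0 : ℝ) • e₁ I else e₁ I) = (if i ∈ I.1.1 then (0 : ℝ) • e₂ I else e₂ I)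
    split_ifs with hI
    · simp
    · rw [(h I hI).1, (h I hI).2])
  rw [h1] at h2
  exact (congrFun h2 J).trans (if_pos hi)

/-- Homogeneity in direction `i`, in coordinates. -/
lemma app_smul {i : Fin 4} {J : Coord o} (hi : i ∈ J.1.1) {a : ℝ} {e e₁ : DecFibre B o m}
    (h : ∀ I : Coord o, i ∉ I.1.1 → e₁ I = e I)
    (h' : ∀ I : Coord o, i ∈ I.1.1 → e₁ I = a • e I) :
    χ.app e₁ J = a • χ.app e J := by
  let i' : Dir o := ⟨i, fun h => J.2 (h ▸ hi)⟩
  have h1 : (dec B o).smul i' a e = e₁ := by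
    funext I
    show (if i ∈ I.1.1 then a • e I else e I) = e₁ I
    split_ifs with hI
    · exact (h' I hI).symm
    · exact (h I hI).symm
  have h2 := χ.map_smul i' a e
  rw [h1] at h2
  exact (congrFun h2 J).trans (if_pos hi)

/-- A component vanishes if the argument lies in the base of one of its directions. -/
lemma app_eq_zero {i : Fin 4} {J : Coord o} (hi : i ∈ J.1.1) {e : DecFibre B o m}
    (h : ∀ I : Coord o, i ∈ I.1.1 → e I = 0) : χ.app e J = 0 := by
  rw [χ.app_smul hi (a := 0) (e := e) (fun _ _ => rfl) (fun I hI => by simp [h I hI]), zero_smul]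

/-- A component of the value depends only on the components of the argument with smaller labels. -/
lemma app_congr {J : Coord o} {e e' : DecFibre B o m}
    (h : ∀ I : Coord o, I.1.1 ⊆ J.1.1 → e I = e' I) : χ.app e J = χ.app e' J := by
  -- project to the base in the directions outside `J`, one after the other
  have key : ∀ (D : Finset (Fin 4)) (e : DecFibre B o m), Disjoint D J.1.1 →
      χ.app (rst (fun I => Disjoint D I) e) J = χ.app e J := by
    intro D e
    induction D using Finset.induction_on with
    | empty =>
      intro _
      congr 1; funext I
      exact rst_pos (Finset.disjoint_empty_left _)
    | insert i D hi ih =>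
      intro hD
      rw [Finset.disjoint_insert_left] at hD
      rw [← ih hD.2]
      by_cases hio : i = o
      · congr 1; funext I
        have : Disjoint (insert i D) I.1.1 ↔ Disjoint D I.1.1 := by
          rw [Finset.disjoint_insert_left]
          exact ⟨fun h => h.2, fun h => ⟨hio ▸ I.2, h⟩⟩
        by_cases hI : Disjoint D I.1.1
        · rw [rst_pos (this.2 hI), rst_pos hI]
        · rw [rst_neg (fun h => hI (this.1 h)), rst_neg hI]
      · have h1 := congrFun (χ.map_smul ⟨i, hio⟩ 0 (rst (fun I => Disjoint D I) e)) J
        refine Eq.trans ?_ (h1.trans (if_neg hD.1))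
        show χ.app _ J = χ.app _ J
        congr 1; funext I
        show _ = if i ∈ I.1.1 then (0 : ℝ) • _ else _
        split_ifs with hiI
        · rw [zero_smul, rst_neg]
          rw [Finset.disjoint_insert_left]; exact fun h => h.1 hiI
        · by_cases hI : Disjoint D I.1.1
          · rw [rst_pos hI, rst_pos]
            rw [Finset.disjoint_insert_left]; exact ⟨hiI, hI⟩
          · rw [rst_neg hI, rst_neg]
            rw [Finset.disjoint_insert_left]; exact fun h => hI h.2
  rw [← key J.1.1ᶜ e disjoint_compl_left, ← key J.1.1ᶜ e' disjoint_compl_left]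
  congr 1; funext I
  by_cases hI : Disjoint J.1.1ᶜ I.1.1
  · rw [rst_pos hI, rst_pos hI, h]
    intro i hi
    by_contra hiJ
    exact Finset.disjoint_left.1 hI (Finset.mem_compl.2 hiJ) hi
  · rw [rst_neg hI, rst_neg hI]

lemma app_of_support {K : Coord o} {e : DecFibre B o m} (h : ∀ I : Coord o, I ≠ K → e I = 0) :
    χ.app e = e := by
  have : e = (dec B o).core K (e K) := by
    funext I
    by_cases hI : I = K
    · subst hI; exact (DecDual.core_same I (e I)).symm
    · rw [h I hI]; exact (DecDual.core_ne hI (e K)).symm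
  rw [this]
  exact χ.map_core K (e K)

/-- The correction `χ(e)_J - e_J` depends only on the `e_I` with `I ⊂ J`, `I ≠ J`. This is where it
is used that a statomorphism is the identity on the building bundle `E_J`. -/
lemma app_sub_eq {J : Coord o} {e e' : DecFibre B o m}
    (h : ∀ I : Coord o, I.1.1 ⊆ J.1.1 → I ≠ J → e I = e' I) :
    χ.app e J - e J = χ.app e' J - e' J := by
  classical
  suffices H : ∀ e : DecFibre B o m, χ.app e J = e J + χ.app (rst (fun I => I ≠ J.1.1) e) J by
    rw [H e, H e', add_sub_cancel_left, add_sub_cancel_left]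
    apply χ.app_congr
    intro I hI
    by_cases hIJ : I = J
    · subst hIJ; rw [rst_neg (by simp), rst_neg (by simp)]
    · have : I.1.1 ≠ J.1.1 := fun h => hIJ (Subtype.ext (Subtype.ext h))
      rw [rst_pos, rst_pos, h I hI hIJ] <;> exact this
  intro e
  -- use additivity in the directions of `J` one after the other
  have key : ∀ D : Finset (Fin 4), D ⊆ J.1.1 → D.Nonempty →
      χ.app e J = χ.app (rst (fun I => Disjoint D I ∨ I = J.1.1) e) J +
        χ.app (rst (fun I => I ≠ J.1.1) e) J := by
    intro D
    induction D using Finset.induction_on with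
    | empty => intro _ h; simp at h
    | insert i D hi ih =>
      intro hD _
      have hiJ : i ∈ J.1.1 := hD (Finset.mem_insert_self _ _)
      rcases D.eq_empty_or_nonempty with rfl | hne
      · apply χ.app_add hiJ
        · intro I hI
          constructor
          · rw [rst_pos]; left; simpa using hI
          · rw [rst_pos]; rintro h; exact hI (h ▸ hiJ)
        · intro I hI
          by_cases hIJ : I.1.1 = J.1.1
          · rw [rst_pos (Or.inr hIJ), rst_neg (by simpa using hIJ), add_zero]
          · rw [rst_neg, rst_pos hIJ, zero_add]
            simp [hI, hIJ]
      · rw [ih ((Finset.subset_insert _ _).trans hD) hne]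
        congr 1
        -- what is removed contains no coordinate with a label meeting `D`
        have h0 : χ.app (rst (fun I => Disjoint D I ∧ I ≠ J.1.1) e) J = 0 := by
          obtain ⟨j, hj⟩ := hne
          refine χ.app_eq_zero (hD (Finset.mem_insert_of_mem hj)) fun I hI => rst_neg fun h' => ?_
          exact Finset.disjoint_left.1 h'.1 hj hI
        rw [← add_zero (χ.app (rst (fun I => Disjoint (insert i D) I ∨ I = J.1.1) e) J), ← h0]
        have hdi : ∀ I : Finset (Fin 4), Disjoint (insert i D) I ↔ i ∉ I ∧ Disjoint D I :=
          fun I => Finset.disjoint_insert_left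
        have hD0 : ¬ Disjoint D J.1.1 := by
          obtain ⟨j, hj⟩ := hne
          exact fun h => Finset.disjoint_left.1 h hj (hD (Finset.mem_insert_of_mem hj))
        apply χ.app_add hiJ
        · intro I hI
          have hIJ : I.1.1 ≠ J.1.1 := fun h => hI (h ▸ hiJ)
          by_cases hd : Disjoint D I.1.1
          · rw [rst_pos, rst_pos, rst_pos] <;> simp [hdi, hI, hIJ, hd]
          · rw [rst_neg, rst_neg, rst_neg] <;> simp [hdi, hI, hIJ, hd]
        · intro I hI
          by_cases hIJ : I.1.1 = J.1.1
          · rw [rst_pos, rst_pos, rst_neg] <;> simp [hdi, hIJ, hD0]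
          · by_cases hd : Disjoint D I.1.1
            · rw [rst_pos, rst_neg, rst_pos] <;> simp [hdi, hI, hIJ, hd]
            · rw [rst_neg, rst_neg, rst_neg] <;> simp [hdi, hI, hIJ, hd]
  rw [key J.1.1 subset_rfl J.1.2.1]
  congr 1
  have hs : ∀ I : Coord o, I ≠ J → rst (fun I => I = J.1.1) e I = 0 := fun I hI =>
    rst_neg fun h => hI (Subtype.ext (Subtype.ext h))
  have : χ.app (rst (fun I => I = J.1.1) e) J = e J := by
    rw [χ.app_of_support hs, rst_pos]; rfl
  rw [← this]
  apply χ.app_congr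
  intro I hI
  by_cases hIJ : I.1.1 = J.1.1
  · rw [rst_pos, rst_pos]
    exacts [hIJ, Or.inr hIJ]
  · rw [rst_neg, rst_neg]
    · exact hIJ
    rintro (h | h)
    · obtain ⟨i, hi⟩ := I.1.2.1
      exact Finset.disjoint_left.1 h (hI hi) hi
    · exact hIJ h

lemma app_of_card_eq_one {J : Coord o} (hJ : J.1.1.card = 1) (e : DecFibre B o m) :
    χ.app e J = e J := by
  have h := χ.app_sub_eq (J := J) (e := e) (e' := fun I => if I = J then 0 else e I)
    (fun I _ hIJ => (if_neg hIJ).symm)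
  have h0 : χ.app (fun I => if I = J then 0 else e I) J = 0 := by
    obtain ⟨i, hi⟩ := Finset.card_eq_one.1 hJ
    rw [χ.app_congr (e' := fun I => 0)]
    · exact χ.app_eq_zero (i := i) (by simp [hi]) (fun _ _ => rfl)
    · intro I hI
      rw [hi, Finset.subset_singleton_iff, or_iff_right I.1.2.1.ne_empty] at hI
      exact if_pos (Subtype.ext (Subtype.ext (hI.trans hi.symm)))
  rw [h0] at h
  simpa [sub_eq_zero] using h

lemma app_of_card_eq_two {J : Coord o} (hJ : J.1.1.card = 2) (e : DecFibre B o m) :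
    χ.app e J = e J + χ.app (rst (fun I => I.card = 1) e) J := by
  have h := χ.app_sub_eq (J := J) (e := e) (e' := rst (fun I => I.card = 1) e) (by
    intro I hI hIJ
    rw [rst_pos]
    have h1 := Finset.card_lt_card (hI.ssubset_of_ne
      fun h => hIJ (Subtype.ext (Subtype.ext h)))
    have h2 := I.1.2.1.card_pos
    omega)
  rw [rst_neg (by rw [hJ]; decide), sub_zero] at h
  rw [← h]; abel

end Stat

end

section

variable {B : BuildingSystem} {o : Fin 4} {m : B.M.carrier}

/-! ### The expansion of the top component -/

/-- The two-element labels. They index the partitions of `{0,1,2,3}` into three blocks, by the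
block with two elements. -/
abbrev Pair := {P : Lab // P.1.card = 2}

/-- The two-element label `{a, b}`. -/
def Pair.mk (a b : Fin 4) (h : a ≠ b) : Pair :=
  ⟨⟨{a, b}, by revert a b; decide⟩, Finset.card_pair h⟩

/-- `I` is a block of the partition whose blocks are `P` and the singletons outside `P`. -/
def Blk (P I : Finset (Fin 4)) : Prop := I = P ∨ (I.card = 1 ∧ Disjoint I P)

instance (P I : Finset (Fin 4)) : Decidable (Blk P I) :=
  inferInstanceAs (Decidable (I = P ∨ (I.card = 1 ∧ Disjoint I P)))

lemma blk_pair_iff : ∀ {o a b c : Fin 4}, a ≠ b → a ≠ c → b ≠ c → a ≠ o → b ≠ o → c ≠ o →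
    ∀ I : Finset (Fin 4), o ∉ I → I.Nonempty → (Blk {a, b} I ↔
      ((a ∈ I ∧ b ∈ I ∧ c ∉ I) ∨ (a ∉ I ∧ b ∉ I ∧ c ∈ I))) := by
  decide +kernel

lemma card_eq_one_iff_of_notMem : ∀ {o a b c : Fin 4}, a ≠ b → a ≠ c → b ≠ c → a ≠ o → b ≠ o →
    c ≠ o → ∀ I : Finset (Fin 4), o ∉ I → I.Nonempty →
      (I.card = 1 ↔ ((a ∈ I → b ∉ I ∧ c ∉ I) ∧ (b ∈ I → c ∉ I))) := by
  decide +kernel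

lemma pair_notMem_iff : ∀ {o a b c : Fin 4}, a ≠ b → a ≠ c → b ≠ c → a ≠ o → b ≠ o → c ≠ o →
    ∀ I : Finset (Fin 4), I.card = 2 → (o ∉ I ↔ I = {a, b} ∨ I = {a, c} ∨ I = {b, c}) := by
  decide +kernel

lemma Pair.mk_injective : ∀ {a b c d : Fin 4} (h : a ≠ b) (h' : c ≠ d),
    Pair.mk a b h = Pair.mk c d h' → (a = c ∧ b = d) ∨ (a = d ∧ b = c) := by
  decide +kernel

lemma exists_others (o : Fin 4) : ∃ a b c : Fin 4, a ≠ b ∧ a ≠ c ∧ b ≠ c ∧ a ≠ o ∧ b ≠ o ∧ c ≠ o ∧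
    ∀ x, x = o ∨ x = a ∨ x = b ∨ x = c := by
  revert o; decide

lemma sum_pair_notMem {M : Type} [AddCommMonoid M] (f : Pair → M) {o a b c : Fin 4} (hab : a ≠ b)
    (hac : a ≠ c) (hbc : b ≠ c) (hao : a ≠ o) (hbo : b ≠ o) (hco : c ≠ o) :
    ∑ P : Pair with o ∉ P.1.1, f P = f (.mk a b hab) + (f (.mk a c hac) + f (.mk b c hbc)) := by
  have : Finset.univ.filter (fun P : Pair => o ∉ P.1.1) =
      {Pair.mk a b hab, Pair.mk a c hac, Pair.mk b c hbc} := by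
    ext ⟨⟨P, hP⟩, hP2⟩
    simp only [Finset.mem_filter, Finset.mem_univ, true_and, Finset.mem_insert,
      Finset.mem_singleton, Pair.mk, Subtype.mk.injEq]
    exact pair_notMem_iff hab hac hbc hao hbo hco P hP2
  have h1 : Pair.mk a b hab ≠ Pair.mk a c hac := fun h => by
    have := Pair.mk_injective _ _ h; tauto
  have h2 : Pair.mk a b hab ≠ Pair.mk b c hbc := fun h => by
    have := Pair.mk_injective _ _ h; tauto
  have h3 : Pair.mk a c hac ≠ Pair.mk b c hbc := fun h => by
    have := Pair.mk_injective _ _ h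
    have := hab.symm; have := hbc.symm; tauto
  rw [this, Finset.sum_insert (by simp [h1, h2]), Finset.sum_insert (by simp [h3]),
    Finset.sum_singleton]

lemma rst_congr {S S' : Finset (Fin 4) → Prop} {e e' : DecFibre B o m}
    (h : ∀ I : Coord o, (S I.1.1 ↔ S' I.1.1)) (he : ∀ I : Coord o, S I.1.1 → e I = e' I) :
    rst S e = rst S' e' := by
  funext I
  by_cases hI : S I.1.1
  · rw [rst_pos hI, rst_pos ((h I).1 hI), he I hI]
  · rw [rst_neg hI, rst_neg (fun h' => hI ((h I).2 h'))]

namespace Stat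

variable (χ : Stat (dec B o) (dec B o))

/-- Additivity in direction `i`: the labels containing `i` are distributed to two families. -/
lemma app_rst_split {i : Fin 4} {J : Coord o} (hi : i ∈ J.1.1) (S S₁ S₂ : Finset (Fin 4) → Prop)
    (e : DecFibre B o m)
    (h : ∀ I : Coord o, (i ∉ I.1.1 → ((S₁ I.1.1 ↔ S I.1.1) ∧ (S₂ I.1.1 ↔ S I.1.1))) ∧
      (i ∈ I.1.1 → ((S I.1.1 ↔ (S₁ I.1.1 ∨ S₂ I.1.1)) ∧ ¬ (S₁ I.1.1 ∧ S₂ I.1.1)))) :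
    χ.app (rst S e) J = χ.app (rst S₁ e) J + χ.app (rst S₂ e) J := by
  apply χ.app_add hi
  · intro I hI
    have := (h I).1 hI
    by_cases h : S I.1.1 <;> simp_all [rst]
  · intro I hI
    have := (h I).2 hI
    simp only [rst]
    by_cases h1 : S₁ I.1.1 <;> by_cases h2 : S₂ I.1.1 <;> simp_all

/-- If, within the family `S`, the direction `i` occurs only in labels which contain `j` and belong
to `S₁`, then the labels containing `j` that do not belong to `S₁` do not contribute. -/
lemma app_rst_prune {i j : Fin 4} {J : Coord o} (hi : i ∈ J.1.1) (hj : j ∈ J.1.1)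
    (S S₁ : Finset (Fin 4) → Prop) (e : DecFibre B o m)
    (h : ∀ I : Coord o, (j ∉ I.1.1 → (S₁ I.1.1 ↔ S I.1.1)) ∧ (S₁ I.1.1 → S I.1.1) ∧
      (i ∈ I.1.1 → S I.1.1 → j ∈ I.1.1 ∧ S₁ I.1.1)) :
    χ.app (rst S e) J = χ.app (rst S₁ e) J := by
  rw [χ.app_rst_split hj S S₁ (fun I => S I ∧ (j ∈ I → ¬ S₁ I)) e]
  · rw [χ.app_eq_zero (e := rst (fun I => S I ∧ (j ∈ I → ¬ S₁ I)) e) hi, add_zero]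
    intro I hI
    have := h I
    exact rst_neg (by tauto)
  · intro I
    have := h I
    tauto

/-- The expansion of the top component of a statomorphism: `e_J`, the three terms that are
bilinear in an `E_c` and an `E_ab`, and the term that is trilinear in `E_a`, `E_b`, `E_c`. -/
lemma app_of_eq_compl {J : Coord o} (hJ : J.1.1 = {o}ᶜ) (e : DecFibre B o m) :
    χ.app e J = e J + (∑ P : Pair with o ∉ P.1.1, χ.app (rst (Blk P.1.1) e) J +
      χ.app (rst (fun I => I.card = 1) e) J) := by
  obtain ⟨a, b, c, hab, hac, hbc, ha, hb, hc, hx⟩ := exists_others o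
  rw [sum_pair_notMem _ hab hac hbc ha hb hc]
  have haJ : a ∈ J.1.1 := by simpa [hJ] using ha
  have hbJ : b ∈ J.1.1 := by simpa [hJ] using hb
  have hcJ : c ∈ J.1.1 := by simpa [hJ] using hc
  have hne : ∀ I : Coord o, a ∈ I.1.1 ∨ b ∈ I.1.1 ∨ c ∈ I.1.1 := by
    intro I
    obtain ⟨x, hxI⟩ := I.1.2.1
    rcases hx x with rfl | rfl | rfl | rfl
    · exact (I.2 hxI).elim
    · exact Or.inl hxI
    · exact Or.inr (Or.inl hxI)
    · exact Or.inr (Or.inr hxI)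
  have hJ' : ∀ I : Coord o, I = J ↔ (a ∈ I.1.1 ∧ b ∈ I.1.1 ∧ c ∈ I.1.1) := by
    intro I
    constructor
    · rintro rfl; exact ⟨haJ, hbJ, hcJ⟩
    · intro h
      apply Subtype.ext; apply Subtype.ext; ext x
      have h1 := I.2
      have h2 := J.2
      rcases hx x with rfl | rfl | rfl | rfl <;> simp [*]
  have hcard : ∀ I : Coord o, I.1.1.card = 1 ↔ ((a ∈ I.1.1 → b ∉ I.1.1 ∧ c ∉ I.1.1) ∧
      (b ∈ I.1.1 → c ∉ I.1.1)) := fun I =>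
    card_eq_one_iff_of_notMem hab hac hbc ha hb hc I.1.1 I.2 I.1.2.1
  have h1 := fun I : Coord o => blk_pair_iff hab hac hbc ha hb hc I.1.1 I.2 I.1.2.1
  have h2 := fun I : Coord o => blk_pair_iff hac hab hbc.symm ha hc hb I.1.1 I.2 I.1.2.1
  have h3 := fun I : Coord o => blk_pair_iff hbc hab.symm hac.symm hb hc ha I.1.1 I.2 I.1.2.1
  have h := χ.app_sub_eq (J := J) (e := e)
    (e' := rst (fun I => ¬ (a ∈ I ∧ b ∈ I ∧ c ∈ I)) e) (by
      intro I _ hI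
      rw [rst_pos]
      exact fun h => hI ((hJ' I).2 h))
  rw [rst_neg (fun h => h ⟨haJ, hbJ, hcJ⟩), sub_zero, sub_eq_iff_eq_add'] at h
  rw [h]
  congr 1
  -- distinguish, for each two of the directions `a`, `b`, `c`, whether they occur in the same label
  rw [χ.app_rst_split haJ _ (fun I => ¬ (a ∈ I ∧ b ∈ I ∧ c ∈ I) ∧ (a ∈ I → b ∈ I))
    (fun I => a ∈ I → b ∉ I) e (by intro I; clear * -; tauto),
    χ.app_rst_prune haJ hbJ _ (Blk {a, b}) e (by
      intro I; rw [h1]; have := hne I; clear * - this; tauto), add_assoc]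
  congr 1
  rw [χ.app_rst_split haJ _ (fun I => a ∈ I → b ∉ I ∧ c ∈ I)
    (fun I => a ∈ I → b ∉ I ∧ c ∉ I) e (by intro I; clear * -; tauto),
    χ.app_rst_prune haJ hcJ _ (Blk {a, c}) e (by
      intro I; rw [h2]; have := hne I; clear * - this; tauto), add_assoc]
  congr 1
  rw [χ.app_rst_split hbJ _ (fun I => (a ∈ I → b ∉ I ∧ c ∉ I) ∧ (b ∈ I → c ∈ I))
    (fun I => (a ∈ I → b ∉ I ∧ c ∉ I) ∧ (b ∈ I → c ∉ I)) e (by intro I; clear * -; tauto),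
    χ.app_rst_prune hbJ hcJ _ (Blk {b, c}) e (by
      intro I; rw [h3]; have := hne I; clear * - this; tauto)]
  congr 2
  exact rst_congr (fun I => (hcard I).symm) (fun _ _ => rfl)

end Stat

end

section

variable {B : BuildingSystem} {o : Fin 4} {m : B.M.carrier}

/-! ### The multilinear forms of a statomorphism -/

/-- A choice of a vector in each of the building bundles and their duals. -/
abbrev Vec (B : BuildingSystem) (m : B.M.carrier) := ∀ I : Lab, B.E I m

/-- The components of `v` in the building bundles `E_I`, `o ∉ I`. -/
def pull (o : Fin 4) (v : Vec B m) : DecFibre B o m := fun I => v I.1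

/-- The label `{o}`. -/
def Lab.sing (o : Fin 4) : Lab := ⟨{o}, singleton_label o⟩

/-- The block containing `o` of the partition into `P` and singletons. -/
def Lab.out (P : Lab) (o : Fin 4) : Lab := if o ∈ P.1 then P else .sing o

lemma Lab.mem_out (P : Lab) (o : Fin 4) : o ∈ (P.out o).1 := by
  unfold Lab.out
  split_ifs with h
  · exact h
  · exact Finset.mem_singleton_self o

lemma Lab.isCompl_compl (N : Lab) : IsCompl N.1 N.compl.1 := _root_.isCompl_compl

lemma Lab.eq_of_isCompl {N I J : Lab} (h : IsCompl N.1 I.1) (h' : IsCompl N.1 J.1) : I = J :=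
  Subtype.ext (h.right_unique h')

/-- The complement of a label containing `o`. -/
def Lab.co (N : Lab) (h : o ∈ N.1) : Coord o := ⟨N.compl, by simpa [Lab.compl] using h⟩

lemma Lab.isCompl_co (N : Lab) (h : o ∈ N.1) : IsCompl N.1 (N.co h).1.1 := N.isCompl_compl

/-- The complementary two-element label. -/
def Pair.compl (P : Pair) : Pair := ⟨P.1.compl, by
  obtain ⟨⟨P, h⟩, hP⟩ := P
  have : Pᶜ.card = 2 := by rw [Finset.card_compl, show P.card = 2 from hP]; rfl
  exact this⟩

lemma Pair.isCompl_compl (P : Pair) : IsCompl P.1.1 P.compl.1.1 := _root_.isCompl_compl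

lemma Pair.compl_compl (P : Pair) : P.compl.compl = P :=
  Subtype.ext (Subtype.ext (_root_.compl_compl P.1.1))

lemma Pair.mem_compl (P : Pair) (x : Fin 4) : x ∈ P.compl.1.1 ↔ x ∉ P.1.1 := Finset.mem_compl

lemma pull_update_of_mem {N : Lab} (h : o ∈ N.1) (v : Vec B m) (w : B.E N m) :
    pull o (Function.update v N w) = pull o v := by
  funext I
  exact Function.update_of_ne (fun h' : I.1 = N => I.2 (h' ▸ h)) _ _

lemma Lab.out_val (P : Lab) (o : Fin 4) :
    (P.out o).1 = if o ∈ P.1 then P.1 else {o} := by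
  unfold Lab.out; split_ifs <;> rfl

namespace Stat

variable (χ ψ : Stat (dec B o) (dec B o))

/-- The pairing of `v_N`, `o ∈ N`, with the component in `E_{Nᶜ}` of the value of `χ` at the
components of `v` with labels in the family `S`. -/
def ev (N : Lab) (hN : o ∈ N.1) (S : Finset (Fin 4) → Prop) (v : Vec B m) : ℝ :=
  B.pair N N.compl N.isCompl_compl m (v N) (χ.app (rst S (pull o v)) (N.co hN))

/-- The trilinear form of a statomorphism for the partition of `{0,1,2,3}` into `P` and two
singletons: pair the component of `v` in the block containing `o` with the value of the
statomorphism at the components in the other two blocks. In this form it makes no reference to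
the direction `o` of the ultracore, so that it can be compared with the form of a dual. -/
def theta (P : Pair) (v : Vec B m) : ℝ := χ.ev (P.1.out o) (P.1.mem_out o) (Blk P.1.1) v

/-- The quadrilinear form of a statomorphism, for the partition into singletons. -/
def gamma (v : Vec B m) : ℝ :=
  χ.ev (.sing o) (Finset.mem_singleton_self o) (fun I => I.card = 1) v

variable {χ}

lemma ev_eq {N : Lab} (hN : o ∈ N.1) (S : Finset (Fin 4) → Prop) (v : Vec B m) {J : Coord o}
    (h : IsCompl N.1 J.1.1) :
    χ.ev N hN S v = B.pair N J.1 h m (v N) (χ.app (rst S (pull o v)) J) := by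
  obtain rfl : N.co hN = J := Subtype.ext (Lab.eq_of_isCompl N.isCompl_compl h)
  rfl

lemma theta_eq {P : Pair} {N : Lab} (hN : P.1.out o = N) (v : Vec B m) {J : Coord o}
    (h : IsCompl N.1 J.1.1) :
    χ.theta P v = B.pair N J.1 h m (v N) (χ.app (rst (Blk P.1.1) (pull o v)) J) := by
  subst hN
  exact ev_eq _ _ _ _

lemma gamma_eq (v : Vec B m) {J : Coord o} (h : IsCompl (Lab.sing o).1 J.1.1) :
    χ.gamma v = B.pair (.sing o) J.1 h m (v (.sing o))
      (χ.app (rst (fun I => I.card = 1) (pull o v)) J) :=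
  ev_eq _ _ _ _

lemma not_blk_out_compl : ∀ (o : Fin 4) (P : Finset (Fin 4)), P.card = 2 →
    ¬ Blk P (if o ∈ P then P else {o})ᶜ := by
  decide +kernel

/-- A label properly contained in the union of the blocks not containing `o` contains at most one
of these blocks. -/
lemma exists_block_of_ssubset : ∀ (o : Fin 4) (P : Finset (Fin 4)), P.card = 2 →
    ∀ I : Finset (Fin 4), I.Nonempty → I ⊂ (if o ∈ P then P else {o})ᶜ →
      ∃ K : Finset (Fin 4), (K.Nonempty ∧ K ≠ Finset.univ) ∧ o ∉ K ∧
        ∀ I' : Finset (Fin 4), Blk P I' → I' ⊆ I → I'.Nonempty → I' = K := by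
  decide +kernel

/-- The trilinear forms are additive: only components of `χ` in `E_I` for `I` smaller than the
union of two blocks enter the correction made by `ψ`, and there `χ` acts as the identity. -/
lemma theta_trans (P : Pair) (v : Vec B m) :
    (χ.trans ψ).theta P v = χ.theta P v + ψ.theta P v := by
  set J := (P.1.out o).co (P.1.mem_out o) with hJ
  have hc : IsCompl (P.1.out o).1 J.1.1 := Lab.isCompl_compl _
  rw [theta_eq rfl v hc, theta_eq rfl v hc, theta_eq rfl v hc, ← _root_.map_add]
  congr 1
  set e := rst (Blk P.1.1) (pull o v)
  have hJ' : J.1.1 = (if o ∈ P.1.1 then P.1.1 else {o})ᶜ := by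
    rw [hJ, ← Lab.out_val]; rfl
  have h := ψ.app_sub_eq (J := J) (e := χ.app e) (e' := e) (by
    intro I hI hIJ
    obtain ⟨K, hK, hoK, hK'⟩ := exists_block_of_ssubset o P.1.1 P.2 I.1.1 I.1.2.1
      (hJ' ▸ hI.ssubset_of_ne fun h => hIJ (Subtype.ext (Subtype.ext h)))
    have h1 : χ.app e I = χ.app (rst (fun I' => I' ⊆ I.1.1) e) I :=
      χ.app_congr fun I' hI' => (rst_pos (S := fun K => K ⊆ I.1.1) hI').symm
    rw [h1, χ.app_of_support (K := ⟨⟨K, hK⟩, hoK⟩)]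
    · exact rst_pos (S := fun I' => I' ⊆ I.1.1) subset_rfl
    · intro I' hne
      by_cases hs : I'.1.1 ⊆ I.1.1
      · rw [rst_pos (S := fun K => K ⊆ I.1.1) hs]
        exact rst_neg fun hb => hne (Subtype.ext (Subtype.ext (hK' _ hb hs I'.1.2.1)))
      · exact rst_neg hs)
  have h0 : e J = 0 := rst_neg (by rw [hJ']; exact not_blk_out_compl o _ P.2)
  rw [h0, sub_zero, sub_eq_iff_eq_add'] at h
  exact h

lemma theta_refl (P : Pair) (v : Vec B m) : (Stat.refl (dec B o)).theta P v = 0 := by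
  have h := theta_trans (χ := Stat.refl (dec B o)) (Stat.refl (dec B o)) P v
  have h' : (Stat.refl (dec B o)).trans (Stat.refl (dec B o)) = Stat.refl (dec B o) := rfl
  rw [h'] at h
  linarith

variable (χ)

lemma theta_symm (P : Pair) (v : Vec B m) : χ.symm.theta P v = - χ.theta P v := by
  have h := theta_trans (χ := χ) χ.symm P v
  have h' : χ.trans χ.symm = Stat.refl _ := by
    apply Stat.ext; funext m; exact (χ.equiv m).self_trans_symm
  rw [h', theta_refl] at h
  linarith

/-- The trilinear form for `P` is linear in the argument in `E_P`. -/
lemma exists_linear (P : Pair) (v : Vec B m) :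
    ∃ f : B.E P.1 m →ₗ[ℝ] ℝ, ∀ w, χ.theta P (Function.update v P.1 w) = f w := by
  by_cases ho : o ∈ P.1.1
  · have hN : P.1.out o = P.1 := if_pos ho
    refine ⟨(B.pair P.1 (P.1.co ho).1 P.1.isCompl_compl m).flip
      (χ.app (rst (Blk P.1.1) (pull o v)) (P.1.co ho)), fun w => ?_⟩
    rw [theta_eq hN _ (J := P.1.co ho) P.1.isCompl_compl, pull_update_of_mem ho,
      Function.update_self]
    rfl
  · have hN : P.1.out o = .sing o := if_neg ho
    have hne : Lab.sing o ≠ P.1 := fun h => ho (h ▸ Finset.mem_singleton_self o)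
    set J : Coord o := (Lab.sing o).co (Finset.mem_singleton_self o)
    have hJ : IsCompl (Lab.sing o).1 J.1.1 := Lab.isCompl_compl _
    obtain ⟨i, hi⟩ := P.1.2.1
    have hiJ : i ∈ J.1.1 := by
      have : i ≠ o := fun h => ho (h ▸ hi)
      exact Finset.mem_compl.2 fun h => this (Finset.mem_singleton.1 h)
    have hb : ∀ I : Coord o, I.1 ≠ P.1 → Blk P.1.1 I.1.1 → i ∉ I.1.1 := by
      rintro I hI (h | h) hiI
      · exact hI (Subtype.ext h)
      · exact Finset.disjoint_left.1 h.2 hiI hi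
    -- among the blocks, only `P` contains the direction `i`
    have key : ∀ (w : B.E P.1 m) (I : Coord o), i ∉ I.1.1 →
        rst (Blk P.1.1) (pull o (Function.update v P.1 w)) I = rst (Blk P.1.1) (pull o v) I := by
      intro w I hI
      have hne : I.1 ≠ P.1 := fun h => hI (h ▸ hi)
      simp only [rst, pull, Function.update_of_ne hne]
    have key' : ∀ (w : B.E P.1 m) (I : Coord o), i ∈ I.1.1 → I.1 ≠ P.1 →
        rst (Blk P.1.1) (pull o (Function.update v P.1 w)) I = 0 :=
      fun w I hI hne => rst_neg fun h => hb I hne h hI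
    have key'' : ∀ (w : B.E P.1 m),
        rst (Blk P.1.1) (pull o (Function.update v P.1 w)) ⟨P.1, ho⟩ = w := fun w =>
      (rst_pos (Or.inl rfl)).trans (Function.update_self _ _ _)
    refine ⟨{ toFun := fun w => χ.theta P (Function.update v P.1 w)
              map_add' := fun w w' => ?_
              map_smul' := fun a w => ?_ }, fun w => rfl⟩
    · rw [theta_eq hN _ hJ, theta_eq hN _ hJ, theta_eq hN _ hJ, Function.update_of_ne hne,
        Function.update_of_ne hne, Function.update_of_ne hne, ← _root_.map_add]
      congr 1
      apply χ.app_add hiJ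
      · intro I hI
        rw [key _ _ hI, key _ _ hI, key _ _ hI]; exact ⟨rfl, rfl⟩
      · intro I hI
        by_cases h : I.1 = P.1
        · obtain rfl : I = ⟨P.1, ho⟩ := Subtype.ext h
          rw [key'', key'', key'']
        · rw [key' _ _ hI h, key' _ _ hI h, key' _ _ hI h, add_zero]
    · rw [theta_eq hN _ hJ, theta_eq hN _ hJ, Function.update_of_ne hne,
        Function.update_of_ne hne, RingHom.id_apply, ← _root_.map_smul]
      congr 1
      apply χ.app_smul hiJ
      · intro I hI
        rw [key _ _ hI, key _ _ hI]
      · intro I hI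
        by_cases h : I.1 = P.1
        · obtain rfl : I = ⟨P.1, ho⟩ := Subtype.ext h
          rw [key'', key'']
        · rw [key' _ _ hI h, key' _ _ hI h, smul_zero]

/-- The vector in `E_Q` representing the trilinear form for `Qᶜ`, as linear form on `E_{Qᶜ}`. -/
def rep (Q : Pair) (v : Vec B m) : B.E Q.1 m :=
  (B.pairEquiv Q.1 Q.compl.1 Q.isCompl_compl m).symm (χ.exists_linear Q.compl v).choose

variable {χ}

lemma pair_rep {P Q : Pair} (h : IsCompl Q.1.1 P.1.1) (v : Vec B m) (w : B.E P.1 m) :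
    B.pair Q.1 P.1 h m (χ.rep Q v) w = χ.theta P (Function.update v P.1 w) := by
  obtain rfl : Q.compl = P := Subtype.ext (Lab.eq_of_isCompl Q.isCompl_compl h)
  rw [(χ.exists_linear Q.compl v).choose_spec w, ← BuildingSystem.pairEquiv_apply]
  unfold rep
  rw [LinearEquiv.apply_symm_apply]

lemma eq_rep {P Q : Pair} (h : IsCompl Q.1.1 P.1.1) {v : Vec B m} {x : B.E Q.1 m}
    (hx : ∀ w, B.pair Q.1 P.1 h m x w = χ.theta P (Function.update v P.1 w)) :
    x = χ.rep Q v := by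
  apply (B.pair_bijective Q.1 P.1 h m).1
  ext w
  rw [hx, pair_rep]

/-- If the label `Q` does not contain `o`, then the representing vector is the component in `E_Q`
of the value of `χ` at a family of vectors in the side bundles. -/
lemma rep_of_notMem {Q : Pair} (ho : o ∉ Q.1.1) (v : Vec B m) :
    χ.app (rst (fun I => I.card = 1) (pull o v)) ⟨Q.1, ho⟩ = χ.rep Q v := by
  have hoc : o ∈ Q.compl.1.1 := (Q.mem_compl o).2 ho
  apply eq_rep Q.isCompl_compl
  intro w
  rw [theta_eq (if_pos hoc) _ (J := ⟨Q.1, ho⟩) Q.isCompl_compl.symm, Function.update_self,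
    B.pair_symm, pull_update_of_mem hoc]
  congr 1
  apply χ.app_congr
  intro I hI
  have : I.1.1.card = 1 ↔ Blk Q.compl.1.1 I.1.1 := by
    constructor
    · exact fun h => Or.inr ⟨h, Q.isCompl_compl.disjoint.mono_left hI⟩
    · rintro (h | h)
      · exact (I.2 (h ▸ hoc)).elim
      · exact h.1
  by_cases hI : I.1.1.card = 1
  · rw [rst_pos hI, rst_pos (this.1 hI)]
  · rw [rst_neg hI, rst_neg (fun h => hI (this.2 h))]

variable (χ)

/-- The contraction of the trilinear forms for `P` and `Pᶜ` by the pairing of `E_P`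
and `E_{Pᶜ}`. -/
def contr (P : Pair) (v : Vec B m) : ℝ := χ.theta P (Function.update v P.1 (χ.rep P v))

lemma contr_compl (P : Pair) (v : Vec B m) : χ.contr P.compl v = χ.contr P v := by
  unfold contr
  rw [← pair_rep P.isCompl_compl, ← pair_rep P.isCompl_compl.symm, B.pair_symm]

/-- The quadrilinear form of a statomorphism, corrected by contractions of the trilinear forms so
that dualization only changes its sign. Dualization in direction `i` changes the sign of the two
contractions for `{o, i}` and its complement, which are equal; this is compensated by the
factor `1 / 4`. -/
def gammaCorr (v : Vec B m) : ℝ := χ.gamma v - 1 / 4 * ∑ P, χ.contr P v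

/-- The pairs not containing `o` give half of the contractions, as `P` and `Pᶜ` contribute the
same. -/
lemma sum_contr_notMem (v : Vec B m) :
    ∑ P : Pair with o ∉ P.1.1, χ.contr P v = 1 / 2 * ∑ P, χ.contr P v := by
  have h1 := Finset.sum_filter_add_sum_filter_not Finset.univ (fun P : Pair => o ∉ P.1.1)
    (fun P => χ.contr P v)
  have h2 : ∑ P : Pair with ¬ o ∉ P.1.1, χ.contr P v =
      ∑ P : Pair with o ∉ P.1.1, χ.contr P v := by
    refine Finset.sum_nbij' Pair.compl Pair.compl ?_ ?_ (fun P _ => P.compl_compl)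
      (fun P _ => P.compl_compl) (fun P _ => (χ.contr_compl P v).symm)
    · intro P hP; simpa [Pair.mem_compl] using hP
    · intro P hP; simpa [Pair.mem_compl] using hP
  linarith

lemma blk_cases {P I : Finset (Fin 4)} (h : Blk P I) : I = P ∨ (I.card = 1 ∧ I ≠ P) := by
  rcases h with h | h
  · exact Or.inl h
  · by_cases hI : I = P
    · exact Or.inl hI
    · exact Or.inr ⟨h.1, hI⟩

/-- The quadrilinear form of the inverse: expand the top component of `χ⁻¹ ∘ χ = 1`. -/
lemma gamma_symm (v : Vec B m) : χ.symm.gamma v =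
    - χ.gamma v + ∑ P : Pair with o ∉ P.1.1, χ.contr P v := by
  set J : Coord o := (Lab.sing o).co (Finset.mem_singleton_self o)
  have hJ : IsCompl (Lab.sing o).1 J.1.1 := Lab.isCompl_compl _
  set e := rst (fun I => I.card = 1) (pull o v) with he
  have h := χ.symm.app_of_eq_compl (J := J) rfl (χ.app e)
  rw [app_symm_app, show e J = 0 from rst_neg (by
    have : ({o} : Finset (Fin 4))ᶜ.card = 3 := by rw [Finset.card_compl]; rfl
    change ({o} : Finset (Fin 4))ᶜ.card ≠ 1; omega)] at h
  have h1 : rst (fun I => I.card = 1) (χ.app e) = rst (fun I => I.card = 1) (pull o v) := by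
    refine rst_congr (fun _ => Iff.rfl) fun I hI => ?_
    rw [χ.app_of_card_eq_one hI, he]; exact rst_pos hI
  have h2 : ∀ P : Pair, o ∉ P.1.1 → rst (Blk P.1.1) (χ.app e) =
      rst (Blk P.1.1) (pull o (Function.update v P.1 (χ.rep P v))) := by
    intro P hP
    refine rst_congr (fun _ => Iff.rfl) fun I hI => ?_
    rcases blk_cases hI with hI | ⟨hI, hIP⟩
    · obtain rfl : I = ⟨P.1, hP⟩ := Subtype.ext (Subtype.ext hI)
      exact (rep_of_notMem hP v).trans (Function.update_self P.1 (χ.rep P v) v).symm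
    · have : I.1 ≠ P.1 := fun h => hIP (congrArg Subtype.val h)
      rw [χ.app_of_card_eq_one hI, he]
      exact (rst_pos hI).trans (Function.update_of_ne this _ _).symm
  have h3 := congrArg (B.pair _ _ hJ m (v (.sing o))) h
  rw [_root_.map_zero, _root_.map_add, _root_.map_add, map_sum, ← gamma_eq, h1, ← gamma_eq] at h3
  have h4 : ∀ P ∈ Finset.univ.filter (fun P : Pair => o ∉ P.1.1), B.pair _ _ hJ m (v (.sing o))
      (χ.symm.app (rst (Blk P.1.1) (χ.app e)) J) = - χ.contr P v := by
    intro P hP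
    have hP := (Finset.mem_filter.1 hP).2
    have hne : Lab.sing o ≠ P.1 := fun h => hP (h ▸ Finset.mem_singleton_self o)
    rw [h2 P hP, contr, ← theta_symm, theta_eq (if_neg hP) _ hJ, Function.update_of_ne hne]
  rw [Finset.sum_congr rfl h4, Finset.sum_neg_distrib] at h3
  linarith

/-- The forms determine the statomorphism. -/
lemma eq_of_forms {χ ψ : Stat (dec B o) (dec B o)}
    (h : ∀ P m (v : Vec B m), χ.theta P v = ψ.theta P v)
    (h' : ∀ m (v : Vec B m), χ.gammaCorr v = ψ.gammaCorr v) : χ = ψ := by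
  have hrep : ∀ P m (v : Vec B m), χ.rep P v = ψ.rep P v := by
    intro P m v
    refine eq_rep P.isCompl_compl fun w => ?_
    rw [pair_rep, h]
  have hgamma : ∀ m (v : Vec B m), χ.gamma v = ψ.gamma v := by
    intro m v
    have := h' m v
    simp only [gammaCorr, contr, hrep, h] at this
    linarith
  -- a vector with prescribed components `e_I`, `o ∉ I`, and one further component
  let ex : ∀ {m} (_ : DecFibre B o m) (N : Lab) (_ : B.E N m), Vec B m := fun e N w I =>
    if hI : o ∉ I.1 then e ⟨I, hI⟩ else Function.update (0 : Vec B _) N w I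
  have hex : ∀ {m} (e : DecFibre B o m) (N : Lab) (w : B.E N m), pull o (ex e N w) = e :=
    fun e N w => funext fun I => dif_pos I.2
  have hex' : ∀ {m} (e : DecFibre B o m) (N : Lab) (_ : o ∈ N.1) (w : B.E N m),
      ex e N w N = w :=
    fun e N hN w => (dif_neg (not_not.2 hN)).trans (Function.update_self _ _ _)
  have key : ∀ m (e : DecFibre B o m) (J : Coord o), χ.app e J = ψ.app e J := by
    intro m e J
    have hc := Finset.card_pos.2 J.1.2.1
    have ho : J.1.1 ⊆ {o}ᶜ := fun x hx => by
      rw [Finset.mem_compl, Finset.mem_singleton]; rintro rfl; exact J.2 hx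
    have hc3 : ({o} : Finset (Fin 4))ᶜ.card = 3 := by rw [Finset.card_compl]; rfl
    have hc' := Finset.card_le_card ho
    have hcases : J.1.1.card = 1 ∨ J.1.1.card = 2 ∨ J.1.1.card = 3 := by omega
    rcases hcases with h1 | h1 | h1
    · rw [app_of_card_eq_one χ h1, app_of_card_eq_one ψ h1]
    · rw [app_of_card_eq_two χ h1, app_of_card_eq_two ψ h1]
      congr 1
      have e1 := fun w => rep_of_notMem (χ := χ) (Q := ⟨J.1, h1⟩) J.2 (ex e (.sing o) w)
      have e2 := fun w => rep_of_notMem (χ := ψ) (Q := ⟨J.1, h1⟩) J.2 (ex e (.sing o) w)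
      simp only [hex] at e1 e2
      exact (e1 0).trans ((hrep _ _ _).trans (e2 0).symm)
    · have hJ' : J.1.1 = {o}ᶜ := Finset.eq_of_subset_of_card_le ho (by omega)
      have hJ : IsCompl (Lab.sing o).1 J.1.1 := by rw [hJ']; exact _root_.isCompl_compl
      rw [app_of_eq_compl χ hJ', app_of_eq_compl ψ hJ']
      congr 2
      · refine Finset.sum_congr rfl fun P hP => ?_
        have hP := (Finset.mem_filter.1 hP).2
        apply (B.pair_bijective _ _ hJ.symm m).1
        ext w
        have e1 := h P m (ex e (.sing o) w)
        rw [theta_eq (if_neg hP) _ hJ, theta_eq (if_neg hP) _ hJ, hex,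
          hex' _ _ (Finset.mem_singleton_self o)] at e1
        rw [B.pair_symm, e1, B.pair_symm]
      · apply (B.pair_bijective _ _ hJ.symm m).1
        ext w
        have e1 := hgamma m (ex e (.sing o) w)
        rw [gamma_eq _ hJ, gamma_eq _ hJ, hex, hex' _ _ (Finset.mem_singleton_self o)] at e1
        rw [B.pair_symm, e1, B.pair_symm]
  apply Stat.ext
  funext m
  apply Equiv.ext
  intro e
  exact funext (key m e)

end Stat

end

section

variable {B : BuildingSystem} {o : Fin 4} {m : B.M.carrier}

/-! ### The forms of the dual of a statomorphism -/

/-- The two-element label `{o, i}`. -/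
def Dir.pair (i : Dir o) : Pair := .mk o i.1 i.2.symm

/-- The sign by which dualization changes the trilinear form for `P`. -/
def Dir.sign (i : Dir o) (P : Pair) : ℝ := if P.1.1 = {o, i.1} then 1 else -1

namespace Stat

variable (χ : Stat (dec B o) (dec B o)) (i : Dir o)

/-- The covariant form `(χ⁻¹)^*` of the dual of a statomorphism `χ`. -/
def codual : Stat (dec B i.1) (dec B i.1) := (χ.decDual i).symm

/-- The point of the base over which the functional with coordinates `f` lives. -/
def dualBase (f : DecFibre B i.1 m) : DecFibre B o m := fun I =>
  if h : i.1 ∈ I.1.1 then 0 else f ⟨I.1, h⟩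

/-- In its base the dual of a statomorphism is the statomorphism itself. -/
lemma codual_keep (f : DecFibre B i.1 m) (J : Coord i.1) (hJ : o ∉ J.1.1) :
    (χ.codual i).app f J = χ.app (dualBase i f) ⟨J.1, hJ⟩ :=
  DecDual.coords_keep _ _ hJ

/-- The components of `(χ⁻¹)^* f` in the building bundles of the dual that are not in its base, if
`f` has only one component of this kind, in `E_N`. -/
lemma pair_codual (f : DecFibre B i.1 m) {N : Lab} (hiN : i.1 ∉ N.1) {J : Coord i.1} {K L : Coord o}
    (hJK : IsCompl J.1.1 K.1.1) (hNL : IsCompl N.1 L.1.1)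
    (hf : ∀ I : Coord i.1, o ∈ I.1.1 → I.1 ≠ N → f I = 0) (w : B.E K.1 m) :
    B.pair J.1 K.1 hJK m ((χ.codual i).app f J) w = B.pair N L.1 hNL m (f ⟨N, hiN⟩)
      (χ.symm.app (Function.update (χ.app (dualBase i f)) K w) L) := by
  have e1 := DecDual.coords_pair' (χ.symm.dualEquiv i m (DecDual.ofCoords f)) J K hJK w
  refine e1.trans ?_
  have e2 := DecDual.proj_update (χ.symm.dualEquiv i m (DecDual.ofCoords f)) K
    ((mem_iff_of_isCompl hJK.symm i.1).2 J.2) w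
  have e3 := congrArg (χ.symm.equiv m) e2
  rw [χ.symm.map_smul] at e3
  refine (DecDual.ofCoords_val f _ (e3.trans ((χ.symm.equiv m).apply_symm_apply _))).trans ?_
  rw [Finset.sum_eq_single L]
  · exact DecDual.term_eq f _ ⟨N, hiN⟩ L hNL
  · intro K' _ hK'
    by_cases hi : i.1 ∈ K'.1.1
    · rw [DecDual.term_eq f _ (K'.dual hi) K' (K'.isCompl_dual hi), hf _ (K'.mem_dual hi),
        _root_.map_zero, LinearMap.zero_apply]
      rintro h
      apply hK'
      have h1 : N.compl = K'.1.compl.compl := by rw [← h]; rfl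
      have h2 : K'.1.compl.compl = K'.1 := Subtype.ext (compl_compl K'.1.1)
      exact Subtype.ext ((h2.symm.trans h1.symm).trans (Lab.eq_of_isCompl N.isCompl_compl hNL))
    · exact DecDual.term_zero f _ K' hi
  · simp

/-- If `o` and `i` are in different blocks, then `R` is the remaining block. -/
lemma exists_third_block : ∀ (i o : Fin 4), i ≠ o → ∀ P : Finset (Fin 4), P.card = 2 →
    P ≠ {o, i} → ∃ R : Finset (Fin 4), (R.Nonempty ∧ R ≠ Finset.univ) ∧ o ∉ R ∧ i ∉ R ∧
      i ∉ (if o ∈ P then P else {o}) ∧ o ∉ (if i ∈ P then P else {i}) ∧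
      R ≠ (if i ∈ P then P else {i}) ∧
      ∀ I : Finset (Fin 4), Blk P I ↔
        I = (if i ∈ P then P else {i}) ∨ I = (if o ∈ P then P else {o}) ∨ I = R := by
  decide +kernel

lemma mem_of_blk : ∀ (i o : Fin 4), i ≠ o → ∀ P : Finset (Fin 4), P = {o, i} →
    ∀ I : Finset (Fin 4), i ∈ I → o ∉ I → ¬ Blk P I := by
  decide +kernel

/-- The block containing `o` and `i` is not changed by the exchange of `o` and `i`, and the form is
read off in the base of the dual. -/
lemma theta_codual_of_eq {P : Pair} (hP : P.1.1 = {o, i.1}) (v : Vec B m) :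
    (χ.codual i).theta P v = χ.theta P v := by
  have ho : o ∈ P.1.1 := by simp [hP]
  have hi : i.1 ∈ P.1.1 := by simp [hP]
  rw [theta_eq (if_pos hi) v (J := P.1.co hi) (P.1.isCompl_co hi),
    theta_eq (if_pos ho) v (J := P.1.co ho) (P.1.isCompl_co ho),
    codual_keep _ _ _ _ (P.1.co ho).2]
  congr 2
  funext I
  unfold dualBase
  split_ifs with h
  · exact (rst_neg (mem_of_blk i.1 o i.2 P.1.1 hP _ h I.2)).symm
  · by_cases hI : Blk P.1.1 I.1.1
    · exact (rst_pos (S := Blk P.1.1) (I := (⟨I.1, h⟩ : Coord i.1)) hI).trans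
        (rst_pos (S := Blk P.1.1) (I := I) (e := pull o v) hI).symm
    · exact (rst_neg (S := Blk P.1.1) (I := (⟨I.1, h⟩ : Coord i.1)) hI).trans
        (rst_neg (S := Blk P.1.1) (I := I) hI).symm

/-- The blocks of `o` and `i` exchange the roles of argument and value, and the dual involves the
inverse of `χ`, which has the opposite trilinear form. -/
lemma theta_codual_of_ne {P : Pair} (hP : P.1.1 ≠ {o, i.1}) (v : Vec B m) :
    (χ.codual i).theta P v = - χ.theta P v := by
  obtain ⟨R, hR, hoR, hiR, hio, hoi, hRi, hblk⟩ := exists_third_block i.1 o i.2 P.1.1 P.2 hP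
  rw [← Lab.out_val, ← Lab.out_val] at hblk
  rw [← Lab.out_val] at hio hoi hRi
  set Ni := P.1.out i.1 with hNi
  set No := P.1.out o with hNo
  have hmi : i.1 ∈ Ni.1 := P.1.mem_out i.1
  have hmo : o ∈ No.1 := P.1.mem_out o
  let R' : Coord o := ⟨⟨R, hR⟩, hoR⟩
  let K : Coord o := ⟨Ni, hoi⟩
  have hJK : IsCompl (Ni.co hmi).1.1 K.1.1 := (Ni.isCompl_co hmi).symm
  set f := rst (Blk P.1.1) (pull i.1 v) with hf
  have hf' : ∀ I : Coord i.1, o ∈ I.1.1 → I.1 ≠ No → f I = 0 := by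
    intro I hI hne
    refine rst_neg fun hb => ?_
    rcases (hblk _).1 hb with h | h | h
    · exact I.2 (h ▸ hmi)
    · exact hne (Subtype.ext h)
    · exact hoR (h ▸ hI)
  have hbase : ∀ I : Coord o, I ≠ R' → dualBase i f I = 0 := by
    intro I hI
    unfold dualBase
    split_ifs with h
    · rfl
    · refine rst_neg fun hb => ?_
      rcases (hblk _).1 hb with h' | h' | h'
      · exact h (h' ▸ hmi)
      · exact I.2 (h' ▸ hmo)
      · exact hI (Subtype.ext (Subtype.ext h'))
  rw [← theta_symm, theta_eq hNi.symm v (J := Ni.co hmi) (Ni.isCompl_co hmi), B.pair_symm,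
    pair_codual χ i f hio hJK (L := No.co hmo) (No.isCompl_co hmo) hf',
    theta_eq hNo.symm v (J := No.co hmo) (No.isCompl_co hmo), χ.app_of_support hbase]
  congr 2
  · exact rst_pos (S := Blk P.1.1) ((hblk _).2 (Or.inr (Or.inl rfl)))
  · funext I
    by_cases hI : I = K
    · subst hI
      rw [Function.update_self]
      exact (rst_pos (S := Blk P.1.1) (I := K) (e := pull o v) ((hblk _).2 (Or.inl rfl))).symm
    · rw [Function.update_of_ne hI]
      by_cases hIR : I = R'
      · subst hIR
        have hb : Blk P.1.1 R := (hblk _).2 (Or.inr (Or.inr rfl))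
        exact ((dif_neg hiR).trans (rst_pos (S := Blk P.1.1) hb)).trans
          (rst_pos (S := Blk P.1.1) (I := R') (e := pull o v) hb).symm
      · rw [hbase I hIR, rst_neg]
        intro hb
        rcases (hblk _).1 hb with h | h | h
        · exact hI (Subtype.ext (Subtype.ext h))
        · exact I.2 (h ▸ hmo)
        · exact hIR (Subtype.ext (Subtype.ext h))

lemma theta_codual (P : Pair) (v : Vec B m) :
    (χ.codual i).theta P v = i.sign P * χ.theta P v := by
  unfold Dir.sign
  split_ifs with h
  · rw [theta_codual_of_eq χ i h, one_mul]
  · rw [theta_codual_of_ne χ i h, neg_one_mul]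

lemma rep_codual (Q : Pair) (v : Vec B m) :
    (χ.codual i).rep Q v = i.sign Q.compl • χ.rep Q v := by
  symm
  refine eq_rep Q.isCompl_compl fun w => ?_
  rw [_root_.map_smul, LinearMap.smul_apply, pair_rep, theta_codual, smul_eq_mul]

lemma contr_codual (P : Pair) (v : Vec B m) :
    (χ.codual i).contr P v = i.sign P * i.sign P.compl * χ.contr P v := by
  unfold contr
  rw [rep_codual, theta_codual, ← pair_rep P.isCompl_compl.symm, _root_.map_smul, smul_eq_mul,
    pair_rep, mul_assoc]

lemma sum_contr_codual (v : Vec B m) :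
    ∑ P, (χ.codual i).contr P v = ∑ P, χ.contr P v - 4 * χ.contr i.pair v := by
  have hne : ¬ i.pair.compl.1.1 = {o, i.1} := by
    intro h
    have : o ∈ i.pair.compl.1.1 := by simp [h]
    exact (i.pair.mem_compl o).1 this (Finset.mem_insert_self _ _)
  have hne' : i.pair ≠ i.pair.compl := fun h => hne (congrArg (fun P : Pair => P.1.1) h).symm
  have h1 : ∑ P, (χ.contr P v - (χ.codual i).contr P v) =
      ∑ P ∈ {i.pair, i.pair.compl}, (χ.contr P v - (χ.codual i).contr P v) := by
    symm
    apply Finset.sum_subset (Finset.subset_univ _)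
    intro P _ hP
    simp only [Finset.mem_insert, Finset.mem_singleton, not_or] at hP
    have h2 : ¬ P.1.1 = {o, i.1} := fun h => hP.1 (Subtype.ext (Subtype.ext h))
    have h3 : ¬ P.compl.1.1 = {o, i.1} := fun h => hP.2 (by
      rw [← P.compl_compl]; congr 1; exact Subtype.ext (Subtype.ext h))
    rw [contr_codual, Dir.sign, Dir.sign, if_neg h2, if_neg h3]
    ring
  rw [Finset.sum_pair hne', Finset.sum_sub_distrib, contr_codual, contr_codual,
    Pair.compl_compl, contr_compl, Dir.sign, Dir.sign,
    if_pos (show i.pair.1.1 = {o, i.1} from rfl), if_neg hne] at h1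
  linarith

lemma eq_sdiff_of_notMem : ∀ (i o : Fin 4), i ≠ o → ∀ P : Finset (Fin 4), P.card = 2 →
    (o ∉ P ∧ i ∉ P) → P = Finset.univ \ {o, i} := by
  decide +kernel

/-- The quadrilinear form of the dual. The dual sends `f` to `f ∘ χ⁻¹`: expand `χ⁻¹` at the base
point, moved by `χ`, together with a vector in `E_i`. As the latter is the only component with a
label containing `i`, just one of the bilinear terms survives besides the trilinear term, that for
the complement of `{o, i}`. -/
lemma gamma_codual (v : Vec B m) :
    (χ.codual i).gamma v = χ.symm.gamma v - χ.contr i.pair v := by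
  set J : Coord o := (Lab.sing o).co (Finset.mem_singleton_self o)
  have hJ : IsCompl (Lab.sing o).1 J.1.1 := Lab.isCompl_compl _
  have hoi : o ∉ (Lab.sing i.1).1 := fun h => i.2 (Finset.mem_singleton.1 h).symm
  have hio : i.1 ∉ (Lab.sing o).1 := fun h => i.2 (Finset.mem_singleton.1 h)
  let K : Coord o := ⟨Lab.sing i.1, hoi⟩
  have hmi : i.1 ∈ (Lab.sing i.1).1 := Finset.mem_singleton_self _
  have hJK : IsCompl ((Lab.sing i.1).co hmi).1.1 K.1.1 := (Lab.isCompl_compl _).symm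
  have hiJ : i.1 ∈ J.1.1 := Finset.mem_compl.2 hio
  set f := rst (fun I => I.card = 1) (pull i.1 v) with hf
  have hf' : ∀ I : Coord i.1, o ∈ I.1.1 → I.1 ≠ Lab.sing o → f I = 0 := by
    intro I hI hne
    refine rst_neg fun hb => hne (Subtype.ext ?_)
    obtain ⟨x, hx⟩ := Finset.card_eq_one.1 hb
    rw [hx] at hI ⊢
    rw [Finset.mem_singleton.1 hI]; rfl
  set b := dualBase i f with hb
  have hb0 : ∀ I : Coord o, i.1 ∈ I.1.1 → b I = 0 := fun I hI => dif_pos hI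
  have hb1 : ∀ I : Coord o, i.1 ∉ I.1.1 → b I = rst (fun I => I.card = 1) (pull o v) I := by
    intro I hI
    refine (dif_neg hI).trans ?_
    by_cases hc : I.1.1.card = 1
    · rw [rst_pos (S := fun I => I.card = 1) hc]
      exact rst_pos (S := fun I => I.card = 1) (I := (⟨I.1, hI⟩ : Coord i.1)) hc
    · rw [rst_neg (S := fun I => I.card = 1) hc]
      exact rst_neg (S := fun I => I.card = 1) (I := (⟨I.1, hI⟩ : Coord i.1)) hc
  set t := Function.update (χ.app b) K (v (Lab.sing i.1)) with ht
  have ht0 : ∀ I : Coord o, I ≠ K → i.1 ∈ I.1.1 → t I = 0 := by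
    intro I hI hiI
    rw [ht, Function.update_of_ne hI, χ.app_eq_zero hiI hb0]
  have ht1 : rst (fun I => I.card = 1) t = rst (fun I => I.card = 1) (pull o v) := by
    refine rst_congr (fun _ => Iff.rfl) fun I hI => ?_
    by_cases hIK : I = K
    · subst hIK; exact Function.update_self _ _ _
    · have : i.1 ∉ I.1.1 := by
        intro h
        obtain ⟨x, hx⟩ := Finset.card_eq_one.1 hI
        apply hIK
        apply Subtype.ext; apply Subtype.ext
        rw [hx] at h ⊢
        rw [← Finset.mem_singleton.1 h]; rfl
      rw [ht, Function.update_of_ne hIK, χ.app_of_card_eq_one hI, hb1 I this]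
      exact rst_pos hI
  have hKc : K.1.1.card = 1 := Finset.card_singleton _
  have hP : ∀ P : Pair, o ∉ P.1.1 → χ.symm.app (rst (Blk P.1.1) t) J =
      if P = i.pair.compl then χ.symm.app (rst (Blk P.1.1)
        (pull o (Function.update v P.1 (χ.rep P v)))) J else 0 := by
    intro P ho
    split_ifs with h
    · have hiP : i.1 ∉ P.1.1 := by
        rw [h, Pair.mem_compl, not_not]
        exact Finset.mem_insert_of_mem (Finset.mem_singleton_self _)
      congr 1
      refine rst_congr (fun _ => Iff.rfl) fun I hI => ?_
      rcases blk_cases hI with hI | ⟨hI, hIP⟩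
      · obtain rfl : I = ⟨P.1, ho⟩ := Subtype.ext (Subtype.ext hI)
        refine Eq.trans ?_ (Function.update_self P.1 (χ.rep P v) v).symm
        rw [← rep_of_notMem ho, ht, Function.update_of_ne]
        · apply χ.app_congr
          intro I' hI'
          exact hb1 I' fun h => hiP (hI' h)
        · intro h
          exact hiP (congrArg (fun K : Coord o => K.1.1) h ▸ hmi)
      · have h1 : I.1 ≠ P.1 := fun h => hIP (congrArg Subtype.val h)
        refine Eq.trans ?_ (Function.update_of_ne h1 (χ.rep P v) v).symm
        have := congrFun ht1 I
        rwa [rst_pos hI, rst_pos hI] at this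
    · have hiP : i.1 ∈ P.1.1 := by
        by_contra hiP
        exact h (Subtype.ext (Subtype.ext (eq_sdiff_of_notMem i.1 o i.2 P.1.1 P.2 ⟨ho, hiP⟩)))
      apply χ.symm.app_eq_zero hiJ
      intro I hiI
      by_cases hbI : Blk P.1.1 I.1.1
      · rw [rst_pos hbI]
        apply ht0 I _ hiI
        rintro rfl
        rcases hbI with h | h
        · have := P.2
          rw [← h, hKc] at this
          omega
        · exact Finset.disjoint_left.1 h.2 hiI hiP
      · exact rst_neg hbI
  have htJ : t J = 0 := by
    refine ht0 J (fun h => ?_) hiJ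
    have : ({o} : Finset (Fin 4))ᶜ.card = 3 := by rw [Finset.card_compl]; rfl
    have h' : ({o} : Finset (Fin 4))ᶜ.card = 1 := by
      rw [← hKc, ← h]; rfl
    omega
  have hic : o ∉ i.pair.compl.1.1 := by
    rw [Pair.mem_compl, not_not]; exact Finset.mem_insert_self _ _
  have hne : Lab.sing o ≠ i.pair.compl.1 := fun h => hic (h ▸ Finset.mem_singleton_self o)
  have hfo : f ⟨Lab.sing o, hio⟩ = v (Lab.sing o) :=
    rst_pos (S := fun I => I.card = 1) (Finset.card_singleton o)
  rw [gamma_eq v (J := (Lab.sing i.1).co hmi) (Lab.isCompl_co _ hmi), B.pair_symm,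
    pair_codual χ i f hio hJK (L := J) hJ hf', hfo, ← ht, χ.symm.app_of_eq_compl (J := J) rfl t,
    htJ, ht1, Finset.sum_congr rfl (fun P hP' => hP P (Finset.mem_filter.1 hP').2),
    zero_add, Finset.sum_ite_eq', if_pos (by simpa using hic), _root_.map_add, ← gamma_eq,
    ← contr_compl, contr]
  have h4 := theta_symm χ i.pair.compl (Function.update v i.pair.compl.1 (χ.rep i.pair.compl v))
  rw [theta_eq (if_neg hic) _ hJ, Function.update_of_ne hne] at h4
  rw [h4]
  ring

/-- Dualization changes the sign of the corrected quadrilinear form. -/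
lemma gammaCorr_codual (v : Vec B m) : (χ.codual i).gammaCorr v = - χ.gammaCorr v := by
  rw [gammaCorr, gammaCorr, gamma_codual, gamma_symm, sum_contr_codual, sum_contr_notMem]
  ring

end Stat

end

section

variable {B : BuildingSystem} {o : Fin 4} {m : B.M.carrier}

/-! ### The forms of a morphism of triple vector bundles -/

lemma Stat.codual_trans (χ ψ : Stat (dec B o) (dec B o)) (i : Dir o) :
    (χ.trans ψ).codual i = (χ.codual i).trans (ψ.codual i) := by
  apply Stat.ext; funext m; apply Equiv.ext; intro x
  show DecDual.equiv i m _ = DecDual.equiv i m (ψ.symm.dualEquiv i m ((DecDual.equiv i m).symm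
    (DecDual.equiv i m (χ.symm.dualEquiv i m ((DecDual.equiv i m).symm x)))))
  rw [Equiv.symm_apply_apply]
  rfl

lemma Stat.trans_assoc {S T U V : PreTVB B o} (φ : Stat S T) (ψ : Stat T U) (χ : Stat U V) :
    (φ.trans ψ).trans χ = φ.trans (ψ.trans χ) := rfl

lemma Stat.self_trans_symm {S T : PreTVB B o} (φ : Stat S T) : φ.trans φ.symm = Stat.refl S := by
  apply Stat.ext; funext m; exact (φ.equiv m).self_trans_symm

lemma Stat.symm_trans_self {S T : PreTVB B o} (φ : Stat S T) : φ.symm.trans φ = Stat.refl T := by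
  apply Stat.ext; funext m; exact (φ.equiv m).symm_trans_self

lemma Stat.symm_trans_cancel {S T U : PreTVB B o} (φ : Stat S T) (ψ : Stat T U) :
    φ.symm.trans (φ.trans ψ) = ψ := by
  rw [← Stat.trans_assoc, Stat.symm_trans_self]; rfl

lemma Stat.trans_symm_cancel {S T U : PreTVB B o} (φ : Stat S T) (ψ : Stat S U) :
    φ.trans (φ.symm.trans ψ) = ψ := by
  rw [← Stat.trans_assoc, Stat.self_trans_symm]; rfl

/-- The space of families of trilinear forms, one for each `P`, and a quadrilinear form (without
recording multilinearity). -/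
abbrev Forms (B : BuildingSystem) :=
  (∀ _ : Pair, ∀ m, Vec B m → ℝ) × (∀ m, Vec B m → ℝ)

/-- The forms of a statomorphism. -/
def Stat.forms (χ : Stat (dec B o) (dec B o)) : Forms B :=
  (fun P _ v => χ.theta P v, fun _ v => χ.gammaCorr v)

lemma Stat.forms_injective : Function.Injective (Stat.forms (B := B) (o := o)) := by
  intro χ ψ h
  refine Stat.eq_of_forms (fun P m v => ?_) (fun m v => ?_)
  · exact congrFun (congrFun (congrFun (congrArg Prod.fst h) P) m) v
  · exact congrFun (congrFun (congrArg Prod.snd h) m) v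

/-- Forms over a variable system of building bundles. The type does not depend on the labelling
of the objects, so that forms of morphisms between objects of different kinds can be compared. -/
abbrev TotalForms := Σ B : BuildingSystem, Forms B

/-- Smooth decompositions of an object of `C`. -/
abbrev Decs (X : C) := {P : Stat X.2.toPreTVB (dec X.1.1 (X.1.2 0)) // P ∈ X.2.decs}

/-- The forms of a morphism in given decompositions of source and target. -/
def homForms : ∀ {X Y : C} (_ : X ⟶ Y) (_ : Decs X) (_ : Decs Y), TotalForms
  | _, _, .mk φ, P, Q => ⟨_, (P.1.symm.trans (φ.1.trans Q.1)).forms⟩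

lemma homForms_injective {X Y : C} (P : Decs X) (Q : Decs Y) :
    Function.Injective (fun f : X ⟶ Y => homForms f P Q) := by
  rintro ⟨φ⟩ g h
  rcases g with ⟨ψ⟩
  have h1 := Stat.forms_injective (eq_of_heq (Sigma.mk.inj h).2)
  congr 1
  apply Subtype.ext
  have h2 := congrArg (fun χ => P.1.trans (χ.trans Q.1.symm)) h1
  simp only [Stat.trans_assoc, Stat.self_trans_symm, Stat.trans_symm_cancel] at h2
  exact h2

lemma fst_eq_of_hom {X Y : C} (f : X ⟶ Y) : X.1 = Y.1 := by
  rcases f with ⟨φ⟩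
  rfl

/-- `f` is the identity in the decompositions `P` and `Q`. -/
def IsCoordId {X Y : C} (f : X ⟶ Y) (P : Decs X) (Q : Decs Y) : Prop :=
  (∀ (Z : C) (g : Y ⟶ Z) (R : Decs Z), homForms (f ≫ g) P R = homForms g Q R) ∧
    ∀ (Z : C) (g : Z ⟶ X) (R : Decs Z), homForms (g ≫ f) R Q = homForms g R P

lemma exists_isCoordId {X Y : C} (h : X.1 = Y.1) (P : Decs X) (Q : Decs Y) :
    ∃ f : X ⟶ Y, IsCoordId f P Q := by
  obtain ⟨p, S⟩ := X
  obtain ⟨p', T⟩ := Y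
  obtain rfl : p = p' := h
  let φ : S ⟶ T := ⟨P.1.trans Q.1.symm, fun R hR => by
    rw [S.mem_decs_iff P.1 P.2, Stat.trans_assoc, Stat.symm_trans_cancel,
      ← T.mem_decs_iff Q.1 Q.2]
    exact hR⟩
  refine ⟨.mk φ, ?_, ?_⟩
  · rintro _ ⟨ψ⟩ R
    show Sigma.mk _ (P.1.symm.trans (((P.1.trans Q.1.symm).trans ψ.1).trans R.1)).forms = _
    rw [Stat.trans_assoc, Stat.trans_assoc, Stat.symm_trans_cancel]
    rfl
  · rintro _ g R
    rcases g with ⟨ψ⟩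
    show Sigma.mk _ (R.1.symm.trans ((ψ.1.trans (P.1.trans Q.1.symm)).trans Q.1)).forms = _
    rw [Stat.trans_assoc, Stat.trans_assoc, Stat.symm_trans_self]
    rfl

/-- Transport of a decomposition along an isomorphism. -/
lemma exists_decs_isCoordId {X Y : C} (f : X ⟶ Y) (P : Decs X) :
    ∃ Q : Decs Y, IsCoordId f P Q := by
  rcases f with ⟨φ⟩
  refine ⟨⟨φ.1.symm.trans P.1, (Groupoid.inv φ).2 P.1 P.2⟩, ?_, ?_⟩
  · rintro _ ⟨ψ⟩ R
    rfl
  · rintro _ g R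
    rcases g with ⟨ψ⟩
    show Sigma.mk _ (R.1.symm.trans ((ψ.1.trans φ.1).trans (φ.1.symm.trans P.1))).forms = _
    rw [Stat.trans_assoc, Stat.trans_symm_cancel]
    rfl

/-- The trilinear forms of an automorphism do not depend on the decomposition. -/
lemma homForms_theta_eq {X : C} (f : X ⟶ X) (P Q : Decs X) :
    (⟨_, (homForms f P P).2.1⟩ : Σ B : BuildingSystem, ∀ _ : Pair, ∀ m, Vec B m → ℝ) =
      ⟨_, (homForms f Q Q).2.1⟩ := by
  rcases f with ⟨φ⟩
  show (⟨_, (Stat.forms (P.1.symm.trans (φ.1.trans P.1))).1⟩ :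
    Σ B : BuildingSystem, ∀ _ : Pair, ∀ m, Vec B m → ℝ) =
      ⟨_, (Stat.forms (Q.1.symm.trans (φ.1.trans Q.1))).1⟩
  congr 1
  funext R m v
  have h : Q.1.symm.trans (φ.1.trans Q.1) = ((P.1.symm.trans Q.1).symm.trans
      (P.1.symm.trans (φ.1.trans P.1))).trans (P.1.symm.trans Q.1) := by
    apply Stat.ext; funext m; ext x; simp
  show Stat.theta _ R v = Stat.theta _ R v
  rw [h, Stat.theta_trans, Stat.theta_trans, Stat.theta_symm]
  ring

/-! ### Signed permutations of the labels -/

instance : MulAction (Equiv.Perm (Fin 4)) Pair where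
  smul σ P := ⟨⟨P.1.1.map σ.toEmbedding, by
    obtain ⟨⟨P, h⟩, hP⟩ := P
    refine ⟨h.1.map, fun h' => ?_⟩
    have := congrArg Finset.card h'
    rw [Finset.card_map, show P.card = 2 from hP] at this
    exact absurd this (by decide)⟩, (Finset.card_map _).trans P.2⟩
  one_smul P := Subtype.ext (Subtype.ext (Finset.map_refl (s := P.1.1)))
  mul_smul σ τ P := Subtype.ext (Subtype.ext
    (Finset.map_map τ.toEmbedding σ.toEmbedding P.1.1).symm)

lemma Pair.smul_val (σ : Equiv.Perm (Fin 4)) (P : Pair) :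
    (σ • P).1.1 = P.1.1.map σ.toEmbedding := rfl

/-- The semidirect product of the group of families of signs, one for each two-element label, with
the group of permutations of `{0,1,2,3}`. -/
abbrev SignedPerm := (Pair → ℤˣ) ⋊[mulAutArrow] Equiv.Perm (Fin 4)

/-- The signed permutation belonging to the dualization in direction `k`. -/
def SignedPerm.gen (k : Fin 4) : SignedPerm :=
  ⟨fun Q => if Q.1.1 = {0, k} then 1 else -1, Equiv.swap 0 k⟩

/-- Change of signs of the forms. -/
def TotalForms.act (s : Pair → ℤˣ) (ε : ℤˣ) (x : TotalForms) : TotalForms :=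
  ⟨x.1, fun P m v => ((s P : ℤ) : ℝ) * x.2.1 P m v, fun m v => ((ε : ℤ) : ℝ) * x.2.2 m v⟩

lemma TotalForms.act_mul (s s' : Pair → ℤˣ) (ε ε' : ℤˣ) (x : TotalForms) :
    x.act (s * s') (ε * ε') = (x.act s ε).act s' ε' := by
  unfold TotalForms.act
  congr 2
  · funext P m v
    simp only [Pi.mul_apply, Units.val_mul, Int.cast_mul]; ring
  · funext m v
    simp only [Units.val_mul, Int.cast_mul]; ring

lemma TotalForms.act_one (x : TotalForms) : x.act 1 1 = x := by
  obtain ⟨B, x⟩ := x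
  unfold TotalForms.act
  simp

/-- The functor `F` acts on the labels by the permutation `a.right`, and on the forms of
morphisms, in suitable decompositions, by signs: the trilinear forms are multiplied by the signs
`a.left`, transported by the labelling of the object, and the quadrilinear form by the sign of
`a.right`. -/
def HasType (F : C ⥤ C) (a : SignedPerm) : Prop :=
  (∀ X : C, (F.obj X).1 = (X.1.1, X.1.2 * a.right)) ∧
    ∃ D : ∀ X : C, Decs X → Decs (F.obj X), ∀ (X Y : C) (f : X ⟶ Y) (P : Decs X) (Q : Decs Y),
      homForms (F.map f) (D X P) (D Y Q) =
        (homForms f P Q).act (mulAutArrow X.1.2 a.left) (Equiv.Perm.sign a.right)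

namespace HasType

lemma id : HasType (𝟭 C) 1 := by
  refine ⟨fun X => rfl, fun X P => P, fun X Y f P Q => ?_⟩
  rw [SemidirectProduct.one_left, SemidirectProduct.one_right, map_one, map_one,
    TotalForms.act_one]
  rfl

lemma comp {F G : C ⥤ C} {a b : SignedPerm} (hF : HasType F a) (hG : HasType G b) :
    HasType (F ⋙ G) (a * b) := by
  obtain ⟨hF, D, hD⟩ := hF
  obtain ⟨hG, D', hD'⟩ := hG
  refine ⟨fun X => ?_, fun X P => D' _ (D X P), fun X Y f P Q => ?_⟩
  · show (G.obj (F.obj X)).1 = _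
    rw [hG, hF, mul_assoc]; rfl
  · show homForms (G.map (F.map f)) _ _ = _
    rw [hD', hD, ← TotalForms.act_mul, SemidirectProduct.mul_left, SemidirectProduct.mul_right,
      hF X, map_mul, map_mul, map_mul]
    rfl

/-- Functors of the same type are naturally isomorphic, through the statomorphisms that are the
identity in the decompositions. -/
lemma mk_eq {F G : C ⥤ C} {a : SignedPerm} (hF : HasType F a) (hG : HasType G a) :
    FunctorClass.mk F = FunctorClass.mk G := by
  obtain ⟨hF, D, hD⟩ := hF
  obtain ⟨hG, D', hD'⟩ := hG
  let P : ∀ X : C, Decs X := fun X => ⟨X.2.decs_nonempty.some, X.2.decs_nonempty.some_mem⟩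
  choose ι hι using fun X => exists_isCoordId ((hF X).trans (hG X).symm) (D X (P X)) (D' X (P X))
  refine Quotient.sound ⟨NatIso.ofComponents
    (fun X => (Groupoid.isoEquivHom _ _).symm (ι X)) fun {X Y} f => ?_⟩
  show F.map f ≫ ι Y = ι X ≫ G.map f
  apply homForms_injective (D X (P X)) (D' Y (P Y))
  show homForms _ _ _ = homForms _ _ _
  rw [(hι Y).2, (hι X).1, hD, hD']

lemma of_mk_eq {F G : C ⥤ C} {a : SignedPerm} (hF : HasType F a)
    (h : FunctorClass.mk F = FunctorClass.mk G) : HasType G a := by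
  obtain ⟨hF, D, hD⟩ := hF
  obtain ⟨η⟩ := Quotient.exact h
  choose D' hD' using fun (X : C) (P : Decs X) => exists_decs_isCoordId (η.hom.app X) (D X P)
  refine ⟨fun X => (fst_eq_of_hom (η.hom.app X)).symm.trans (hF X), D', fun X Y f P Q => ?_⟩
  rw [← hD, ← (hD' Y Q).2, ← (hD' X P).1, η.hom.naturality]

end HasType

/-! ### The types of the dualization functors -/

/-- The decomposition of the dual induced by a decomposition. -/
def Decs.dual {p : BuildingSystem × Equiv.Perm (Fin 4)} {T : Placed p} (i : Dir (p.2 0))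
    (P : Stat T.toPreTVB (dec p.1 (p.2 0))) : Stat (T.dual i).toPreTVB (dec p.1 i.1) :=
  (T.dualDec i).trans ((T.someDec.symm.trans P).codual i)

lemma Decs.dual_mem {p : BuildingSystem × Equiv.Perm (Fin 4)} {T : Placed p} (i : Dir (p.2 0))
    {P : Stat T.toPreTVB (dec p.1 (p.2 0))} (hP : P ∈ T.decs) :
    Decs.dual i P ∈ (T.dual i).decs := by
  show Stat.IsSmooth _
  unfold Decs.dual
  rw [Stat.symm_trans_cancel]
  exact (Stat.IsSmooth.decDual ((T.mem_decs_iff _ T.someDec_mem _).1 hP) i).symm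

lemma dualMap_symm_eq {S T : TVB B o} (φ : S ⟶ T) (i : Dir o) :
    (TVB.dualMap φ i).1.symm =
      (S.dualDec i).trans (((TVB.coordHom φ).codual i).trans (T.dualDec i).symm) := by
  apply Stat.ext; funext m
  show (φ.1.dualEquiv i m).symm = _
  rw [TVB.dualEquiv_eq]
  rfl

lemma dual_symm_trans {p : BuildingSystem × Equiv.Perm (Fin 4)} {S T : Placed p} (φ : S ⟶ T)
    (i : Dir (p.2 0)) (P : Stat S.toPreTVB (dec p.1 (p.2 0)))
    (Q : Stat T.toPreTVB (dec p.1 (p.2 0))) :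
    (Decs.dual i P).symm.trans ((TVB.dualMap φ i).1.symm.trans (Decs.dual i Q)) =
      (P.symm.trans (φ.1.trans Q)).codual i := by
  have h : (Decs.dual i P).symm = ((S.someDec.symm.trans P).codual i).symm.trans
    (S.dualDec i).symm := rfl
  rw [h, dualMap_symm_eq, Decs.dual, Stat.trans_assoc, Stat.trans_assoc, Stat.trans_assoc,
    Stat.symm_trans_cancel, Stat.symm_trans_cancel]
  have h2 : P.symm.trans (φ.1.trans Q) = (S.someDec.symm.trans P).symm.trans
      ((TVB.coordHom φ).trans (T.someDec.symm.trans Q)) := by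
    apply Stat.ext; funext m; ext x; simp [TVB.coordHom]
  rw [h2, Stat.codual_trans, Stat.codual_trans]
  rfl

lemma gen_sign (σ : Equiv.Perm (Fin 4)) (k : Fin 4) (hk : k ≠ 0) (P : Pair) :
    (((mulAutArrow σ (SignedPerm.gen k).left P : ℤˣ) : ℤ) : ℝ) =
      Dir.sign (o := σ 0) ⟨σ k, fun h => hk (σ.injective h)⟩ P := by
  have h1 : mulAutArrow σ (SignedPerm.gen k).left P = (SignedPerm.gen k).left (σ⁻¹ • P) := rfl
  have h2 : (σ⁻¹ • P).1.1 = {0, k} ↔ P.1.1 = {σ 0, σ k} := by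
    have h3 : ({σ 0, σ k} : Finset (Fin 4)) = Finset.map σ.toEmbedding {0, k} := by
      simp
    rw [h3, ← Finset.map_inj (f := σ.toEmbedding), ← Pair.smul_val, smul_inv_smul]
  rw [h1]
  unfold SignedPerm.gen Dir.sign
  simp only [h2]
  split_ifs <;> simp

lemma hasType_dualizationCov (k : Fin 4) (hk : k ≠ 0) :
    HasType (dualizationCov k hk) (SignedPerm.gen k) := by
  refine ⟨fun X => rfl, fun X P => ⟨Decs.dual _ P.1, Decs.dual_mem _ P.2⟩, ?_⟩
  rintro _ _ ⟨φ⟩ P Q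
  show Sigma.mk _ ((Decs.dual _ P.1).symm.trans
    ((TVB.dualMap φ _).1.symm.trans (Decs.dual _ Q.1))).forms = Sigma.mk _ _
  rw [dual_symm_trans]
  congr 1
  refine Prod.ext ?_ ?_
  · funext R m v
    refine (Stat.theta_codual _ _ _ _).trans ?_
    exact congrArg (fun r : ℝ => r * Stat.theta _ R v) (gen_sign _ k hk R).symm
  · funext m v
    refine (Stat.gammaCorr_codual _ _ _).trans ?_
    have : Equiv.Perm.sign (SignedPerm.gen k).right = -1 := Equiv.Perm.sign_swap hk.symm
    rw [this]
    simp [homForms, Stat.forms]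

end

section

/-! ### Statomorphisms with nonzero trilinear forms -/

/-- The decomposed triple vector bundle, as triple vector bundle. -/
def decTVB (B : BuildingSystem) (o : Fin 4) : TVB B o where
  toPreTVB := dec B o
  decs := {χ | χ.IsSmooth}
  decs_nonempty := ⟨Stat.refl _, Stat.IsSmooth.refl⟩
  mem_decs_iff P hP Q := by
    constructor
    · exact fun hQ => (Stat.IsSmooth.symm hP).trans hQ
    · intro hQ
      have h := Stat.IsSmooth.trans hP hQ
      rwa [Stat.trans_symm_cancel] at h

/-- A point. -/
def pointManifold : SmoothManifold where
  carrier := EuclideanSpace ℝ (Fin 0)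
  dim := 0

/-- The trivial line bundle. -/
def lineBundle (M : SmoothManifold) : SmoothVB M where
  F := ℝ
  E := Bundle.Trivial M.carrier ℝ

lemma lineBundle_smoothAt {M : SmoothManifold} {d : ℕ} {q : EuclideanSpace ℝ (Fin d) → M.carrier}
    {s : EuclideanSpace ℝ (Fin d) → ℝ} {u₀ : EuclideanSpace ℝ (Fin d)} :
    (lineBundle M).SmoothAt q s u₀ ↔
      ContMDiffAt (𝓡 d) (𝓡 M.dim) ∞ q u₀ ∧ ContDiffAt ℝ ∞ s u₀ := by
  rw [← contMDiffAt_iff_contDiffAt]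
  exact contMDiffAt_totalSpace

/-- The system of building bundles over a point all of which are lines. -/
def lineSystem : BuildingSystem where
  M := pointManifold
  V _ := lineBundle pointManifold
  pair _ _ _ _ := LinearMap.mul ℝ ℝ
  pair_bijective _ _ _ _ := by
    constructor
    · intro x y h
      have := LinearMap.congr_fun h (1 : ℝ)
      exact (mul_one (M := ℝ) x).symm.trans (this.trans (mul_one (M := ℝ) y))
    · intro f
      refine ⟨f (1 : ℝ), ?_⟩
      apply LinearMap.ext_ring
      exact mul_one _
  pair_symm _ _ _ _ x y := mul_comm (G := ℝ) x y
  pair_smooth _ _ _ d q s t u₀ hs ht :=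
    (lineBundle_smoothAt.1 hs).2.mul (lineBundle_smoothAt.1 ht).2

variable {o : Fin 4}

/-- The map `e_J ↦ e_J + c e_R e_S` on families of real numbers. -/
def shearFun (R S J : Coord o) (c : ℝ) (e : Coord o → ℝ) : Coord o → ℝ :=
  fun I => if I = J then e I + c * e R * e S else e I

/-- The labels `R`, `S` partition the label `J`. -/
structure IsPartition (R S J : Coord o) : Prop where
  disjoint : Disjoint R.1.1 S.1.1
  mem_iff : ∀ x, x ∈ J.1.1 ↔ x ∈ R.1.1 ∨ x ∈ S.1.1

namespace IsPartition

variable {R S J : Coord o}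

lemma left_ne (h : IsPartition R S J) : R ≠ J := by
  rintro rfl
  obtain ⟨x, hx⟩ := S.1.2.1
  exact Finset.disjoint_left.1 h.disjoint ((h.mem_iff x).2 (Or.inr hx)) hx

lemma right_ne (h : IsPartition R S J) : S ≠ J := by
  rintro rfl
  obtain ⟨x, hx⟩ := R.1.2.1
  exact Finset.disjoint_left.1 h.disjoint hx ((h.mem_iff x).2 (Or.inl hx))

lemma left_ne_right (h : IsPartition R S J) : R ≠ S := by
  rintro rfl
  obtain ⟨x, hx⟩ := R.1.2.1
  exact Finset.disjoint_left.1 h.disjoint hx hx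

lemma shearFun_neg (h : IsPartition R S J) (c : ℝ) (e : Coord o → ℝ) :
    shearFun R S J c (shearFun R S J (-c) e) = e := by
  funext I
  by_cases hI : I = J
  · simp only [shearFun, hI, h.left_ne, h.right_ne, if_true, if_false]
    ring
  · simp only [shearFun, hI, if_false]

end IsPartition

/-- The statomorphism `e_J ↦ e_J + c e_R e_S` of the decomposed triple vector bundle of lines. -/
noncomputable def shear {R S J : Coord o} (hp : IsPartition R S J) (c : ℝ) :
    Stat (dec lineSystem o) (dec lineSystem o) where
  equiv _ := ⟨shearFun R S J c, shearFun R S J (-c),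
    fun e => (congrArg (fun t => shearFun R S J (-c) (shearFun R S J t e)) (neg_neg c).symm).trans
      (hp.shearFun_neg (-c) e), hp.shearFun_neg c⟩
  map_smul := by
    intro m i a x
    change Coord o → ℝ at x
    funext I
    change shearFun R S J c (fun I => if i.1 ∈ I.1.1 then a * x I else x I) I =
      if i.1 ∈ I.1.1 then a * shearFun R S J c x I else shearFun R S J c x I
    by_cases hI : I = J
    · subst hI
      have hd : i.1 ∈ R.1.1 → i.1 ∉ S.1.1 := fun h => Finset.disjoint_left.1 hp.disjoint h
      by_cases hR : i.1 ∈ R.1.1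
      · simp only [shearFun, hp.mem_iff, hR, hd hR, if_true, if_false, true_or]
        ring
      · by_cases hS : i.1 ∈ S.1.1
        · simp only [shearFun, hp.mem_iff, hR, hS, if_true, if_false, or_true]
          ring
        · simp only [shearFun, hp.mem_iff, hR, hS, if_true, if_false, or_self]
    · simp only [shearFun, hI, if_false]
  map_add := by
    intro m i x y h
    change Coord o → ℝ at x
    change Coord o → ℝ at y
    have hxy : ∀ I : Coord o, i.1 ∉ I.1.1 → x I = y I := by
      intro I hI
      exact (if_neg hI).symm.trans ((congrFun h I).trans (if_neg hI))
    funext I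
    change shearFun R S J c (fun I => if i.1 ∈ I.1.1 then x I + y I else x I) I =
      if i.1 ∈ I.1.1 then shearFun R S J c x I + shearFun R S J c y I else shearFun R S J c x I
    by_cases hI : I = J
    · subst hI
      have hd : i.1 ∈ R.1.1 → i.1 ∉ S.1.1 := fun h => Finset.disjoint_left.1 hp.disjoint h
      by_cases hR : i.1 ∈ R.1.1
      · simp only [shearFun, hp.mem_iff, hR, hd hR, if_true, if_false, true_or, hxy S (hd hR)]
        ring
      · by_cases hS : i.1 ∈ S.1.1
        · simp only [shearFun, hp.mem_iff, hR, hS, if_true, if_false, or_true, hxy R hR]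
          ring
        · simp only [shearFun, hp.mem_iff, hR, hS, if_true, if_false, or_self]
    · simp only [shearFun, hI, if_false]
  map_core := by
    intro m K x
    have key : ∀ y : Coord o → ℝ, y R = 0 ∨ y S = 0 → shearFun R S J c y = y := by
      intro y hy
      funext I
      rcases hy with hy | hy <;> simp [shearFun, hy]
    apply key
    by_cases hK : R = K
    · exact Or.inr (DecDual.core_ne (fun h => hp.left_ne_right (hK.trans h.symm)) x)
    · exact Or.inl (DecDual.core_ne hK x)

variable {R S J : Coord o} (hp : IsPartition R S J) (c : ℝ)

lemma shear_smoothMap : SmoothMap lineSystem o (fun m => (shear hp c).equiv m) := by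
  intro d q s u₀ hs I
  refine lineBundle_smoothAt.2 ⟨(lineBundle_smoothAt.1 (hs I)).1, ?_⟩
  have h : ∀ I, ContDiffAt ℝ ∞ (fun u => (s u I : ℝ)) u₀ :=
    fun I => (lineBundle_smoothAt.1 (hs I)).2
  by_cases hI : I = J
  · subst hI
    exact ((h I).add ((contDiffAt_const.mul (h R)).mul (h S))).congr_of_eventuallyEq
      (Filter.Eventually.of_forall fun u => if_pos rfl)
  · exact (h I).congr_of_eventuallyEq (Filter.Eventually.of_forall fun u => if_neg hI)

lemma shear_symm : (shear hp c).symm = shear hp (-c) := by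
  apply Stat.ext; funext m; apply Equiv.ext; intro x
  rfl

lemma shear_isSmooth : (shear hp c).IsSmooth := by
  refine ⟨shear_smoothMap hp c, ?_⟩
  have := shear_smoothMap hp (-c)
  rwa [← shear_symm] at this

lemma exists_partition_into_blocks : ∀ (o : Fin 4) (P : Finset (Fin 4)), P.card = 2 →
    ∃ R S : Finset (Fin 4), (R.Nonempty ∧ R ≠ Finset.univ) ∧ (S.Nonempty ∧ S ≠ Finset.univ) ∧
      o ∉ R ∧ o ∉ S ∧ Disjoint R S ∧ Blk P R ∧ Blk P S ∧
      ∀ x, x ∈ (if o ∈ P then P else {o})ᶜ ↔ x ∈ R ∨ x ∈ S := by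
  decide +kernel

lemma exists_theta_ne_zero (o : Fin 4) (P : Pair) :
    ∃ χ : Stat (dec lineSystem o) (dec lineSystem o), χ.IsSmooth ∧
      ∃ (m : lineSystem.M.carrier) (v : Vec lineSystem m), χ.theta P v ≠ 0 := by
  obtain ⟨R, S, hR, hS, hoR, hoS, hd, hbR, hbS, hu⟩ := exists_partition_into_blocks o P.1.1 P.2
  let R' : Coord o := ⟨⟨R, hR⟩, hoR⟩
  let S' : Coord o := ⟨⟨S, hS⟩, hoS⟩
  let J : Coord o := (P.1.out o).co (P.1.mem_out o)
  have hJ : J.1.1 = (if o ∈ P.1.1 then P.1.1 else {o})ᶜ := by rw [← Lab.out_val]; rfl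
  have hp : IsPartition R' S' J := ⟨hd, fun x => by rw [hJ]; exact hu x⟩
  let m : lineSystem.M.carrier := (0 : EuclideanSpace ℝ (Fin 0))
  let v : Vec lineSystem m := fun _ => (1 : ℝ)
  refine ⟨shear hp 1, shear_isSmooth _ _, m, v, ?_⟩
  have h1 := Stat.theta_eq (χ := shear hp 1) (P := P) rfl v (J := J) (Lab.isCompl_co _ _)
  have hbJ : ¬ Blk P.1.1 J.1.1 := by rw [hJ]; exact Stat.not_blk_out_compl o _ P.2
  have h2 : (shear hp 1).app (rst (fun I => Blk P.1.1 I) (pull o v)) J = (1 : ℝ) := by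
    let e : Coord o → ℝ := rst (fun I => Blk P.1.1 I) (pull o v)
    have hR : e R' = 1 := rst_pos hbR
    have hS : e S' = 1 := rst_pos hbS
    have hJ : e J = 0 := rst_neg hbJ
    show shearFun R' S' J 1 e J = 1
    simp [shearFun, hR, hS, hJ]
  rw [h1, h2]
  exact (one_mul (1 : ℝ)).trans_ne one_ne_zero

end

section

/-! ### The group of duality functors as a group of signed permutations -/

/-- The decomposed triple vector bundle of lines over a point, as an object of `C`. -/
def lineObj : C := ⟨(lineSystem, 1), decTVB lineSystem _⟩

/-- The signs can be recovered: `a` and `b` prescribe the trilinear forms of the image of an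
automorphism, which do not depend on the decomposition. -/
lemma HasType.unique {F : C ⥤ C} {a b : SignedPerm} (ha : HasType F a) (hb : HasType F b) :
    a = b := by
  obtain ⟨ha, D, hD⟩ := ha
  obtain ⟨hb, D', hD'⟩ := hb
  have hr := congrArg Prod.snd ((ha lineObj).symm.trans (hb lineObj))
  simp only [mul_right_inj] at hr
  refine SemidirectProduct.ext (funext fun Q => ?_) hr
  obtain ⟨χ, hχ, m, v, hv⟩ := exists_theta_ne_zero ((1 : Equiv.Perm (Fin 4)) 0) Q
  let φ : decTVB lineSystem ((1 : Equiv.Perm (Fin 4)) 0) ⟶ decTVB lineSystem _ :=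
    ⟨χ, fun R hR => hχ.trans hR⟩
  let f : lineObj ⟶ lineObj := .mk φ
  let P : Decs lineObj := ⟨Stat.refl _, Stat.IsSmooth.refl⟩
  have h := homForms_theta_eq (F.map f) (D _ P) (D' _ P)
  rw [hD, hD'] at h
  have h2 := eq_of_heq (Sigma.mk.inj h).2
  have h3 : (((mulAutArrow (1 : Equiv.Perm (Fin 4)) a.left Q : ℤˣ) : ℤ) : ℝ) * χ.theta Q v =
      (((mulAutArrow (1 : Equiv.Perm (Fin 4)) b.left Q : ℤˣ) : ℤ) : ℝ) * χ.theta Q v :=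
    congrFun (congrFun (congrFun h2 Q) m) v
  rw [map_one] at h3
  exact Units.ext (Int.cast_injective (mul_right_cancel₀ hv h3))

lemma FunctorClass.mk_comp (F G : C ⥤ C) :
    FunctorClass.mk (F ⋙ G) = FunctorClass.mk F * FunctorClass.mk G := rfl

lemma SignedPerm.gen_mul_gen : ∀ k : Fin 4, gen k * gen k = 1 := by
  intro k
  refine SemidirectProduct.ext ?_ ?_
  · revert k; decide +kernel
  · exact Equiv.swap_mul_self 0 k

lemma mk_dualizationCov_mul_self (k : Fin 4) (hk : k ≠ 0) :
    FunctorClass.mk (dualizationCov k hk) * FunctorClass.mk (dualizationCov k hk) = 1 := by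
  have h := (hasType_dualizationCov k hk).comp (hasType_dualizationCov k hk)
  rw [SignedPerm.gen_mul_gen] at h
  exact h.mk_eq HasType.id

/-- The class of the dualization functor in direction `k`, as an element of `DG3`. -/
def DG3.gen (k : Fin 4) (hk : k ≠ 0) : DG3 :=
  ⟨⟨_, _, mk_dualizationCov_mul_self k hk, mk_dualizationCov_mul_self k hk⟩,
    Subgroup.subset_closure ⟨k, hk, rfl⟩⟩

lemma DG3.closure_gen : Subgroup.closure {W | ∃ k hk, W = DG3.gen k hk} = ⊤ := by
  have h : {u : FunctorClassˣ | ∃ (k : Fin 4) (hk : k ≠ 0), (u : FunctorClass) =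
    FunctorClass.mk (dualizationCov k hk)} = Subtype.val '' {W | ∃ k hk, W = DG3.gen k hk} := by
    ext u
    constructor
    · rintro ⟨k, hk, h⟩
      exact ⟨_, ⟨k, hk, rfl⟩, Units.ext h.symm⟩
    · rintro ⟨_, ⟨k, hk, rfl⟩, rfl⟩
      exact ⟨k, hk, rfl⟩
  apply Subgroup.map_injective DG3.subtype_injective
  rw [MonoidHom.map_closure, ← MonoidHom.range_eq_map, Subgroup.range_subtype]
  exact congrArg Subgroup.closure h.symm

/-- An induction principle for the elements of `DG3`. The generators are involutions, so inverses
need not be considered. -/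
lemma DG3.induction {p : DG3 → Prop} (hgen : ∀ k hk, p (DG3.gen k hk)) (hone : p 1)
    (hmul : ∀ V W, p V → p W → p (V * W)) (W : DG3) : p W := by
  have hW : W ∈ Subgroup.closure {W | ∃ k hk, W = DG3.gen k hk} := DG3.closure_gen ▸ trivial
  refine (Subgroup.closure_induction (p := fun W _ => p W ∧ p W⁻¹) ?_ ?_ ?_ ?_ hW).1
  · rintro _ ⟨k, hk, rfl⟩
    -- the inverse of `DG3.gen k hk` is defined to be `DG3.gen k hk`
    exact ⟨hgen k hk, hgen k hk⟩
  · exact ⟨hone, by rwa [inv_one]⟩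
  · rintro V W - - hV hW
    exact ⟨hmul _ _ hV.1 hW.1, by rw [mul_inv_rev]; exact hmul _ _ hW.2 hV.2⟩
  · rintro V - hV
    exact ⟨hV.2, by rw [inv_inv]; exact hV.1⟩

lemma DG3.exists_hasType (W : DG3) :
    ∃ (F : C ⥤ C) (a : SignedPerm), FunctorClass.mk F = (W : FunctorClassˣ) ∧ HasType F a := by
  induction W using DG3.induction with
  | hgen k hk => exact ⟨_, _, rfl, hasType_dualizationCov k hk⟩
  | hone => exact ⟨_, _, rfl, HasType.id⟩
  | hmul V W hV hW =>
    obtain ⟨F, a, hF, ha⟩ := hV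
    obtain ⟨G, b, hG, hb⟩ := hW
    refine ⟨F ⋙ G, a * b, ?_, ha.comp hb⟩
    rw [FunctorClass.mk_comp, hF, hG]; rfl

/-- The signed permutation by which an element of `DG3` acts on the forms. -/
def DG3.type (W : DG3) : SignedPerm := (DG3.exists_hasType W).choose_spec.choose

lemma DG3.hasType {W : DG3} {F : C ⥤ C} (h : FunctorClass.mk F = (W : FunctorClassˣ)) :
    HasType F (DG3.type W) :=
  (DG3.exists_hasType W).choose_spec.choose_spec.2.of_mk_eq
    ((DG3.exists_hasType W).choose_spec.choose_spec.1.trans h.symm)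

lemma DG3.type_eq {W : DG3} {F : C ⥤ C} {a : SignedPerm}
    (h : FunctorClass.mk F = (W : FunctorClassˣ)) (ha : HasType F a) : DG3.type W = a :=
  (DG3.hasType h).unique ha

/-- The embedding of `DG3` into the group of signed permutations. -/
def DG3.typeHom : DG3 →* SignedPerm where
  toFun := DG3.type
  map_one' := DG3.type_eq rfl HasType.id
  map_mul' V W := by
    obtain ⟨F, a, hF, ha⟩ := (DG3.exists_hasType V)
    obtain ⟨G, b, hG, hb⟩ := (DG3.exists_hasType W)
    rw [DG3.type_eq hF ha, DG3.type_eq hG hb]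
    refine DG3.type_eq (F := F ⋙ G) ?_ (ha.comp hb)
    rw [FunctorClass.mk_comp, hF, hG]; rfl

lemma DG3.typeHom_injective : Function.Injective DG3.typeHom := by
  intro V W h
  obtain ⟨F, a, hF, ha⟩ := (DG3.exists_hasType V)
  obtain ⟨G, b, hG, hb⟩ := (DG3.exists_hasType W)
  obtain rfl : a = b := (DG3.type_eq hF ha).symm.trans (h.trans (DG3.type_eq hG hb))
  exact Subtype.ext (Units.ext (hF.symm.trans ((ha.mk_eq hb).trans hG)))

lemma DG3.typeHom_gen (k : Fin 4) (hk : k ≠ 0) : DG3.typeHom (DG3.gen k hk) = SignedPerm.gen k :=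
  DG3.type_eq rfl (hasType_dualizationCov k hk)

/-- The permutation by which an element of `DG3` acts on the labels. -/
def DG3.perm : DG3 →* Equiv.Perm (Fin 4) := SemidirectProduct.rightHom.comp DG3.typeHom

lemma DG3.perm_apply (W : DG3) : DG3.perm W = (DG3.typeHom W).right := rfl

lemma DG3.perm_surjective : Function.Surjective DG3.perm := by
  rw [← MonoidHom.range_eq_top, ← top_le_iff, ← Equiv.Perm.closure_isSwap,
    Subgroup.closure_le]
  have h0 : ∀ k : Fin 4, Equiv.swap 0 k ∈ DG3.perm.range := by
    intro k
    rcases eq_or_ne k 0 with rfl | hk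
    · rw [Equiv.swap_self]; exact one_mem _
    · exact ⟨DG3.gen k hk, by rw [DG3.perm_apply, DG3.typeHom_gen]; rfl⟩
  rintro _ ⟨i, j, hij, rfl⟩
  have h : ∀ i j : Fin 4, i ≠ j →
      Equiv.swap i j = Equiv.swap 0 i * Equiv.swap 0 j * Equiv.swap 0 i ∨
        i = 0 ∨ j = 0 := by decide +kernel
  rcases h i j hij with h | rfl | rfl
  · rw [h]; exact mul_mem (mul_mem (h0 i) (h0 j)) (h0 i)
  · exact h0 j
  · rw [Equiv.swap_comm]; exact h0 i

end

section

/-! ### The signs that occur -/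

/-- The relations between the signs and the permutation of an element of `DG3`: the product of the
signs of the three labels containing `v`, and that of all signs, are determined by the
permutation. -/
structure SignedPerm.Admissible (a : SignedPerm) : Prop where
  prod_mem : ∀ v : Fin 4, ∏ Q : Pair, (if v ∈ Q.1.1 then a.left Q else 1) =
    Equiv.Perm.sign a.right * ((if v = 0 then -1 else 1) * (if v = a.right 0 then -1 else 1))
  prod : ∏ Q : Pair, a.left Q = Equiv.Perm.sign a.right

namespace SignedPerm.Admissible

lemma one : Admissible 1 := by
  refine ⟨?_, ?_⟩ <;> decide +kernel

lemma gen : ∀ k : Fin 4, k ≠ 0 → Admissible (gen k) := by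
  intro k hk
  refine ⟨?_, ?_⟩ <;> revert k <;> decide +kernel

lemma mul {a b : SignedPerm} (ha : Admissible a) (hb : Admissible b) : Admissible (a * b) := by
  have hl : ∀ Q, (a * b).left Q = a.left Q * b.left (a.right⁻¹ • Q) := fun Q => rfl
  constructor
  · intro v
    have h : ∏ Q : Pair, (if v ∈ Q.1.1 then b.left (a.right⁻¹ • Q) else 1) =
        ∏ Q : Pair, (if a.right⁻¹ v ∈ Q.1.1 then b.left Q else 1) := by
      refine Fintype.prod_equiv (MulAction.toPerm a.right⁻¹) _ _ fun Q => ?_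
      have : a.right⁻¹ v ∈ (a.right⁻¹ • Q).1.1 ↔ v ∈ Q.1.1 :=
        Finset.mem_map' a.right⁻¹.toEmbedding
      simp only [MulAction.toPerm_apply, this]
    have h1 : ∀ Q : Pair, (if v ∈ Q.1.1 then (a * b).left Q else 1) =
        (if v ∈ Q.1.1 then a.left Q else 1) *
          (if v ∈ Q.1.1 then b.left (a.right⁻¹ • Q) else 1) := by
      intro Q
      rw [hl]; split_ifs <;> simp
    simp only [h1, Finset.prod_mul_distrib, h, ha.prod_mem, hb.prod_mem,
      SemidirectProduct.mul_right, map_mul, Equiv.Perm.inv_eq_iff_eq, Equiv.Perm.mul_apply]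
    have hsq : ((if v = a.right 0 then -1 else 1 : ℤˣ) * if v = a.right 0 then -1 else 1) = 1 :=
      Int.units_mul_self _
    calc _ = Equiv.Perm.sign a.right * Equiv.Perm.sign b.right * ((if v = 0 then -1 else 1) *
          if v = a.right (b.right 0) then -1 else 1) *
          ((if v = a.right 0 then -1 else 1 : ℤˣ) * if v = a.right 0 then -1 else 1) := by ac_rfl
      _ = _ := by rw [hsq, mul_one]; congr
  · have h : ∏ Q : Pair, b.left (a.right⁻¹ • Q) = ∏ Q : Pair, b.left Q :=
      Fintype.prod_equiv (MulAction.toPerm a.right⁻¹) _ _ fun Q => rfl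
    simp only [hl, Finset.prod_mul_distrib, h, ha.prod, hb.prod, SemidirectProduct.mul_right,
      map_mul]

end SignedPerm.Admissible

lemma DG3.admissible (W : DG3) : (DG3.typeHom W).Admissible := by
  induction W using DG3.induction with
  | hgen k hk => rw [DG3.typeHom_gen]; exact SignedPerm.Admissible.gen k hk
  | hone => rw [map_one]; exact SignedPerm.Admissible.one
  | hmul V W hV hW => rw [map_mul]; exact hV.mul hW

/-! ### The kernel -/

instance : DecidablePred (· ∈ klein) := fun σ => decidable_of_iff
  (σ = 1 ∨ σ = Equiv.swap 1 2 * Equiv.swap 3 0 ∨ σ = Equiv.swap 2 3 * Equiv.swap 1 0 ∨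
    σ = Equiv.swap 1 3 * Equiv.swap 2 0) Iff.rfl

/-- The family of signs corresponding to an element `κ` of the Klein group: the sign of a label is
positive if it is fixed by `κ`. -/
def kleinSign (κ : Equiv.Perm (Fin 4)) (Q : Pair) : ℤˣ := if κ • Q = Q then 1 else -1

lemma kleinSign_conj (σ κ : Equiv.Perm (Fin 4)) :
    kleinSign (σ * κ * σ⁻¹) = mulAutArrow σ (kleinSign κ) := by
  funext Q
  show _ = kleinSign κ (σ⁻¹ • Q)
  have : (σ * κ * σ⁻¹) • Q = Q ↔ κ • σ⁻¹ • Q = σ⁻¹ • Q := by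
    rw [mul_smul, mul_smul, ← eq_inv_smul_iff (g := σ)]
  simp only [kleinSign, this]

/-- The family of signs as a homomorphism on the Klein group. -/
def kleinSignHom : klein →* (Pair → ℤˣ) where
  toFun κ := kleinSign κ
  map_one' := funext fun Q => if_pos (one_smul _ Q)
  map_mul' := by
    have h : ∀ κ ∈ klein, ∀ κ' ∈ klein, ∀ Q,
        kleinSign (κ * κ') Q = kleinSign κ Q * kleinSign κ' Q := by decide +kernel
    exact fun κ κ' => funext (h κ κ.2 κ' κ'.2)

lemma kleinSignHom_injective : Function.Injective kleinSignHom := by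
  rw [injective_iff_map_eq_one]
  have h : ∀ κ ∈ klein, (∀ Q, kleinSign κ Q = 1) → κ = 1 := by decide +kernel
  exact fun κ hκ => Subtype.ext (h κ κ.2 (congrFun hκ))

/-- The signs of an element of the kernel. -/
def kerSignHom : DG3.perm.ker →* (Pair → ℤˣ) where
  toFun k := (DG3.typeHom k).left
  map_one' := by rw [OneMemClass.coe_one, map_one]; rfl
  map_mul' k k' := by
    have hk : (DG3.typeHom k).right = 1 := k.2
    rw [Subgroup.coe_mul, map_mul, SemidirectProduct.mul_left, hk, map_one]
    rfl

lemma kerSignHom_injective : Function.Injective kerSignHom := by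
  intro k k' h
  refine Subtype.ext (DG3.typeHom_injective (SemidirectProduct.ext h ?_))
  exact (show (DG3.typeHom k).right = 1 from k.2).trans
    (show (DG3.typeHom k').right = 1 from k'.2).symm

/-- Over the identity permutation the relations leave only the signs coming from the Klein group. -/
lemma exists_kleinSign_eq : ∀ s : Pair → ℤˣ,
    (∀ v : Fin 4, ∏ Q : Pair, (if v ∈ Q.1.1 then s Q else 1) = 1) → ∏ Q : Pair, s Q = 1 →
      ∃ κ ∈ klein, ∀ Q, kleinSign κ Q = s Q := by
  decide +kernel

open SignedPerm in
/-- The signs coming from the Klein group are realized by words in the generators. -/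
lemma gen_word_sq :
    (gen 1 * gen 2 * gen 1 * gen 3) ^ 2 =
      ⟨kleinSign (Equiv.swap 1 2 * Equiv.swap 3 0), 1⟩ ∧
    (gen 2 * gen 3 * gen 2 * gen 1) ^ 2 =
      ⟨kleinSign (Equiv.swap 2 3 * Equiv.swap 1 0), 1⟩ ∧
    (gen 3 * gen 1 * gen 3 * gen 2) ^ 2 =
      ⟨kleinSign (Equiv.swap 1 3 * Equiv.swap 2 0), 1⟩ := by
  refine ⟨SemidirectProduct.ext (funext ?_) ?_, SemidirectProduct.ext (funext ?_) ?_,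
    SemidirectProduct.ext (funext ?_) ?_⟩ <;> decide +kernel

lemma range_kerSignHom : kerSignHom.range = kleinSignHom.range := by
  apply le_antisymm
  · rintro _ ⟨k, rfl⟩
    have hk : (DG3.typeHom k).right = 1 := k.2
    have h := DG3.admissible k
    obtain ⟨κ, hκ, h'⟩ := exists_kleinSign_eq (DG3.typeHom k).left (fun v => by
      rw [h.prod_mem, hk, map_one, one_mul]
      exact Int.units_mul_self _) (by rw [h.prod, hk, map_one])
    exact ⟨⟨κ, hκ⟩, funext h'⟩
  · have key : ∀ (W : DG3) (s : Pair → ℤˣ), DG3.typeHom W = ⟨s, 1⟩ → s ∈ kerSignHom.range :=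
      fun W s h => ⟨⟨W, congrArg SemidirectProduct.right h⟩, congrArg SemidirectProduct.left h⟩
    let X := DG3.gen 1 (by decide)
    let Y := DG3.gen 2 (by decide)
    let Z := DG3.gen 3 (by decide)
    rintro _ ⟨⟨κ, rfl | rfl | rfl | rfl⟩, rfl⟩
    · exact (map_one kleinSignHom).symm ▸ one_mem _
    · refine key ((X * Y * X * Z) ^ 2) _ (Eq.trans ?_ gen_word_sq.1)
      simp only [X, Y, Z, map_pow, map_mul, DG3.typeHom_gen]
    · refine key ((Y * Z * Y * X) ^ 2) _ (Eq.trans ?_ gen_word_sq.2.1)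
      simp only [X, Y, Z, map_pow, map_mul, DG3.typeHom_gen]
    · refine key ((Z * X * Z * Y) ^ 2) _ (Eq.trans ?_ gen_word_sq.2.2)
      simp only [X, Y, Z, map_pow, map_mul, DG3.typeHom_gen]

/-- The isomorphism of the kernel with the Klein group: corresponding elements have the same
signs. -/
def kerEquiv : DG3.perm.ker ≃* klein :=
  (MonoidHom.ofInjective kerSignHom_injective).trans
    ((MulEquiv.subgroupCongr range_kerSignHom).trans
      (MonoidHom.ofInjective kleinSignHom_injective).symm)

lemma kleinSign_kerEquiv (k : DG3.perm.ker) :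
    kleinSign (kerEquiv k) = (DG3.typeHom k).left := by
  show kleinSignHom (kerEquiv k) = kerSignHom k
  unfold kerEquiv
  rw [MulEquiv.trans_apply, MulEquiv.trans_apply, MonoidHom.apply_ofInjective_symm]
  rfl

instance klein_normal : klein.Normal :=
  ⟨by decide +kernel⟩

lemma kerEquiv_conj (W : DG3) (k k' : DG3.perm.ker) (h : (k' : DG3) = W * k * W⁻¹) :
    (kerEquiv k' : Equiv.Perm (Fin 4)) = DG3.perm W * kerEquiv k * (DG3.perm W)⁻¹ := by
  have hk : (DG3.typeHom k).right = 1 := k.2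
  have hl : ∀ a b : SignedPerm, b.right = 1 → (a * b * a⁻¹).left = mulAutArrow a.right b.left := by
    intro a b hb
    simp only [SemidirectProduct.mul_left, SemidirectProduct.mul_right, hb, mul_one,
      SemidirectProduct.inv_left, ← MulAut.mul_apply, ← map_mul, mul_inv_cancel, map_one,
      MulAut.one_apply]
    rw [mul_comm a.left, mul_assoc, mul_inv_cancel, mul_one]
  have hs : kleinSign (kerEquiv k') =
      kleinSign (DG3.perm W * kerEquiv k * (DG3.perm W)⁻¹) := by
    rw [kleinSign_conj, kleinSign_kerEquiv, kleinSign_kerEquiv, h, map_mul, map_mul, map_inv,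
      hl _ _ hk]
    rfl
  exact congrArg Subtype.val (@kleinSignHom_injective (kerEquiv k')
    ⟨_, klein_normal.conj_mem _ (kerEquiv k).2 (DG3.perm W)⟩ hs)

/-! ### The extension -/

/-- The extension of `S_4` by the kernel. -/
def extension : GroupExtension DG3.perm.ker DG3 (Equiv.Perm (Fin 4)) where
  inl := DG3.perm.ker.subtype
  rightHom := DG3.perm
  inl_injective := Subtype.val_injective
  range_inl_eq_ker_rightHom := Subgroup.range_subtype _
  rightHom_surjective := DG3.perm_surjective

/-- The action of `S_4` on the kernel. -/
def kerAction : Equiv.Perm (Fin 4) →* MulAut DG3.perm.ker :=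
  (MulAut.congr kerEquiv.symm).toMonoidHom.comp MulAut.conjNormal

lemma kerEquiv_kerAction (σ : Equiv.Perm (Fin 4)) (k : DG3.perm.ker) :
    (kerEquiv (kerAction σ k) : Equiv.Perm (Fin 4)) = σ * kerEquiv k * σ⁻¹ := by
  have h : kerAction σ k = kerEquiv.symm (MulAut.conjNormal σ (kerEquiv k)) := rfl
  rw [h, MulEquiv.apply_symm_apply, MulAut.conjNormal_apply]

lemma kerAction_perm (W : DG3) : kerAction (DG3.perm W) = extension.conjAct W := by
  apply MulEquiv.ext
  intro k
  apply kerEquiv.injective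
  apply Subtype.ext
  rw [kerEquiv_kerAction]
  exact (kerEquiv_conj W k _ extension.inl_conjAct_comm).symm

set_option synthInstance.maxSize 512 in
/-- The relations for a square root of `1` over `(12)(30)`, which is even and maps `0` to `3`, have
no solution. -/
lemma prod_ne_one_of_invariant : ∀ s : Pair → ℤˣ,
    (∀ Q Q' : Pair, (Equiv.swap 1 2 * Equiv.swap 3 0 : Equiv.Perm (Fin 4)) • Q' = Q →
      s Q * s Q' = 1) →
    ∏ Q : Pair, (if 0 ∈ Q.1.1 then s Q else 1) = -1 →
    ∏ Q : Pair, (if 1 ∈ Q.1.1 then s Q else 1) = 1 → ∏ Q : Pair, s Q ≠ 1 := by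
  decide +kernel

lemma isEmpty_splitting : IsEmpty extension.Splitting := by
  refine ⟨fun s => ?_⟩
  let κ : Equiv.Perm (Fin 4) := Equiv.swap 1 2 * Equiv.swap 3 0
  have hκ : κ * κ = 1 := by decide +kernel
  have h1 : (DG3.typeHom (s κ)).right = κ := s.rightHom_splitting κ
  have h2 : DG3.typeHom (s κ) * DG3.typeHom (s κ) = 1 := by
    rw [← map_mul, ← map_mul, hκ, map_one, map_one]
  have h := DG3.admissible (s κ)
  refine prod_ne_one_of_invariant (DG3.typeHom (s κ)).left (fun Q Q' hQ => ?_) ?_ ?_ ?_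
  · have h3 := congrFun (congrArg SemidirectProduct.left h2) Q
    rw [SemidirectProduct.mul_left, h1] at h3
    rw [← inv_smul_eq_iff.2 hQ.symm]
    exact h3
  · rw [h.prod_mem, h1]; decide +kernel
  · rw [h.prod_mem, h1]; decide +kernel
  · rw [h.prod, h1]; decide +kernel

end

end TripleVB

end

theorem mainTheorem2 :
    -- `X`, `Y`, `Z` are invertible up to natural isomorphism, so generate the group `DG3`
    (∀ (k : Fin 4) (hk : k ≠ 0),
      IsUnit (TripleVB.FunctorClass.mk (TripleVB.dualizationCov k hk))) ∧
    -- `π W` is the permutation by which `W` acts on the labels of the building bundles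
    ∃ π : TripleVB.DG3 →* Equiv.Perm (Fin 4),
      (∀ (W : TripleVB.DG3) (F : CategoryTheory.Functor TripleVB.C TripleVB.C),
        TripleVB.FunctorClass.mk F = ((W : TripleVB.FunctorClassˣ) : TripleVB.FunctorClass) →
          ∀ E : TripleVB.C, (F.obj E).1 = (E.1.1, E.1.2 * π W)) ∧
      -- the short exact sequence, with `K_4` the kernel of `π`
      ∃ S : GroupExtension π.ker TripleVB.DG3 (Equiv.Perm (Fin 4)),
        S.inl = π.ker.subtype ∧ S.rightHom = π ∧
        -- conjugation makes `K_4` an `S_4`-module, isomorphic to the normal Klein subgroup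
        TripleVB.klein.Normal ∧
        (∃ α : Equiv.Perm (Fin 4) →* MulAut π.ker,
          (∀ g : TripleVB.DG3, α (π g) = S.conjAct g) ∧
          ∃ φ : π.ker ≃* TripleVB.klein, ∀ (σ : Equiv.Perm (Fin 4)) (k : π.ker),
            (φ (α σ k) : Equiv.Perm (Fin 4)) = σ * (φ k : Equiv.Perm (Fin 4)) * σ⁻¹) ∧
        -- the extension does not split
        IsEmpty S.Splitting := by
  open TripleVB in
  refine ⟨fun k hk => ⟨(DG3.gen k hk : FunctorClassˣ), rfl⟩, DG3.perm,
    fun W F hF E => (DG3.hasType hF).1 E, extension, rfl, rfl, klein_normal,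
    ⟨kerAction, kerAction_perm, kerEquiv, kerEquiv_kerAction⟩, isEmpty_splitting⟩
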